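/- **Model.** Base stations (BSs) form a homogeneous Poisson point process $\Phi=\{x_i\}_i$ of intensity $\lambda>0$ on $\mathbb{R}^2$; the typical user is at the origin $o$. Conditionally on $\Phi$, the links to the BSs are line-of-sight (LOS) independently of each other, a link of length $r$ with probability $h(r)\in[0,1]$ ($h$ measurable), and otherwise NLOS; $\Phi_L$ and $\Phi_N$ denote the LOS and NLOS BSs. The path losses are $l_L(r)=\beta r^{\alpha_L}$ (LOS) and $l_N(r)=\beta r^{\alpha_N}$ (NLOS) with $\beta,\alpha_L,\alpha_N>0$, so $l_L^{-1}(z)=(z/\beta)^{1/\alpha_L}$ and $l_N^{-1}(z)=(z/\beta)^{1/\alpha_N}$. The fading powers $F_i$ are i.i.d. exponential with unit mean (Rayleigh fading), independent of the locations and of the blockage. Let $P_b>0$ be the transmit power, $\sigma^2\ge 0$ the noise power, $M_{cs},N_{cs}\ge 1$ the numbers of directions searched by BSs and user, and $K_{cs}=\max(M_{cs},N_{cs})$. The user main lobe gain is $G(\theta)=\frac{2\pi}{\theta}\frac{\gamma}{\gamma+1}$ with $\gamma=\frac{2\pi}{C_0(2\pi-\theta)}$, $C_0>0$, and $G(2\pi)=1$.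 The typical BS sector is $S_1=\{x\in\mathbb{R}^2:\angle x\in[0,2\pi/K_{cs})\}$. Let $Z_1$ be the smallest path loss from the user to the BSs in $S_1$. The BS attaining it, with fading power $F_0$, is *detected* if $\mathrm{SINR}_{SS}(Z_1)>\Gamma_{cs}$, where $\Gamma_{cs}>0$ and $$\mathrm{SINR}_{SS}(Z_1)=\frac{F_0/Z_1}{\displaystyle\sum_{x_i\in\Phi_L\cap S_1,\ \|x_i\|>l_L^{-1}(Z_1)}\frac{F_i}{l_L(\|x_i\|)}+\sum_{x_j\in\Phi_N\cap S_1,\ \|x_j\|>l_N^{-1}(Z_1)}\frac{F_j}{l_N(\|x_j\|)}+\frac{\sigma^2}{P_bM_{cs}G(2\pi/N_{cs})}} .$$ Put $$V(z,T,\ell)=\exp\Bigl\{-2\pi \ell\Bigl(\int_{l_L^{-1}(z)}^{\infty}\frac{Tz\,h(r)\,r\,dr}{Tz+l_L(r)}+\int_{l_N^{-1}(z)}^{\infty}\frac{Tz(1-h(r))\,r\,dr}{Tz+l_N(r)}\Bigr)\Bigr\}\qquad(\exp(-\infty)=0),$$ $$\begin{aligned}f_{Z_1}(z)=\frac{2\pi\lambda}{K_{cs}}\Bigl[&\tfrac1{\alpha_L}\beta^{-2/\alpha_L}z^{2/\alpha_L-1}h\bigl(l_L^{-1}(z)\bigr)+\tfrac1{\alpha_N}\beta^{-2/\alpha_N}z^{2/\alpha_N-1}\bigl(1-h(l_N^{-1}(z))\bigr)\Bigr]\\&\times\exp\Bigl(-\tfrac{2\pi\lambda}{K_{cs}}\int_0^{l_L^{-1}(z)}h(r)r\,dr-\tfrac{2\pi\lambda}{K_{cs}}\int_0^{l_N^{-1}(z)}(1-h(r))r\,dr\Bigr).\end{aligned}$$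 **Lemma.** The random variable $Z_1$ has probability density function $f_{Z_1}$ on $(0,\infty)$. The conditional probability, given $Z_1=z$, that the BS with the smallest path loss in $S_1$ is detected is (for almost every value $z$ of $Z_1$) $$\tilde P_{M_{cs},N_{cs}}(z,\Gamma_{cs})=\exp\Bigl(-\frac{\Gamma_{cs}z\sigma^2}{P_bM_{cs}G(2\pi/N_{cs})}\Bigr)V\Bigl(z,\Gamma_{cs},\frac{\lambda}{K_{cs}}\Bigr),$$ and the probability that the BS with the smallest path loss in $S_1$ is detected is $$P_{M_{cs},N_{cs}}(\Gamma_{cs})=\int_0^\infty\tilde P_{M_{cs},N_{cs}}(z,\Gamma_{cs})\,f_{Z_1}(z)\,dz ,$$ where the integral converges. -/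

import Mathlib

open MeasureTheory ProbabilityTheory
open scoped ENNReal NNReal

noncomputable section

namespace MmWave

/-- The Euclidean plane, with its Euclidean norm and Lebesgue measure `volume`. The typical user is
at the origin. -/
abbrev Plane : Type := EuclideanSpace ℝ (Fin 2)

/-- The infinite sector with apex `u`: all points `x` for which the angle of `x - u` lies in
`[θ₁, θ₂)` (in polar coordinates). -/
def sector (u : Plane) (θ₁ θ₂ : ℝ) : Set Plane :=
  {x | ∃ r : ℝ, 0 < r ∧ ∃ φ ∈ Set.Ico θ₁ θ₂, x = u + !₂[r * Real.cos φ, r * Real.sin φ]}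

/-- The points `X 0, X 1, X 2, …` form a Poisson point process with intensity measure `Λ`: the
numbers of points in disjoint sets of finite `Λ`-measure are independent, and the number of points
in `B` is Poisson distributed with mean `Λ B`. -/
structure IsPoissonProcess {Ω E : Type*} [MeasurableSpace Ω] [MeasurableSpace E]
    (μ : Measure Ω) (X : ℕ → Ω → E) (Λ : Measure E) : Prop where
  measurable_point : ∀ i, Measurable (X i)
  counts : ∀ (n : ℕ) (B : Fin n → Set E) (k : Fin n → ℕ),
    (∀ a, MeasurableSet (B a)) → (∀ a, Λ (B a) ≠ ∞) → Pairwise (Function.onFun Disjoint B) →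
    μ (⋂ a, {ω | {i : ℕ | X i ω ∈ B a}.encard = (k a : ℕ∞)}) =
      ∏ a, poissonMeasure (Λ (B a)).toNNReal {k a}

/-- The network seen from the typical user: base stations `X i`, indicators `los i` telling whether
the link to `X i` is line-of-sight, and fading powers `F i`. -/
structure IsNetwork {Ω : Type*} [MeasurableSpace Ω] (μ : Measure Ω)
    (X : ℕ → Ω → Plane) (los : ℕ → Ω → Bool) (F : ℕ → Ω → ℝ) (lam : ℝ) (h : ℝ → ℝ) : Prop where
  /-- The base stations form a homogeneous Poisson point process of intensity `lam`. -/
  poisson : IsPoissonProcess μ X (ENNReal.ofReal lam • (volume : Measure Plane))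
  measurable_los : ∀ i, Measurable (los i)
  /-- Conditionally on the base station locations, the links are line-of-sight independently of
  each other, a link of length `r` with probability `h r`. -/
  blockage : ∀ (s : Finset ℕ) (b : ℕ → Bool) (A : Set (ℕ → Plane)), MeasurableSet A →
    μ {ω | (fun i => X i ω) ∈ A ∧ ∀ i ∈ s, los i ω = b i} =
      ∫⁻ ω in {ω | (fun i => X i ω) ∈ A},
        ∏ i ∈ s, ENNReal.ofReal (if b i = true then h ‖X i ω‖ else 1 - h ‖X i ω‖) ∂μ
  measurable_fading : ∀ i, Measurable (F i)
  /-- Rayleigh fading: the fading powers are i.i.d. exponential with unit mean … -/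
  fading_law : ∀ i, μ.map (F i) = expMeasure 1
  fading_indep : iIndepFun F μ
  /-- … and independent of the locations and of the blockage. -/
  fading_indep_network :
    IndepFun (fun ω i => F i ω) (fun ω => ((fun i => X i ω), (fun i => los i ω))) μ

/-- The deterministic system parameters. -/
structure Params where
  /-- base station intensity `λ` -/
  lam : ℝ
  /-- LOS probability as a function of the link length -/
  h : ℝ → ℝ
  /-- path loss at the reference distance -/
  beta : ℝ
  /-- LOS path loss exponent -/
  alphaL : ℝ
  /-- NLOS path loss exponent -/
  alphaN : ℝ
  /-- base station transmit power -/
  Pb : ℝ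
  /-- `sigma ^ 2` is the total thermal noise power -/
  sigma : ℝ
  /-- constant in the front-back power ratio of the user antenna -/
  C0 : ℝ
  /-- number of directions searched by the base stations in cell search -/
  Mcs : ℕ
  /-- number of directions searched by the user in cell search -/
  Ncs : ℕ

/-- Main lobe gain of a user beam of width `θ`, `(2π/θ) γ/(γ+1)` with front-back power ratio
`γ = 2π / (C₀ (2π - θ))`; for an omnidirectional beam, `θ = 2π`, the ratio is infinite and the gain
is `1`. -/
def mainLobeGain (C0 θ : ℝ) : ℝ :=
  if θ = 2 * Real.pi then 1
  else
    let γ := 2 * Real.pi / (C0 * (2 * Real.pi - θ))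
    2 * Real.pi / θ * (γ / (γ + 1))

namespace Params

variable (p : Params)

/-- The number of base station sectors. -/
def Kcs : ℕ := max p.Mcs p.Ncs

/-- The typical base station sector `S₁`. -/
def typicalSector : Set Plane := sector 0 0 (2 * Real.pi / p.Kcs)

/-- LOS path loss (linear scale) at distance `r`. -/
def lossL (r : ℝ) : ℝ := p.beta * r ^ p.alphaL

/-- NLOS path loss (linear scale) at distance `r`. -/
def lossN (r : ℝ) : ℝ := p.beta * r ^ p.alphaN

/-- Inverse function of `lossL`. -/
def invLossL (z : ℝ) : ℝ := (z / p.beta) ^ (1 / p.alphaL)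

/-- Inverse function of `lossN`. -/
def invLossN (z : ℝ) : ℝ := (z / p.beta) ^ (1 / p.alphaN)

/-- Product `P_b M_cs G(2π / N_cs)` of transmit power, base station gain and user gain. -/
def linkGain : ℝ := p.Pb * p.Mcs * mainLobeGain p.C0 (2 * Real.pi / p.Ncs)

/-- The special function `V(z, T, l)`. The integrals have nonnegative integrands and are taken in
`[0, ∞]`, with `exp (-∞) = 0`. -/
def V (z T l : ℝ) : ℝ :=
  (EReal.exp (-((ENNReal.ofReal (2 * Real.pi * l) *
    ((∫⁻ r in Set.Ioi (p.invLossL z), ENNReal.ofReal (T * z * p.h r * r / (T * z + p.lossL r))) +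
     (∫⁻ r in Set.Ioi (p.invLossN z),
        ENNReal.ofReal (T * z * (1 - p.h r) * r / (T * z + p.lossN r)))) : ℝ≥0∞) :
      EReal))).toReal

/-- The density `f_{Z₁}`. -/
def fZ (z : ℝ) : ℝ :=
  (2 * Real.pi * p.lam / p.Kcs * (1 / p.alphaL) * (1 / p.beta) ^ (2 / p.alphaL) *
      z ^ (2 / p.alphaL - 1) * p.h (p.invLossL z) *
      Real.exp (-(2 * Real.pi * p.lam / p.Kcs) * ∫ r in (0 : ℝ)..p.invLossL z, p.h r * r)) *
    Real.exp (-(2 * Real.pi * p.lam / p.Kcs) * ∫ r in (0 : ℝ)..p.invLossN z, (1 - p.h r) * r) +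
  (2 * Real.pi * p.lam / p.Kcs * (1 / p.alphaN) * (1 / p.beta) ^ (2 / p.alphaN) *
      z ^ (2 / p.alphaN - 1) * (1 - p.h (p.invLossN z)) *
      Real.exp (-(2 * Real.pi * p.lam / p.Kcs) * ∫ r in (0 : ℝ)..p.invLossN z, (1 - p.h r) * r)) *
    Real.exp (-(2 * Real.pi * p.lam / p.Kcs) * ∫ r in (0 : ℝ)..p.invLossL z, p.h r * r)

/-- The function `P̃(z, Γ)`. -/
def condProb (z Γ : ℝ) : ℝ :=
  Real.exp (-(Γ * z * p.sigma ^ 2 / p.linkGain)) * p.V z Γ (p.lam / p.Kcs)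

variable {Ω : Type*} (X : ℕ → Ω → Plane) (los : ℕ → Ω → Bool) (F : ℕ → Ω → ℝ)

/-- Path loss from the typical user to the `i`-th base station. -/
def pathLoss (i : ℕ) (ω : Ω) : ℝ :=
  if los i ω = true then p.lossL ‖X i ω‖ else p.lossN ‖X i ω‖

/-- `Z₁`, the smallest path loss from the typical user to the base stations in the typical sector
(which almost surely contains infinitely many base stations). -/
def minLoss (ω : Ω) : ℝ :=
  sInf {l | ∃ i, X i ω ∈ p.typicalSector ∧ l = p.pathLoss X los i ω}

/-- Interference from the LOS base stations of the sector with larger path loss than `Z₁`. -/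
def interferenceL (ω : Ω) : ℝ≥0∞ :=
  ∑' j : {j : ℕ // los j ω = true ∧ X j ω ∈ p.typicalSector ∧
      p.invLossL (p.minLoss X los ω) < ‖X j ω‖},
    ENNReal.ofReal (F j ω / p.lossL ‖X j ω‖)

/-- Interference from the NLOS base stations of the sector with larger path loss than `Z₁`. -/
def interferenceN (ω : Ω) : ℝ≥0∞ :=
  ∑' j : {j : ℕ // los j ω = false ∧ X j ω ∈ p.typicalSector ∧
      p.invLossN (p.minLoss X los ω) < ‖X j ω‖},
    ENNReal.ofReal (F j ω / p.lossN ‖X j ω‖)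

/-- The SINR of the synchronization signal when the base station with the smallest path loss in the
typical sector is the `i`-th one. -/
def sinr (i : ℕ) (ω : Ω) : ℝ≥0∞ :=
  ENNReal.ofReal (F i ω / p.minLoss X los ω) /
    (p.interferenceL X los F ω + p.interferenceN X los F ω +
      ENNReal.ofReal (p.sigma ^ 2 / p.linkGain))

/-- The event that the base station with the smallest path loss in the typical sector is detected,
that is, that the SINR of its synchronization signal exceeds `Γ`. -/
def detected (Γ : ℝ) : Set Ω :=
  {ω | ∃ i, X i ω ∈ p.typicalSector ∧ p.pathLoss X los i ω = p.minLoss X los ω ∧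
    ENNReal.ofReal Γ < p.sinr X los F i ω}

end Params

end MmWave

end

open MeasureTheory ProbabilityTheory Filter
open scoped ENNReal NNReal Topology

noncomputable section

namespace MmWave

/-! Fix a threshold `T` and a Borel set `B`. "The best base station is detected and `Z₁ ∈ B`" is, up
to a null set, the disjoint union over `i` of the events `detectionEvent`: base station `i`
minimises the path loss in the sector, its loss `z` lies in `B`, and `F i` exceeds `T z` times
interference plus noise. Given locations and link types, the exponential tail and the Laplace
transform `1 / (1 + s)` of the other fadings turn the last condition into a noise factor times the
product over `j ≠ i` of `(1 + T z / l_j)⁻¹`, taken over the sector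
(`measure_lt_fading_of_indepFun`). Minimality inserts the indicators of `z ≤ l_j`, so the whole is
again a product, with one factor `weight` per link (`indicator_serverSet`).

The expectation of a sum over points `x_i` of such products over the other points is given by the
reduced Campbell (Slivnyak–Mecke) formula: `∫ a(x) exp(-∫ (1 - w_x) dΛ) Λ(dx)`, with independent
marks averaged inside `w` (`IsPoissonProcess.palm`, `IsMarking.palm`). Here the exponent splits.
Links with loss below `z` have weight `0` and give the void probability in `f_{Z₁}`; the others have
`1 - w = T z / (T z + l)` and give `V`. Polar coordinates and the substitution `z = β r ^ α` then
yield `∫_B f_{Z₁} P̃` (`lintegral_serverWeight`). The case `T = 0` is the law of `Z₁`.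

The Campbell formula is derived from the joint law of the counts alone. For step functions it is the
generating function of independent Poisson variables and its derivative
(`IsPoissonProcess.lintegral_stepFun`); decreasing limits (`PalmFormula.iInf`) give general factors,
and a dyadic discretisation of the level `z` allows the factors to depend on the distinguished
point.

Adding the events requires that there be no ties. This comes from a first moment: the expected
number of minimisers is `∫ f_{Z₁} = 1` (`lintegral_ofReal_fZ`), and almost surely there is at least
one, hence exactly one (`ae_existsUnique_isServer`). The joint law of `Z₁` and detection then
determines the conditional expectation by testing on the sets `{Z₁ ∈ B}`. -/

/-! ### Exponentials and infinite products in `[0, ∞]`. -/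

/-- `exp (-x)` on `[0, ∞]`, with `exp (-∞) = 0`. -/
def expNeg (x : ℝ≥0∞) : ℝ≥0∞ := EReal.exp (-(x : EReal))

lemma expNeg_ofReal {x : ℝ} (hx : 0 ≤ x) : expNeg (ENNReal.ofReal x) = ENNReal.ofReal (Real.exp (-x)) := by
  rw [expNeg, EReal.coe_ennreal_ofReal, max_eq_left hx, ← EReal.coe_neg, EReal.exp_coe]

@[simp] lemma expNeg_zero : expNeg 0 = 1 := by simp [expNeg]

@[simp] lemma expNeg_top : expNeg ∞ = 0 := by simp [expNeg]

lemma expNeg_add (x y : ℝ≥0∞) : expNeg (x + y) = expNeg x * expNeg y := by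
  rcases eq_or_ne x ∞ with rfl | hx
  · simp
  rcases eq_or_ne y ∞ with rfl | hy
  · simp
  lift x to ℝ≥0 using hx
  lift y to ℝ≥0 using hy
  rw [← ENNReal.ofReal_coe_nnreal, ← ENNReal.ofReal_coe_nnreal,
    ← ENNReal.ofReal_add (NNReal.coe_nonneg x) (NNReal.coe_nonneg y),
    expNeg_ofReal (NNReal.coe_nonneg x), expNeg_ofReal (NNReal.coe_nonneg y),
    expNeg_ofReal (by positivity),
    ← ENNReal.ofReal_mul (by positivity), ← Real.exp_add]
  congr 2
  ring

lemma continuous_expNeg : Continuous expNeg := by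
  unfold expNeg
  exact (ENNReal.continuous_exp).comp (continuous_neg.comp continuous_coe_ennreal_ereal)

@[fun_prop] lemma measurable_expNeg : Measurable expNeg := continuous_expNeg.measurable

lemma antitone_expNeg : Antitone expNeg := fun x y h => by
  unfold expNeg
  apply EReal.exp_monotone
  simpa using h

lemma expNeg_le_one (x : ℝ≥0∞) : expNeg x ≤ 1 := by
  simpa using antitone_expNeg (zero_le (a := x))

lemma expNeg_ne_top (x : ℝ≥0∞) : expNeg x ≠ ∞ := ((expNeg_le_one x).trans_lt ENNReal.one_lt_top).ne

lemma expNeg_sum {ι : Type*} (s : Finset ι) (f : ι → ℝ≥0∞) :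
    expNeg (∑ i ∈ s, f i) = ∏ i ∈ s, expNeg (f i) := by
  classical
  induction s using Finset.induction_on with
  | empty => simp
  | insert a s ha ih => rw [Finset.sum_insert ha, Finset.prod_insert ha, expNeg_add, ih]

lemma expNeg_iSup {x : ℕ → ℝ≥0∞} (hx : Monotone x) : expNeg (⨆ n, x n) = ⨅ n, expNeg (x n) :=
  tendsto_nhds_unique ((continuous_expNeg.tendsto _).comp (tendsto_atTop_iSup hx))
    (tendsto_atTop_iInf fun _ _ h => antitone_expNeg (hx h))

/-- The bound by `1` keeps the limits finite, so the discontinuity of multiplication at `0 · ∞`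
plays no role. -/
lemma finsetProd_iInf {ι : Type*} (s : Finset ι) {f : ℕ → ι → ℝ≥0∞} (hf : Antitone f)
    (h1 : ∀ n i, f n i ≤ 1) : ∏ i ∈ s, ⨅ n, f n i = ⨅ n, ∏ i ∈ s, f n i := by
  refine tendsto_nhds_unique (ENNReal.tendsto_finsetProd_of_ne_top s
    (fun i _ => tendsto_atTop_iInf fun _ _ h => hf h i) fun i _ => ?_)
    (tendsto_atTop_iInf fun _ _ h => Finset.prod_le_prod' fun i _ => hf h i)
  exact ((iInf_le _ 0).trans (h1 0 i)).trans_lt ENNReal.one_lt_top |>.ne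

/-- The infinite product of the factors `f j ≤ 1` with `j ≠ i`. -/
def redProd (i : ℕ) (f : ℕ → ℝ≥0∞) : ℝ≥0∞ := ⨅ n, ∏ j ∈ (Finset.range n).erase i, f j

lemma antitone_redProd_aux (i : ℕ) {f : ℕ → ℝ≥0∞} (hf : ∀ j, f j ≤ 1) :
    Antitone fun n => ∏ j ∈ (Finset.range n).erase i, f j := fun _ _ h =>
  Finset.prod_le_prod_of_subset_of_le_one'
    (Finset.erase_subset_erase _ (Finset.range_mono h)) fun j _ _ => hf j

lemma redProd_le_one (i : ℕ) (f : ℕ → ℝ≥0∞) : redProd i f ≤ 1 :=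
  (iInf_le _ 0).trans (by simp)

lemma redProd_iInf (i : ℕ) {f : ℕ → ℕ → ℝ≥0∞} (hf : Antitone f) (h1 : ∀ n i, f n i ≤ 1) :
    redProd i (fun j => ⨅ n, f n j) = ⨅ n, redProd i (f n) := by
  unfold redProd
  rw [iInf_comm]
  exact iInf_congr fun k => finsetProd_iInf _ hf h1

lemma redProd_mono (i : ℕ) {f g : ℕ → ℝ≥0∞} (h : f ≤ g) : redProd i f ≤ redProd i g :=
  iInf_mono fun _ => Finset.prod_le_prod' fun j _ => h j

lemma measurable_redProd {α : Type*} [MeasurableSpace α] (i : ℕ) {f : ℕ → α → ℝ≥0∞}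
    (hf : ∀ j, Measurable (f j)) : Measurable fun x => redProd i fun j => f j x :=
  Measurable.iInf fun _ => Finset.measurable_fun_prod _ fun j _ => hf j

/-- Both sides are limits of the same partial expressions. This passes from the Laplace functional
of the interference to a product over base stations. -/
lemma redProd_expNeg (i : ℕ) (s : ℕ → ℝ≥0∞) :
    redProd i (fun j => expNeg (s j)) = expNeg (∑' j, if j = i then 0 else s j) := by
  have hm : Monotone fun n => ∑ j ∈ Finset.range n, (if j = i then 0 else s j) :=
    fun _ _ h => Finset.sum_le_sum_of_subset (Finset.range_mono h)
  rw [ENNReal.tsum_eq_iSup_nat, expNeg_iSup hm]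
  refine iInf_congr fun n => ?_
  rw [← expNeg_sum]
  congr 1
  rw [← Finset.filter_ne', Finset.sum_filter]
  refine Finset.sum_congr rfl fun j _ => ?_
  by_cases h : j = i <;> simp [h]

/-! ### Joint law of the counts and Poisson generating functions. -/

lemma encard_eq_tsum_indicator {E : Type*} (x : ℕ → E) (B : Set E) :
    (({i : ℕ | x i ∈ B}.encard : ℕ∞) : ℝ≥0∞) = ∑' i, B.indicator 1 (x i) := by
  rw [← ENNReal.tsum_set_one, tsum_subtype {i : ℕ | x i ∈ B} (fun _ => (1 : ℝ≥0∞))]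
  rfl

lemma measurableSet_encard_eq {Ω E : Type*} [MeasurableSpace Ω] [MeasurableSpace E]
    {X : ℕ → Ω → E} (hX : ∀ i, Measurable (X i)) {B : Set E} (hB : MeasurableSet B) (k : ℕ) :
    MeasurableSet {ω | {i : ℕ | X i ω ∈ B}.encard = (k : ℕ∞)} := by
  have h : {ω | {i : ℕ | X i ω ∈ B}.encard = (k : ℕ∞)} =
      {ω | ∑' i, B.indicator (1 : E → ℝ≥0∞) (X i ω) = k} := by
    ext ω
    simp only [Set.mem_ofPred_eq]
    rw [← encard_eq_tsum_indicator (fun i => X i ω) B]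
    norm_cast
  rw [h]
  refine measurableSet_eq_fun (Measurable.tsum fun i => ?_) measurable_const
  exact (measurable_one.indicator hB).comp (hX i)

namespace IsPoissonProcess

variable {Ω E : Type*} [MeasurableSpace Ω] [MeasurableSpace E] {μ : Measure Ω}
  {X : ℕ → Ω → E} {Λ : Measure E}

lemma counts_fintype (hX : IsPoissonProcess μ X Λ) {ι : Type*} [Fintype ι] (B : ι → Set E)
    (k : ι → ℕ) (hB : ∀ a, MeasurableSet (B a)) (hfin : ∀ a, Λ (B a) ≠ ∞)
    (hdis : Pairwise (Function.onFun Disjoint B)) :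
    μ (⋂ a, {ω | {i : ℕ | X i ω ∈ B a}.encard = (k a : ℕ∞)}) =
      ∏ a, poissonMeasure (Λ (B a)).toNNReal {k a} := by
  let e := (Fintype.equivFin ι).symm
  have h := hX.counts (Fintype.card ι) (fun a => B (e a)) (fun a => k (e a)) (fun a => hB _)
    (fun a => hfin _) (fun a b hab => hdis (e.injective.ne hab))
  rw [e.surjective.iInter_comp (fun a => {ω | {i : ℕ | X i ω ∈ B a}.encard = (k a : ℕ∞)})] at h
  rw [h, Equiv.prod_comp e (fun a => poissonMeasure (Λ (B a)).toNNReal {k a})]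

/-- The events prescribing all counts are disjoint and their probabilities, those of a product of
Poisson laws, add up to `1`. Configurations with an infinite count are therefore null, and `Φ` need
only be known off them. -/
lemma lintegral_counts [IsProbabilityMeasure μ] (hX : IsPoissonProcess μ X Λ) {ι : Type*}
    [Fintype ι] {B : ι → Set E} (hB : ∀ a, MeasurableSet (B a)) (hfin : ∀ a, Λ (B a) ≠ ∞)
    (hdis : Pairwise (Function.onFun Disjoint B)) (Φ : Ω → ℝ≥0∞) (G : (ι → ℕ) → ℝ≥0∞)
    (hΦ : ∀ ω k, (∀ a, {i : ℕ | X i ω ∈ B a}.encard = (k a : ℕ∞)) → Φ ω = G k) :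
    ∫⁻ ω, Φ ω ∂μ = ∫⁻ k, G k ∂(Measure.pi fun a => poissonMeasure (Λ (B a)).toNNReal) := by
  set S : (ι → ℕ) → Set Ω := fun k => ⋂ a, {ω | {i : ℕ | X i ω ∈ B a}.encard = (k a : ℕ∞)}
    with hS
  have hSm : ∀ k, MeasurableSet (S k) := fun k =>
    MeasurableSet.iInter fun a => measurableSet_encard_eq hX.measurable_point (hB a) _
  have hSd : Pairwise (Function.onFun Disjoint S) := by
    intro k l hkl
    refine Set.disjoint_left.2 fun ω h1 h2 => hkl (funext fun a => ?_)
    simp only [hS, Set.mem_iInter, Set.mem_ofPred_eq] at h1 h2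
    exact_mod_cast (h1 a).symm.trans (h2 a)
  have hμS : ∀ k, μ (S k) = Measure.pi (fun a => poissonMeasure (Λ (B a)).toNNReal) {k} :=
    fun k => by rw [Measure.pi_singleton, hX.counts_fintype B k hB hfin hdis]
  have huniv : μ (⋃ k, S k) = 1 := by
    rw [measure_iUnion hSd hSm]
    simp_rw [hμS]
    rw [← measure_iUnion (f := fun k : ι → ℕ => {k}) (fun a b hab => Set.disjoint_singleton.2 hab)
      (fun k => measurableSet_singleton k), Set.iUnion_of_singleton, measure_univ]
  have hae : (⋃ k, S k : Set Ω) =ᵐ[μ] Set.univ := by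
    rw [ae_eq_univ, ← compl_compl (⋃ k, S k)ᶜ, compl_compl,
      prob_compl_eq_zero_iff (MeasurableSet.iUnion hSm)]
    exact huniv
  rw [← setLIntegral_univ Φ, ← setLIntegral_congr hae, lintegral_iUnion hSm hSd,
    lintegral_countable']
  refine tsum_congr fun k => ?_
  rw [setLIntegral_congr_fun (g := fun _ => G k) (hSm k)
    (fun ω hω => hΦ ω k (by simpa [hS] using hω)), setLIntegral_const, hμS]

end IsPoissonProcess

lemma lintegral_pow_poissonMeasure (r : ℝ≥0) {c : ℝ≥0∞} (hc : c ≤ 1) :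
    ∫⁻ n, c ^ n ∂(poissonMeasure r) = expNeg (r * (1 - c)) := by
  lift c to ℝ≥0 using (hc.trans_lt ENNReal.one_lt_top).ne
  have hc' : (c : ℝ) ≤ 1 := by exact_mod_cast hc
  have h := (NormedSpace.expSeries_div_hasSum_exp ((r * c : ℝ))).mul_left (Real.exp (-r))
  rw [← Real.exp_eq_exp_ℝ, ← Real.exp_add] at h
  have e1 : (r : ℝ≥0∞) * (1 - c) = ENNReal.ofReal (r * (1 - c)) := by
    rw [ENNReal.ofReal_mul (by positivity), ENNReal.ofReal_sub _ (by positivity)]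
    simp
  rw [e1, expNeg_ofReal (mul_nonneg (by positivity) (by linarith)), lintegral_countable',
    show -((r : ℝ) * (1 - c)) = -r + r * c by ring, ← h.tsum_eq,
    ENNReal.ofReal_tsum_of_nonneg (fun n => by positivity) h.summable]
  refine tsum_congr fun n => ?_
  rw [poissonMeasure_singleton, ← ENNReal.ofReal_coe_nnreal, ← ENNReal.ofReal_pow (by positivity),
    ← ENNReal.ofReal_mul (by positivity)]
  congr 1
  rw [mul_pow]
  ring

/-- The derivative of the generating function, obtained from `(n + 1) P(n + 1) = r P(n)`. The
truncated `n - 1` is harmless because the term `n = 0` vanishes. -/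
lemma lintegral_mul_pow_poissonMeasure (r : ℝ≥0) {c : ℝ≥0∞} (hc : c ≤ 1) :
    ∫⁻ n, n * c ^ (n - 1) ∂(poissonMeasure r) = r * expNeg (r * (1 - c)) := by
  rw [← lintegral_pow_poissonMeasure r hc, lintegral_countable', lintegral_countable',
    tsum_eq_zero_add' ENNReal.summable]
  simp only [CharP.cast_eq_zero, zero_mul, zero_add, Nat.add_sub_cancel]
  rw [← ENNReal.tsum_mul_left]
  refine tsum_congr fun n => ?_
  have : ((n + 1 : ℕ) : ℝ≥0∞) * poissonMeasure r {n + 1} = r * poissonMeasure r {n} := by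
    rw [poissonMeasure_singleton, poissonMeasure_singleton, ← ENNReal.ofReal_natCast,
      ← ENNReal.ofReal_mul (by positivity), ← ENNReal.ofReal_coe_nnreal,
      ← ENNReal.ofReal_mul (by positivity)]
    congr 1
    rw [Nat.factorial_succ]
    push_cast
    field_simp
    ring
  calc _ = ((n + 1 : ℕ) : ℝ≥0∞) * poissonMeasure r {n + 1} * c ^ n := by ring
    _ = _ := by rw [this]; ring

lemma lintegral_pi_prod {ι : Type*} [Fintype ι] (ν : ι → Measure ℕ)
    [∀ a, IsProbabilityMeasure (ν a)] (g : ι → ℕ → ℝ≥0∞) :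
    ∫⁻ k, ∏ a, g a (k a) ∂(Measure.pi ν) = ∏ a, ∫⁻ n, g a n ∂(ν a) := by
  have hind : iIndepFun (fun a (k : ι → ℕ) => g a (k a)) (Measure.pi ν) :=
    iIndepFun_pi fun a => (Measurable.of_discrete (f := g a)).aemeasurable
  have := lintegral_prod_eq_prod_lintegral_of_indepFun Finset.univ
    (fun a (k : ι → ℕ) => g a (k a)) hind
    (fun a => (Measurable.of_discrete (f := g a)).comp (measurable_pi_apply a))
  rw [this]
  refine Finset.prod_congr rfl fun a _ => ?_
  exact (measurePreserving_eval ν a).lintegral_comp (Measurable.of_discrete (f := g a))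

/-! ### Multiplicative functionals of step functions. -/

open Classical in
/-- The function with value `c a` on `B a` (for disjoint sets `B a`) and value `1` elsewhere. -/
def stepFun {E ι : Type*} [Fintype ι] (B : ι → Set E) (c : ι → ℝ≥0∞) (x : E) : ℝ≥0∞ :=
  ∏ a, if x ∈ B a then c a else 1

section stepFun

variable {E ι : Type*} [Fintype ι] {B : ι → Set E} {c : ι → ℝ≥0∞}

lemma stepFun_le_one (hc : ∀ a, c a ≤ 1) (x : E) : stepFun B c x ≤ 1 :=
  Finset.prod_le_one' fun a _ => by split_ifs <;> simp [hc]

lemma stepFun_of_mem (hdis : Pairwise (Function.onFun Disjoint B)) {x : E} {a : ι} (hx : x ∈ B a) :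
    stepFun B c x = c a := by
  classical
  unfold stepFun
  rw [Finset.prod_eq_single a, if_pos hx]
  · exact fun b _ hb => if_neg (Set.disjoint_left.1 (hdis hb.symm) hx)
  · simp

lemma stepFun_of_notMem {x : E} (hx : ∀ a, x ∉ B a) : stepFun B c x = 1 :=
  Finset.prod_eq_one fun a _ => if_neg (hx a)

lemma measurable_stepFun [MeasurableSpace E] (hB : ∀ a, MeasurableSet (B a)) :
    Measurable (stepFun B c) := by
  classical
  exact Finset.measurable_fun_prod _ fun a _ => Measurable.ite (hB a) measurable_const measurable_const

lemma lintegral_one_sub_stepFun [MeasurableSpace E] (Λ : Measure E) (hB : ∀ a, MeasurableSet (B a))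
    (hdis : Pairwise (Function.onFun Disjoint B)) :
    ∫⁻ x, (1 - stepFun B c x) ∂Λ = ∑ a, Λ (B a) * (1 - c a) := by
  have h : ∀ x, 1 - stepFun B c x = ∑ a, (B a).indicator (fun _ => 1 - c a) x := by
    intro x
    by_cases hx : ∃ a, x ∈ B a
    · obtain ⟨a, ha⟩ := hx
      rw [stepFun_of_mem hdis ha, Finset.sum_eq_single a, Set.indicator_of_mem ha]
      · exact fun b _ hb => Set.indicator_of_notMem (Set.disjoint_left.1 (hdis hb.symm) ha) _
      · simp
    · push Not at hx
      rw [stepFun_of_notMem hx, Finset.sum_eq_zero, tsub_self]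
      exact fun a _ => Set.indicator_of_notMem (hx a) _
  simp_rw [h]
  rw [lintegral_finsetSum _ fun a _ => measurable_const.indicator (hB a)]
  exact Finset.sum_congr rfl fun a _ => by rw [lintegral_indicator_const (hB a), mul_comm]

-- Only finitely many points lie in the cells, so the partial products are eventually constant: each
-- cell contributes `c a` to the power of its count, and the omitted index lowers the count of its
-- own cell by one.
open Classical in
lemma redProd_stepFun (hc : ∀ a, c a ≤ 1) (hdis : Pairwise (Function.onFun Disjoint B)) {x : ℕ → E} {k : ι → ℕ}
    (hk : ∀ a, {i : ℕ | x i ∈ B a}.encard = (k a : ℕ∞)) {i : ℕ} {b : ι} (hi : x i ∈ B b) :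
    redProd i (fun j => stepFun B c (x j)) = ∏ a, c a ^ (if a = b then k a - 1 else k a) := by
  have hfin : ∀ a, {i : ℕ | x i ∈ B a}.Finite := fun a =>
    Set.finite_of_encard_eq_coe (hk a)
  have hcard : ∀ a, (hfin a).toFinset.card = k a := fun a => by
    have := hk a
    rw [(hfin a).encard_eq_coe_toFinset_card] at this
    exact_mod_cast this
  obtain ⟨M, hM⟩ := ((Finset.univ.biUnion fun a => (hfin a).toFinset)).exists_nat_subset_range
  have hM' : ∀ a j, x j ∈ B a → j < M := fun a j hj => Finset.mem_range.1 (hM (by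
    simp only [Finset.mem_biUnion, Finset.mem_univ, true_and, Set.Finite.mem_toFinset]
    exact ⟨a, hj⟩))
  have key : ∀ n, M ≤ n → ∏ j ∈ (Finset.range n).erase i, stepFun B c (x j) =
      ∏ a, c a ^ (if a = b then k a - 1 else k a) := by
    intro n hn
    unfold stepFun
    rw [Finset.prod_comm]
    refine Finset.prod_congr rfl fun a _ => ?_
    rw [Finset.prod_ite, Finset.prod_const_one, mul_one, Finset.prod_const]
    congr 1
    have e : ((Finset.range n).erase i).filter (fun j => x j ∈ B a) = (hfin a).toFinset.erase i := by
      ext j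
      simp only [Finset.mem_filter, Finset.mem_erase, Finset.mem_range, Set.Finite.mem_toFinset,
        Set.mem_ofPred_eq]
      exact ⟨fun h => ⟨h.1.1, h.2⟩, fun h => ⟨⟨h.1, (hM' a j h.2).trans_le hn⟩, h.2⟩⟩
    rw [e]
    split_ifs with hab
    · subst hab
      rw [Finset.card_erase_of_mem (by simpa using hi), hcard]
    · rw [Finset.erase_eq_of_notMem, hcard]
      simpa using Set.disjoint_left.1 (hdis (Ne.symm hab)) hi
  unfold redProd
  refine le_antisymm ((iInf_le _ M).trans_eq (key M le_rfl)) (le_iInf fun n => ?_)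
  exact (key _ (le_max_left M n)).symm.trans_le
    (antitone_redProd_aux i (fun j => stepFun_le_one hc (x j)) (le_max_right M n))

end stepFun

/-! ### The reduced Campbell formula: step functions and decreasing limits. -/

section Palm

variable {Ω E : Type*} [MeasurableSpace Ω] [MeasurableSpace E] {μ : Measure Ω}
  {X : ℕ → Ω → E} {Λ : Measure E}

-- On prescribed counts `k` the sum over `i` equals `k b` times a product in which the exponent of
-- cell `b` is `k b - 1`. By independence the integral factors: cell `b` yields the derivative of
-- its generating function, every other cell the generating function itself.
open Classical in
lemma IsPoissonProcess.lintegral_stepFun [IsProbabilityMeasure μ] (hX : IsPoissonProcess μ X Λ)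
    {ι : Type*} [Fintype ι] {B : ι → Set E} {c : ι → ℝ≥0∞} (hB : ∀ a, MeasurableSet (B a))
    (hfin : ∀ a, Λ (B a) ≠ ∞) (hdis : Pairwise (Function.onFun Disjoint B)) (hc : ∀ a, c a ≤ 1)
    (b : ι) :
    ∑' i, ∫⁻ ω, (B b).indicator 1 (X i ω) * redProd i (fun j => stepFun B c (X j ω)) ∂μ =
      Λ (B b) * expNeg (∫⁻ y, (1 - stepFun B c y) ∂Λ) := by
  have hmeas : ∀ i, Measurable fun ω =>
      (B b).indicator 1 (X i ω) * redProd i (fun j => stepFun B c (X j ω)) := fun i =>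
    ((measurable_one.indicator (hB b)).comp (hX.measurable_point i)).mul
      (measurable_redProd i fun j => (measurable_stepFun hB).comp (hX.measurable_point j))
  rw [← lintegral_tsum fun i => (hmeas i).aemeasurable]
  let g : ι → ℕ → ℝ≥0∞ := fun a n => if a = b then n * c a ^ (n - 1) else c a ^ n
  rw [hX.lintegral_counts hB hfin hdis _ (fun k => ∏ a, g a (k a)), lintegral_pi_prod]
  · have h1 : ∀ a, ∫⁻ n, g a n ∂(poissonMeasure (Λ (B a)).toNNReal) =
        (if a = b then Λ (B a) else 1) * expNeg (Λ (B a) * (1 - c a)) := by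
      intro a
      have h2 : ((Λ (B a)).toNNReal : ℝ≥0∞) = Λ (B a) := ENNReal.coe_toNNReal (hfin a)
      by_cases hab : a = b
      · simp only [g, if_pos hab]
        rw [lintegral_mul_pow_poissonMeasure _ (hc a), h2]
      · simp only [g, if_neg hab]
        rw [lintegral_pow_poissonMeasure _ (hc a), h2, one_mul]
    simp_rw [h1]
    rw [Finset.prod_mul_distrib, lintegral_one_sub_stepFun Λ hB hdis, expNeg_sum,
      Finset.prod_ite_eq' Finset.univ b, if_pos (Finset.mem_univ b)]
  · intro ω k hk
    have h1 : ∀ i, (B b).indicator 1 (X i ω) * redProd i (fun j => stepFun B c (X j ω)) =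
        (B b).indicator 1 (X i ω) * ∏ a, c a ^ (if a = b then k a - 1 else k a) := by
      intro i
      by_cases hi : X i ω ∈ B b
      · rw [redProd_stepFun (x := fun j => X j ω) hc hdis hk hi]
      · simp [Set.indicator_of_notMem hi]
    simp_rw [h1]
    rw [ENNReal.tsum_mul_right, ← encard_eq_tsum_indicator (fun i => X i ω), hk b]
    have h2 : ∀ a, g a (k a) =
        (if a = b then (k a : ℝ≥0∞) else 1) * c a ^ (if a = b then k a - 1 else k a) := by
      intro a
      by_cases hab : a = b <;> simp [g, hab]
    simp_rw [h2]
    rw [Finset.prod_mul_distrib, Finset.prod_ite_eq' Finset.univ b, if_pos (Finset.mem_univ b)]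
    simp

/-- The reduced Campbell formula for the multiplicative functional with factors `u x y`. -/
def PalmFormula (μ : Measure Ω) (X : ℕ → Ω → E) (Λ : Measure E) (u : E → E → ℝ≥0∞) : Prop :=
  ∀ A, MeasurableSet A → Λ A ≠ ∞ →
    ∑' i, ∫⁻ ω, A.indicator 1 (X i ω) * redProd i (fun j => u (X i ω) (X j ω)) ∂μ =
      ∫⁻ x in A, expNeg (∫⁻ y, (1 - u x y) ∂Λ) ∂Λ

/-- The level sets of `s` are cut along `A`, so that `A` is a union of cells, and the one-cell
formula is summed over the cells inside `A`. Outside `S` the factor is `1`, which lets every cell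
have finite measure. -/
lemma palmFormula_step [IsProbabilityMeasure μ] (hX : IsPoissonProcess μ X Λ)
    (s : SimpleFunc E ℝ≥0∞) (hs : ∀ x, s x ≤ 1) {S : Set E} (hS : MeasurableSet S)
    (hSfin : Λ S ≠ ∞) (hsS : ∀ x ∉ S, s x = 1) :
    PalmFormula μ X Λ (fun _ => s) := by
  intro A hA hAfin
  let B : (s.range × Bool) → Set E := fun a =>
    (s ⁻¹' {a.1.1}) ∩ (if a.2 = true then A else S \ A)
  let c : (s.range × Bool) → ℝ≥0∞ := fun a => a.1.1
  have hB : ∀ a, MeasurableSet (B a) := fun a =>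
    (s.measurableSet_fiber _).inter (by split_ifs; exacts [hA, hS.diff hA])
  have hfin : ∀ a, Λ (B a) ≠ ∞ := fun a => by
    refine measure_ne_top_of_subset Set.inter_subset_right ?_
    split_ifs
    exacts [hAfin, measure_ne_top_of_subset Set.sdiff_subset hSfin]
  have hc : ∀ a, c a ≤ 1 := by
    rintro ⟨⟨v, hv⟩, b⟩
    obtain ⟨x, rfl⟩ := SimpleFunc.mem_range.1 hv
    exact hs x
  have hdis : Pairwise (Function.onFun Disjoint B) := by
    rintro ⟨⟨v, hv⟩, b⟩ ⟨⟨w, hw⟩, d⟩ hne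
    refine Set.disjoint_left.2 fun x hx hy => hne ?_
    obtain ⟨h1, h2⟩ := hx
    obtain ⟨h3, h4⟩ := hy
    have h5 : v = w := h1.symm.trans h3
    subst h5
    cases b <;> cases d <;> simp_all
  have hsB : ∀ x, s x = stepFun B c x := by
    intro x
    by_cases hxA : x ∈ A
    · rw [stepFun_of_mem hdis (a := (⟨s x, SimpleFunc.mem_range_self s x⟩, true))]
      exact ⟨rfl, by simpa using hxA⟩
    by_cases hxS : x ∈ S
    · rw [stepFun_of_mem hdis (a := (⟨s x, SimpleFunc.mem_range_self s x⟩, false))]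
      exact ⟨rfl, by simp [hxA, hxS]⟩
    rw [hsS x hxS, stepFun_of_notMem]
    rintro ⟨v, b⟩ ⟨-, h2⟩
    cases b <;> simp_all
  have hAB : ∀ x, A.indicator (1 : E → ℝ≥0∞) x = ∑ v : s.range, (B (v, true)).indicator 1 x := by
    intro x
    rw [Finset.sum_eq_single ⟨s x, SimpleFunc.mem_range_self s x⟩]
    · by_cases hxA : x ∈ A
      · rw [Set.indicator_of_mem hxA, Set.indicator_of_mem]
        exact ⟨rfl, by simpa using hxA⟩
      · rw [Set.indicator_of_notMem hxA, Set.indicator_of_notMem]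
        exact fun h => hxA (by simpa using h.2)
    · rintro ⟨v, hv⟩ - hne
      exact Set.indicator_of_notMem (fun h => hne (Subtype.ext h.1.symm)) _
    · simp
  have hred : Measurable (stepFun B c) := measurable_stepFun hB
  have hmeas : ∀ (v : s.range) i, Measurable fun ω =>
      (B (v, true)).indicator 1 (X i ω) * redProd i (fun j => stepFun B c (X j ω)) := fun v i =>
    ((measurable_one.indicator (hB _)).comp (hX.measurable_point i)).mul
      (measurable_redProd i fun j => hred.comp (hX.measurable_point j))
  simp_rw [hsB, hAB, Finset.sum_mul]
  simp_rw [lintegral_finsetSum _ fun v _ => hmeas v _]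
  rw [Summable.tsum_finsetSum fun _ _ => ENNReal.summable]
  simp_rw [hX.lintegral_stepFun hB hfin hdis hc]
  rw [← Finset.sum_mul, setLIntegral_const, mul_comm]
  congr 1
  have h := lintegral_congr (μ := Λ) hAB
  rw [lintegral_indicator_one hA, lintegral_finsetSum _ fun v _ => measurable_one.indicator (hB _)]
    at h
  simp_rw [lintegral_indicator_one (hB _)] at h
  exact h.symm

/-- The Campbell formula with all factors equal to `1`; it supplies the integrable majorant for
decreasing limits. -/
lemma IsPoissonProcess.tsum_measure [IsProbabilityMeasure μ] (hX : IsPoissonProcess μ X Λ)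
    {A : Set E} (hA : MeasurableSet A) (hfin : Λ A ≠ ∞) :
    ∑' i, ∫⁻ ω, A.indicator 1 (X i ω) ∂μ = Λ A := by
  have h := palmFormula_step hX (SimpleFunc.const E 1) (fun _ => le_rfl) (S := ∅)
    MeasurableSet.empty (by simp) (fun _ _ => rfl) A hA hfin
  simpa [redProd] using h

/-- The infimum passes through the product, the expectation and the sum over `i` on the left, and
through the inner and outer integrals on the right. Decreasing limits need a finite starting value:
everything is dominated by the indicator of `A`, of total mass `Λ A`. -/
lemma PalmFormula.iInf [IsProbabilityMeasure μ] (hX : IsPoissonProcess μ X Λ) [SFinite Λ]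
    {u : ℕ → E → E → ℝ≥0∞} (hu : ∀ n, Measurable (Function.uncurry (u n))) (hanti : Antitone u)
    (h1 : ∀ n x y, u n x y ≤ 1) (h : ∀ n, PalmFormula μ X Λ (u n)) :
    PalmFormula μ X Λ (fun x y => ⨅ n, u n x y) := by
  intro A hA hfin
  have hui : ∀ n x, Measurable (u n x) := fun n x => (hu n).comp measurable_prodMk_left
  set f : ℕ → ℕ → Ω → ℝ≥0∞ := fun n i ω =>
    A.indicator 1 (X i ω) * redProd i (fun j => u n (X i ω) (X j ω)) with hf
  have hA1 : ∀ i, Measurable fun ω => A.indicator (1 : E → ℝ≥0∞) (X i ω) := fun i =>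
    (measurable_one.indicator hA).comp (hX.measurable_point i)
  have hfm : ∀ n i, Measurable (f n i) := fun n i =>
    (hA1 i).mul (measurable_redProd i fun j =>
      (hu n).comp ((hX.measurable_point i).prodMk (hX.measurable_point j)))
  have hfa : ∀ i ω, Antitone fun n => f n i ω := fun i ω n m hnm =>
    mul_le_mul_right (redProd_mono i fun j => hanti hnm _ _) _
  have hfle : ∀ n i ω, f n i ω ≤ A.indicator 1 (X i ω) := fun n i ω =>
    (mul_le_mul_right (redProd_le_one _ _) _).trans_eq (mul_one _)
  have hfint : ∀ n i, ∫⁻ ω, f n i ω ∂μ ≤ ∫⁻ ω, A.indicator 1 (X i ω) ∂μ := fun n i =>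
    lintegral_mono fun ω => hfle n i ω
  have hL : ∀ i ω, A.indicator 1 (X i ω) * redProd i (fun j => ⨅ n, u n (X i ω) (X j ω)) =
      ⨅ n, f n i ω := by
    intro i ω
    rw [redProd_iInf i (f := fun n j => u n (X i ω) (X j ω)) (fun _ _ h j => hanti h _ _)
      (fun n j => h1 n _ _)]
    by_cases hx : X i ω ∈ A <;> simp [f, hx]
  have hsum : ∑' i, ∫⁻ ω, A.indicator 1 (X i ω) ∂μ = Λ A := hX.tsum_measure hA hfin
  simp_rw [hL]
  have hin : ∀ i, ∫⁻ ω, ⨅ n, f n i ω ∂μ = ⨅ n, ∫⁻ ω, f n i ω ∂μ := by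
    intro i
    refine lintegral_iInf (fun n => hfm n i) (fun n m h ω => hfa i ω h) ?_
    refine ne_top_of_le_ne_top ?_ (hfint 0 i)
    exact ne_top_of_le_ne_top (hsum ▸ hfin) (ENNReal.le_tsum i)
  simp_rw [hin]
  -- The sum over `i` is an integral against counting measure, so monotone convergence applies to it
  -- as well.
  rw [← lintegral_count, lintegral_iInf (fun n => Measurable.of_discrete)
    (fun n m hnm i => lintegral_mono fun ω => hfa i ω hnm)]
  swap
  · rw [lintegral_count]
    exact ne_top_of_le_ne_top (hsum ▸ hfin) (ENNReal.tsum_le_tsum fun i => hfint 0 i)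
  simp_rw [lintegral_count]
  have hR : ∀ x, expNeg (∫⁻ y, (1 - ⨅ n, u n x y) ∂Λ) = ⨅ n, expNeg (∫⁻ y, (1 - u n x y) ∂Λ) := by
    intro x
    simp_rw [ENNReal.sub_iInf]
    rw [lintegral_iSup (fun n => (hui n x).const_sub 1)
      (fun n m hnm y => tsub_le_tsub_left (hanti hnm x y) 1)]
    exact expNeg_iSup fun n m hnm => lintegral_mono fun y => tsub_le_tsub_left (hanti hnm x y) 1
  simp_rw [hR]
  rw [lintegral_iInf]
  · exact iInf_congr fun n => h n A hA hfin
  · exact fun n => measurable_expNeg.comp (Measurable.lintegral_prod_right' ((hu n).const_sub 1))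
  · exact fun n m hnm x => antitone_expNeg
      (lintegral_mono fun y => tsub_le_tsub_left (hanti hnm x y) 1)
  · refine ne_top_of_le_ne_top hfin ((lintegral_mono fun x => expNeg_le_one _).trans ?_)
    simp

end Palm

/-! ### The reduced Campbell formula: factors depending on the distinguished point. -/

section Palm

variable {Ω E : Type*} [MeasurableSpace Ω] [MeasurableSpace E] {μ : Measure Ω}
  {X : ℕ → Ω → E} {Λ : Measure E}

/-- The measure on the left-hand side of the reduced Campbell formula. -/
def palmMeasure (μ : Measure Ω) (X : ℕ → Ω → E) (u : E → E → ℝ≥0∞) : Measure E :=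
  Measure.sum fun i =>
    (μ.withDensity fun ω => redProd i fun j => u (X i ω) (X j ω)).map (X i)

lemma measurable_redProd_uncurry (hX : ∀ i, Measurable (X i)) {u : E → E → ℝ≥0∞}
    (hu : Measurable (Function.uncurry u)) (i : ℕ) :
    Measurable fun ω => redProd i fun j => u (X i ω) (X j ω) :=
  measurable_redProd i fun j => hu.comp ((hX i).prodMk (hX j))

lemma lintegral_palmMeasure (hX : ∀ i, Measurable (X i)) {u : E → E → ℝ≥0∞}
    (hu : Measurable (Function.uncurry u)) {a : E → ℝ≥0∞} (ha : Measurable a) :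
    ∫⁻ x, a x ∂(palmMeasure μ X u) =
      ∑' i, ∫⁻ ω, a (X i ω) * redProd i (fun j => u (X i ω) (X j ω)) ∂μ := by
  rw [palmMeasure, lintegral_sum_measure]
  refine tsum_congr fun i => ?_
  rw [lintegral_map ha (hX i), lintegral_withDensity_eq_lintegral_mul _
    (measurable_redProd_uncurry hX hu i) (g := fun ω => a (X i ω)) (ha.comp (hX i))]
  exact lintegral_congr fun ω => mul_comm _ _

/-- As an equality of measures the formula may be checked on the pieces of a countable partition. -/
lemma palmFormula_iff (hX : ∀ i, Measurable (X i)) {u : E → E → ℝ≥0∞}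
    (hu : Measurable (Function.uncurry u)) :
    PalmFormula μ X Λ u ↔ ∀ A, MeasurableSet A → Λ A ≠ ∞ → palmMeasure μ X u A =
      Λ.withDensity (fun x => expNeg (∫⁻ y, (1 - u x y) ∂Λ)) A := by
  refine forall_congr' fun A => forall_congr' fun hA => forall_congr' fun _ => ?_
  rw [← lintegral_indicator_one hA, lintegral_palmMeasure hX hu (measurable_one.indicator hA),
    withDensity_apply _ hA]

/-- On each piece `κ = k` the factors no longer depend on the distinguished point, so the formula
for `v k` applies there. -/
lemma palmFormula_of_countable [SFinite Λ] (hX : ∀ i, Measurable (X i)) {κ : E → ℤ}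
    (hκ : Measurable κ) {v : ℤ → E → ℝ≥0∞} (hv : ∀ k, Measurable (v k))
    (h : ∀ k, PalmFormula μ X Λ (fun _ => v k)) :
    PalmFormula μ X Λ (fun x y => v (κ x) y) := by
  have hvm : Measurable (Function.uncurry fun x y => v (κ x) y) := by
    have : Measurable fun p : ℤ × E => v p.1 p.2 := measurable_from_prod_countable_right hv
    exact this.comp ((hκ.comp measurable_fst).prodMk measurable_snd)
  rw [palmFormula_iff hX hvm]
  intro A hA hfin
  set S : ℤ → Set E := fun k => A ∩ κ ⁻¹' {k} with hS
  have hSm : ∀ k, MeasurableSet (S k) := fun k => hA.inter (hκ (measurableSet_singleton k))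
  have hSd : Pairwise (Function.onFun Disjoint S) := fun k l hkl =>
    Set.disjoint_left.2 fun x h1 h2 => hkl (h1.2.symm.trans h2.2)
  have hSA : ⋃ k, S k = A := by
    rw [← Set.inter_iUnion, ← Set.preimage_iUnion, Set.iUnion_of_singleton]
    simp
  rw [← hSA, measure_iUnion hSd hSm, measure_iUnion hSd hSm]
  refine tsum_congr fun k => ?_
  have hk := h k (S k) (hSm k) (measure_ne_top_of_subset Set.inter_subset_left hfin)
  rw [withDensity_apply _ (hSm k), ← lintegral_indicator_one (hSm k),
    lintegral_palmMeasure hX hvm (measurable_one.indicator (hSm k))]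
  rw [setLIntegral_congr_fun (g := fun _ => expNeg (∫⁻ y, (1 - v k y) ∂Λ)) (hSm k), ← hk]
  · refine tsum_congr fun i => lintegral_congr fun ω => ?_
    by_cases hx : X i ω ∈ S k
    · rw [show κ (X i ω) = k from hx.2]
    · simp [Set.indicator_of_notMem hx]
  · intro x hx
    simp only [show κ x = k from hx.2]

/-- `1 - u` is an increasing limit of simple functions supported on sets of finite measure, hence
`u` is a decreasing limit of factors covered by `palmFormula_step`. -/
lemma palmFormula_const [IsProbabilityMeasure μ] (hX : IsPoissonProcess μ X Λ) [SigmaFinite Λ]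
    {u : E → ℝ≥0∞} (hu : Measurable u) (h1 : ∀ x, u x ≤ 1) :
    PalmFormula μ X Λ (fun _ => u) := by
  set f : E → ℝ≥0∞ := fun x => 1 - u x with hf
  have hfm : Measurable f := hu.const_sub 1
  set S := spanningSets Λ
  have hSm : ∀ n, MeasurableSet (S n) := fun n => measurableSet_spanningSets Λ n
  set t : ℕ → SimpleFunc E ℝ≥0∞ := fun n =>
    SimpleFunc.const E 1 - (SimpleFunc.eapprox f n).restrict (S n) with ht
  have htx : ∀ n x, t n x = 1 - (S n).indicator (SimpleFunc.eapprox f n) x := fun n x => by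
    simp [ht, SimpleFunc.restrict_apply _ (hSm n)]
  have hmono : ∀ x, Monotone fun n => (S n).indicator (SimpleFunc.eapprox f n) x := by
    intro x n m hnm
    refine (Set.indicator_le_indicator_of_subset (monotone_spanningSets Λ hnm)
      (fun _ => zero_le) x).trans ?_
    exact Set.indicator_le_indicator (SimpleFunc.monotone_eapprox f hnm x)
  have hsup : ∀ x, ⨆ n, (S n).indicator (SimpleFunc.eapprox f n) x = f x := by
    intro x
    refine le_antisymm (iSup_le fun n => ?_) ?_
    · rw [← SimpleFunc.iSup_eapprox_apply hfm x]
      exact (Set.indicator_le_self _ _ _).trans (le_iSup (fun n => SimpleFunc.eapprox f n x) n)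
    · rw [← SimpleFunc.iSup_eapprox_apply hfm x]
      refine iSup_le fun n => ?_
      obtain ⟨m, hm⟩ : ∃ m, x ∈ S m := by
        exact Set.mem_iUnion.1 ((iUnion_spanningSets Λ).symm ▸ Set.mem_univ x)
      refine le_trans ?_ (le_iSup _ (max n m))
      rw [Set.indicator_of_mem (monotone_spanningSets Λ (le_max_right n m) hm)]
      exact SimpleFunc.monotone_eapprox f (le_max_left n m) x
  have hinf : (fun (_ : E) x => ⨅ n, t n x) = fun _ => u := by
    funext _ x
    simp_rw [htx]
    rw [← ENNReal.sub_iSup ENNReal.one_ne_top, hsup, hf]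
    exact ENNReal.sub_sub_cancel ENNReal.one_ne_top (h1 x)
  rw [← hinf]
  refine PalmFormula.iInf hX (u := fun n _ => t n)
    (fun n => (t n).measurable.comp measurable_snd) ?_ ?_ ?_
  · intro n m hnm _ x
    simp only [htx]
    exact tsub_le_tsub_left (hmono x hnm) 1
  · intro n _ x
    rw [htx]
    exact tsub_le_self
  · refine fun n => palmFormula_step hX (t n) (fun x => by rw [htx]; exact tsub_le_self) (hSm n)
      (measure_spanningSets_lt_top Λ n).ne fun x hx => ?_
    rw [htx, Set.indicator_of_notMem hx, tsub_zero]

/-- Dyadic approximation of a real number from below. -/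
def dyadicFloor (n : ℕ) (z : ℝ) : ℝ := ⌊2 ^ n * z⌋ / 2 ^ n

lemma dyadicFloor_le (n : ℕ) (z : ℝ) : dyadicFloor n z ≤ z := by
  rw [dyadicFloor, div_le_iff₀ (by positivity), mul_comm]
  exact Int.floor_le _

lemma monotone_dyadicFloor (z : ℝ) : Monotone fun n => dyadicFloor n z := by
  refine monotone_nat_of_le_succ fun n => ?_
  unfold dyadicFloor
  rw [div_le_div_iff₀ (by positivity) (by positivity), pow_succ]
  have h : ⌊(2 : ℝ) ^ n * z⌋ * 2 ≤ ⌊(2 : ℝ) ^ n * 2 * z⌋ := by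
    rw [Int.le_floor]
    push_cast
    have := Int.floor_le ((2 : ℝ) ^ n * z)
    linarith
  have h' : (⌊(2 : ℝ) ^ n * z⌋ : ℝ) * 2 ≤ ⌊(2 : ℝ) ^ n * 2 * z⌋ := by exact_mod_cast h
  nlinarith [show (0 : ℝ) < 2 ^ n by positivity]

lemma tendsto_dyadicFloor (z : ℝ) : Tendsto (fun n => dyadicFloor n z) atTop (𝓝[≤] z) := by
  refine tendsto_nhdsWithin_iff.2 ⟨?_, Eventually.of_forall fun n => dyadicFloor_le n z⟩
  have h1 : Tendsto (fun n : ℕ => z - (1 / 2 : ℝ) ^ n) atTop (𝓝 z) := by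
    simpa using (tendsto_pow_atTop_nhds_zero_of_lt_one (by norm_num : (0 : ℝ) ≤ 1 / 2)
      (by norm_num)).const_sub z
  refine tendsto_of_tendsto_of_tendsto_of_le_of_le h1 tendsto_const_nhds (fun n => ?_)
    fun n => dyadicFloor_le n z
  have h2 := Int.lt_floor_add_one ((2 : ℝ) ^ n * z)
  simp only [dyadicFloor]
  rw [le_div_iff₀ (by positivity), one_div, inv_pow, sub_mul, inv_mul_cancel₀ (by positivity)]
  linarith

/-- The reduced Campbell formula for a Poisson process, for multiplicative functionals depending on
the distinguished point through a level `z`, monotonically and left-continuously. -/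
theorem IsPoissonProcess.palm [IsProbabilityMeasure μ] (hX : IsPoissonProcess μ X Λ)
    [SigmaFinite Λ] {z : E → ℝ} (hz : Measurable z) {U : ℝ → E → ℝ≥0∞}
    (hU : Measurable (Function.uncurry U)) (h1 : ∀ s y, U s y ≤ 1) (hanti : Antitone U)
    (hcont : ∀ y s, ContinuousWithinAt (fun s => U s y) (Set.Iic s) s)
    {a : E → ℝ≥0∞} (ha : Measurable a) :
    ∑' i, ∫⁻ ω, a (X i ω) * redProd i (fun j => U (z (X i ω)) (X j ω)) ∂μ =
      ∫⁻ x, a x * expNeg (∫⁻ y, (1 - U (z x) y) ∂Λ) ∂Λ := by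
  have hUs : ∀ s, Measurable (U s) := fun s => hU.comp measurable_prodMk_left
  have huz : Measurable (Function.uncurry fun x y => U (z x) y) :=
    hU.comp ((hz.comp measurable_fst).prodMk measurable_snd)
  -- The dyadic levels increase to `z x`, so the antitone `U` decreases along them, and left
  -- continuity identifies the limit.
  have hinf : (fun x y => U (z x) y) = fun x y => ⨅ n, U (dyadicFloor n (z x)) y := by
    funext x y
    exact tendsto_nhds_unique ((hcont y (z x)).tendsto.comp (tendsto_dyadicFloor (z x)))
      (tendsto_atTop_iInf fun n m hnm => hanti (monotone_dyadicFloor (z x) hnm) y)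
  have hfl : ∀ n : ℕ, Measurable fun x => ⌊2 ^ n * z x⌋ := fun n =>
    Int.measurable_floor.comp (hz.const_mul _)
  have hpalm : PalmFormula μ X Λ (fun x y => U (z x) y) := by
    rw [hinf]
    refine PalmFormula.iInf hX (fun n => ?_) (fun n m hnm x y =>
      hanti (monotone_dyadicFloor (z x) hnm) y) (fun n x y => h1 _ _) fun n => ?_
    · refine hU.comp (Measurable.prodMk ?_ measurable_snd)
      exact ((measurable_from_top (f := fun k : ℤ => (k : ℝ))).comp
        ((hfl n).comp measurable_fst)).div_const _
    · exact palmFormula_of_countable hX.measurable_point (hfl n)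
        (v := fun k => U ((k : ℝ) / 2 ^ n)) (fun k => hUs _)
        fun k => palmFormula_const hX (hUs _) (h1 _)
  rw [palmFormula_iff hX.measurable_point huz] at hpalm
  have hdm : Measurable fun x => expNeg (∫⁻ y, (1 - U (z x) y) ∂Λ) :=
    measurable_expNeg.comp (Measurable.lintegral_prod_right' (huz.const_sub 1))
  have heq : palmMeasure μ X (fun x y => U (z x) y) =
      Λ.withDensity (fun x => expNeg (∫⁻ y, (1 - U (z x) y) ∂Λ)) := by
    -- Both measures agree on sets of finite intensity; `A` is cut into countably many such pieces.
    ext A hA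
    set S : ℕ → Set E := fun n => A ∩ disjointed (spanningSets Λ) n with hS
    have hSm : ∀ n, MeasurableSet (S n) := fun n =>
      hA.inter (MeasurableSet.disjointed (measurableSet_spanningSets Λ) n)
    have hSd : Pairwise (Function.onFun Disjoint S) := fun n m hnm =>
      (disjoint_disjointed (spanningSets Λ) hnm).mono Set.inter_subset_right Set.inter_subset_right
    have hSA : ⋃ n, S n = A := by
      rw [← Set.inter_iUnion, iUnion_disjointed, iUnion_spanningSets, Set.inter_univ]
    rw [← hSA, measure_iUnion hSd hSm, measure_iUnion hSd hSm]
    refine tsum_congr fun n => hpalm _ (hSm n) ?_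
    exact measure_ne_top_of_subset (Set.inter_subset_right.trans (disjointed_subset _ n))
      (measure_spanningSets_lt_top Λ n).ne
  rw [← lintegral_palmMeasure hX.measurable_point huz ha, heq,
    lintegral_withDensity_eq_lintegral_mul _ hdm ha]
  exact lintegral_congr fun x => mul_comm _ _

end Palm

/-! ### Independent marks: averaging over the link types. -/

section Marks

/-- A mark pattern on `s` is encoded by the subset `t` of indices marked `true`. -/
lemma prod_bool_eq_sum_powerset {ι : Type*} [DecidableEq ι] (s : Finset ι)
    (c : ι → Bool → ℝ≥0∞) :
    ∏ i ∈ s, ∑ b, c i b = ∑ t ∈ s.powerset, ∏ i ∈ s, c i (decide (i ∈ t)) := by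
  simp_rw [Fintype.sum_bool]
  rw [Finset.prod_add]
  refine Finset.sum_congr rfl fun t ht => ?_
  rw [← Finset.prod_sdiff (Finset.mem_powerset.1 ht), mul_comm]
  congr 1
  · exact Finset.prod_congr rfl fun i hi => by simp [(Finset.mem_sdiff.1 hi).2]
  · exact Finset.prod_congr rfl fun i hi => by simp [hi]

variable {Ω E : Type*} [MeasurableSpace Ω] [MeasurableSpace E] {μ : Measure Ω}
  {X : ℕ → Ω → E} {los : ℕ → Ω → Bool} {q : Bool → E → ℝ≥0∞}

/-- Given the points `X`, the marks `los` are independent, with `q b x` the probability that the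
mark of the point `x` is `b`. -/
def IsMarking (μ : Measure Ω) (X : ℕ → Ω → E) (los : ℕ → Ω → Bool) (q : Bool → E → ℝ≥0∞) : Prop :=
  ∀ (s : Finset ℕ) (b : ℕ → Bool) (A : Set (ℕ → E)), MeasurableSet A →
    μ {ω | (fun i => X i ω) ∈ A ∧ ∀ i ∈ s, los i ω = b i} =
      ∫⁻ ω in {ω | (fun i => X i ω) ∈ A}, ∏ i ∈ s, q (b i) (X i ω) ∂μ

/-- The marking property says that two measures on point sequences agree: the law restricted to a
mark pattern, and the law weighted by the probability of that pattern. -/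
lemma IsMarking.setLIntegral (hm : IsMarking μ X los q) (hX : ∀ i, Measurable (X i))
    (hq : ∀ b, Measurable (q b)) (s : Finset ℕ) (b : ℕ → Bool)
    {φ : (ℕ → E) → ℝ≥0∞} (hφ : Measurable φ) :
    ∫⁻ ω in {ω | ∀ i ∈ s, los i ω = b i}, φ (fun i => X i ω) ∂μ =
      ∫⁻ ω, φ (fun i => X i ω) * ∏ i ∈ s, q (b i) (X i ω) ∂μ := by
  have hξ : Measurable fun ω i => X i ω := measurable_pi_lambda _ hX
  have hprod : Measurable fun ω => ∏ i ∈ s, q (b i) (X i ω) :=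
    Finset.measurable_fun_prod _ fun i _ => (hq _).comp (hX i)
  have hmap : (μ.restrict {ω | ∀ i ∈ s, los i ω = b i}).map (fun ω i => X i ω) =
      (μ.withDensity fun ω => ∏ i ∈ s, q (b i) (X i ω)).map (fun ω i => X i ω) := by
    ext A hA
    rw [Measure.map_apply hξ hA, Measure.map_apply hξ hA, Measure.restrict_apply (hξ hA),
      withDensity_apply _ (hξ hA)]
    exact hm s b A hA
  rw [← lintegral_map hφ hξ, hmap, lintegral_map hφ hξ,
    lintegral_withDensity_eq_lintegral_mul _ hprod (g := fun ω => φ fun i => X i ω) (hφ.comp hξ)]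
  exact lintegral_congr fun ω => mul_comm _ _

lemma IsMarking.lintegral_prod (hm : IsMarking μ X los q) (hX : ∀ i, Measurable (X i))
    (hlos : ∀ i, Measurable (los i)) (hq : ∀ b, Measurable (q b)) (s : Finset ℕ)
    {g : ℕ → (ℕ → E) → Bool → ℝ≥0∞} (hg : ∀ j b, Measurable fun x => g j x b) :
    ∫⁻ ω, ∏ j ∈ s, g j (fun i => X i ω) (los j ω) ∂μ =
      ∫⁻ ω, ∏ j ∈ s, ∑ b, q b (X j ω) * g j (fun i => X i ω) b ∂μ := by
  classical
  have hξ : Measurable fun ω i => X i ω := measurable_pi_lambda _ hX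
  have hLm : ∀ t : Finset ℕ, MeasurableSet {ω | ∀ i ∈ s, los i ω = decide (i ∈ t)} := fun t => by
    have : {ω | ∀ i ∈ s, los i ω = decide (i ∈ t)} =
        ⋂ i ∈ s, los i ⁻¹' {decide (i ∈ t)} := by
      ext ω
      simp
    rw [this]
    exact Finset.measurableSet_biInter _ fun i _ => hlos i (measurableSet_singleton _)
  have hgm : ∀ t : Finset ℕ, Measurable fun x => ∏ j ∈ s, g j x (decide (j ∈ t)) := fun t =>
    Finset.measurable_fun_prod _ fun j _ => hg j _
  have h1 : ∀ ω, ∏ j ∈ s, g j (fun i => X i ω) (los j ω) =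
      ∑ t ∈ s.powerset, {ω | ∀ i ∈ s, los i ω = decide (i ∈ t)}.indicator
        (fun ω => ∏ j ∈ s, g j (fun i => X i ω) (decide (j ∈ t))) ω := by
    intro ω
    have : ∀ j, g j (fun i => X i ω) (los j ω) =
        ∑ b, (if los j ω = b then 1 else 0) * g j (fun i => X i ω) b := fun j => by
      cases los j ω <;> simp
    simp_rw [this]
    rw [prod_bool_eq_sum_powerset]
    refine Finset.sum_congr rfl fun t _ => ?_
    rw [Finset.prod_mul_distrib]
    by_cases h : ∀ i ∈ s, los i ω = decide (i ∈ t)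
    · rw [Set.indicator_of_mem (by exact h), Finset.prod_eq_one fun i hi => if_pos (h i hi),
        one_mul]
    · rw [Set.indicator_of_notMem (by exact h)]
      push Not at h
      obtain ⟨i, hi, hne⟩ := h
      rw [Finset.prod_eq_zero hi (if_neg hne), zero_mul]
  simp_rw [h1, prod_bool_eq_sum_powerset]
  have hgξ : ∀ t : Finset ℕ,
      Measurable fun ω => ∏ j ∈ s, g j (fun i => X i ω) (decide (j ∈ t)) := fun t =>
    (hgm t).comp hξ
  have hqg : ∀ t : Finset ℕ, Measurable fun ω => ∏ j ∈ s,
      q (decide (j ∈ t)) (X j ω) * g j (fun i => X i ω) (decide (j ∈ t)) := fun t =>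
    Finset.measurable_fun_prod _ fun j _ => ((hq _).comp (hX j)).mul ((hg j _).comp hξ)
  rw [lintegral_finsetSum _ fun t _ => (hgξ t).indicator (hLm t),
    lintegral_finsetSum _ fun t _ => hqg t]
  refine Finset.sum_congr rfl fun t _ => ?_
  rw [lintegral_indicator (hLm t), hm.setLIntegral hX hq s (fun i => decide (i ∈ t)) (hgm t)]
  refine lintegral_congr fun ω => ?_
  rw [Finset.prod_mul_distrib, mul_comm]

lemma lintegral_mul_redProd [IsFiniteMeasure μ] {a : Ω → ℝ≥0∞} (ha : Measurable a)
    (ha1 : ∀ ω, a ω ≤ 1) (i : ℕ) {f : ℕ → Ω → ℝ≥0∞} (hf : ∀ j, Measurable (f j))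
    (hf1 : ∀ j ω, f j ω ≤ 1) :
    ∫⁻ ω, a ω * redProd i (fun j => f j ω) ∂μ =
      ⨅ n, ∫⁻ ω, a ω * ∏ j ∈ (Finset.range n).erase i, f j ω ∂μ := by
  have hm : ∀ n, Measurable fun ω => a ω * ∏ j ∈ (Finset.range n).erase i, f j ω := fun n =>
    ha.mul (Finset.measurable_fun_prod _ fun j _ => hf j)
  rw [← lintegral_iInf hm]
  · refine lintegral_congr fun ω => ?_
    exact ENNReal.mul_iInf fun h => absurd h ((ha1 ω).trans_lt ENNReal.one_lt_top).ne
  · exact fun n m hnm ω => mul_le_mul_right (antitone_redProd_aux i (fun j => hf1 j ω) hnm) _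
  · refine ne_top_of_le_ne_top (measure_ne_top μ Set.univ) ?_
    rw [← setLIntegral_univ, ← setLIntegral_one]
    refine lintegral_mono fun ω => ?_
    exact mul_le_one' (ha1 ω) (Finset.prod_le_one' fun j _ => hf1 j ω)

/-- Conditioning on the mark of `i` and averaging the other marks independently replaces each factor
by its mean over the mark. Finite products come first; the infinite product is their decreasing
limit. -/
lemma IsMarking.lintegral_redProd [IsProbabilityMeasure μ] (hm : IsMarking μ X los q)
    (hX : ∀ i, Measurable (X i))
    (hlos : ∀ i, Measurable (los i)) (hq : ∀ b, Measurable (q b)) (hq1 : ∀ x, ∑ b, q b x = 1)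
    {a : E → Bool → ℝ≥0∞} (ha : ∀ b, Measurable fun x => a x b) (ha1 : ∀ x b, a x b ≤ 1)
    {w : E → Bool → E → Bool → ℝ≥0∞} (hw : ∀ b c, Measurable fun p : E × E => w p.1 b p.2 c)
    (hw1 : ∀ x b y c, w x b y c ≤ 1) (i : ℕ) :
    ∫⁻ ω, a (X i ω) (los i ω) * redProd i (fun j => w (X i ω) (los i ω) (X j ω) (los j ω)) ∂μ =
      ∑ b, ∫⁻ ω, q b (X i ω) * a (X i ω) b *
        redProd i (fun j => ∑ c, q c (X j ω) * w (X i ω) b (X j ω) c) ∂μ := by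
  classical
  have hqle : ∀ b x, q b x ≤ 1 := fun b x => by
    rw [← hq1 x]
    exact Finset.single_le_sum (f := fun b => q b x) (fun _ _ => zero_le) (Finset.mem_univ b)
  have hbar : ∀ b j ω, ∑ c, q c (X j ω) * w (X i ω) b (X j ω) c ≤ 1 := fun b j ω => by
    rw [← hq1 (X j ω)]
    exact Finset.sum_le_sum fun c _ => (mul_le_mul_right (hw1 _ _ _ _) _).trans_eq (mul_one _)
  have hind : ∀ b, Measurable fun ω => if los i ω = b then (1 : ℝ≥0∞) else 0 := fun b =>
    Measurable.ite (hlos i (measurableSet_singleton b)) measurable_const measurable_const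
  have hwj : ∀ b j c, Measurable fun ω => w (X i ω) b (X j ω) c := fun b j c =>
    (hw b c).comp ((hX i).prodMk (hX j))
  have hwl : ∀ b j, Measurable fun ω => w (X i ω) b (X j ω) (los j ω) := fun b j => by
    have : (fun ω => w (X i ω) b (X j ω) (los j ω)) = fun ω =>
        if los j ω = true then w (X i ω) b (X j ω) true else w (X i ω) b (X j ω) false := by
      funext ω
      cases los j ω <;> simp
    rw [this]
    exact Measurable.ite (hlos j (measurableSet_singleton true)) (hwj b j true) (hwj b j false)
  have hsplit : ∀ ω, a (X i ω) (los i ω) *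
      redProd i (fun j => w (X i ω) (los i ω) (X j ω) (los j ω)) =
      ∑ b, ((if los i ω = b then 1 else 0) * a (X i ω) b) *
        redProd i (fun j => w (X i ω) b (X j ω) (los j ω)) := fun ω => by
    cases los i ω <;> simp
  have haX : ∀ b, Measurable fun ω => a (X i ω) b := fun b => (ha b).comp (hX i)
  have hqX : ∀ b j, Measurable fun ω => q b (X j ω) := fun b j => (hq b).comp (hX j)
  simp_rw [hsplit]
  rw [lintegral_finsetSum _ fun b _ => ((hind b).fun_mul (haX b)).fun_mul
    (measurable_redProd i fun j => hwl b j)]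
  refine Finset.sum_congr rfl fun b _ => ?_
  rw [lintegral_mul_redProd ((hind b).fun_mul (haX b)) (fun ω => mul_le_one'
      (by split_ifs <;> simp) (ha1 _ _)) i (hwl b) (fun j ω => hw1 _ _ _ _),
    lintegral_mul_redProd ((hqX b i).fun_mul (haX b)) (fun ω => mul_le_one' (hqle _ _) (ha1 _ _)) i
      (f := fun j ω => ∑ c, q c (X j ω) * w (X i ω) b (X j ω) c)
      (fun j => Finset.measurable_fun_sum _ fun c _ => (hqX c j).fun_mul (hwj b j c)) (hbar b)]
  refine iInf_congr fun n => ?_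
  -- The distinguished index is treated as one more factor, carrying `a` and the indicator of its
  -- mark, so that `IsMarking.lintegral_prod` handles all indices at once.
  let g : ℕ → (ℕ → E) → Bool → ℝ≥0∞ := fun j x c =>
    if j = i then (if c = b then 1 else 0) * a (x i) b else w (x i) b (x j) c
  have hg : ∀ j c, Measurable fun x => g j x c := by
    intro j c
    by_cases hj : j = i
    · simp only [g, if_pos hj]
      exact measurable_const.mul ((ha b).comp (measurable_pi_apply i))
    · simp only [g, if_neg hj]
      exact (hw b c).comp (f := fun x : ℕ → E => (x i, x j))
        ((measurable_pi_apply i).prodMk (measurable_pi_apply j))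
  have h := hm.lintegral_prod hX hlos hq (insert i ((Finset.range n).erase i)) hg
  simp_rw [Finset.prod_insert (Finset.notMem_erase i _)] at h
  convert h using 2
  · funext ω
    congr 1
    · simp [g]
    · refine Finset.prod_congr rfl fun j hj => ?_
      simp [g, Finset.ne_of_mem_erase hj]
  · funext ω
    congr 1
    · cases b <;> simp [g]
    · refine Finset.prod_congr rfl fun j hj => ?_
      simp [g, Finset.ne_of_mem_erase hj]

/-- The reduced Campbell formula for an independently marked Poisson process. -/
theorem IsMarking.palm [IsProbabilityMeasure μ] {Λ : Measure E} [SigmaFinite Λ]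
    (hm : IsMarking μ X los q) (hX : IsPoissonProcess μ X Λ)
    (hlos : ∀ i, Measurable (los i)) (hq : ∀ b, Measurable (q b)) (hq1 : ∀ x, ∑ b, q b x = 1)
    {a : E → Bool → ℝ≥0∞} (ha : ∀ b, Measurable fun x => a x b) (ha1 : ∀ x b, a x b ≤ 1)
    {z : E → Bool → ℝ} (hz : ∀ b, Measurable fun x => z x b)
    {w : ℝ → E → Bool → ℝ≥0∞} (hw : ∀ c, Measurable fun p : ℝ × E => w p.1 p.2 c)
    (hw1 : ∀ s y c, w s y c ≤ 1) (hanti : Antitone w)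
    (hcont : ∀ y c s, ContinuousWithinAt (fun s => w s y c) (Set.Iic s) s) :
    ∑' i, ∫⁻ ω, a (X i ω) (los i ω) *
        redProd i (fun j => w (z (X i ω) (los i ω)) (X j ω) (los j ω)) ∂μ =
      ∑ b, ∫⁻ x, q b x * a x b * expNeg (∫⁻ y, (1 - ∑ c, q c y * w (z x b) y c) ∂Λ) ∂Λ := by
  have hqle : ∀ b x, q b x ≤ 1 := fun b x => by
    rw [← hq1 x]
    exact Finset.single_le_sum (f := fun b => q b x) (fun _ _ => zero_le) (Finset.mem_univ b)
  simp_rw [hm.lintegral_redProd hX.measurable_point hlos hq hq1 ha ha1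
    (w := fun x b y c => w (z x b) y c)
    (fun b c => (hw c).comp (((hz b).comp measurable_fst).prodMk measurable_snd))
    (fun x b y c => hw1 _ _ _)]
  rw [Summable.tsum_finsetSum fun _ _ => ENNReal.summable]
  refine Finset.sum_congr rfl fun b _ => ?_
  refine hX.palm (hz b) (U := fun s y => ∑ c, q c y * w s y c) ?_ ?_ ?_ ?_
    ((hq b).mul (ha b))
  · exact Finset.measurable_fun_sum _ fun c _ => ((hq c).comp measurable_snd).mul (hw c)
  · intro s y
    rw [← hq1 y]
    exact Finset.sum_le_sum fun c _ => (mul_le_mul_right (hw1 _ _ _) _).trans_eq (mul_one _)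
  · exact fun s t hst y => Finset.sum_le_sum fun c _ => mul_le_mul_right (hanti hst y c) _
  · intro y s
    refine tendsto_finsetSum _ fun c _ => ?_
    exact ENNReal.Tendsto.const_mul (hcont y c s)
      (Or.inr ((hqle c y).trans_lt ENNReal.one_lt_top).ne)

end Marks

/-! ### Exponential fading: tails and Laplace transforms. -/

section Fading

lemma measurable_ennrealTsum {α : Type*} {m : MeasurableSpace α} {f : ℕ → α → ℝ≥0∞}
    (hf : ∀ j, Measurable (f j)) : Measurable fun x => ∑' j, f j x :=
  Measurable.tsum hf

instance : IsProbabilityMeasure (expMeasure 1) := isProbabilityMeasure_expMeasure one_pos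

lemma ae_nonneg_expMeasure : ∀ᵐ x ∂(expMeasure 1), 0 ≤ x := by
  have h : expMeasure 1 (Set.Iio 0) = 0 := by
    rw [expMeasure, gammaMeasure, withDensity_apply _ measurableSet_Iio]
    exact lintegral_exponentialPDF_of_nonpos le_rfl
  rw [ae_iff]
  convert h using 2
  ext x
  simp

lemma expMeasure_Ioi {c : ℝ} (hc : 0 ≤ c) :
    expMeasure 1 (Set.Ioi c) = ENNReal.ofReal (Real.exp (-c)) := by
  have h1 : expMeasure 1 (Set.Iic c) = ENNReal.ofReal (1 - Real.exp (-c)) := by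
    rw [← ofReal_cdf, cdf_expMeasure_eq one_pos, if_pos hc, one_mul]
  rw [← Set.compl_Iic, prob_compl_eq_one_sub measurableSet_Iic, h1, ← ENNReal.ofReal_one,
    ← ENNReal.ofReal_sub]
  · congr 1
    ring
  · simpa using hc

lemma expMeasure_lt_ofReal (c : ℝ≥0∞) :
    expMeasure 1 {x | c < ENNReal.ofReal x} = expNeg c := by
  rcases eq_or_ne c ∞ with rfl | hc
  · simp
  rw [← ENNReal.ofReal_toReal hc, expNeg_ofReal ENNReal.toReal_nonneg,
    ← expMeasure_Ioi ENNReal.toReal_nonneg]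
  congr 1
  ext x
  simp only [Set.mem_ofPred_eq, Set.mem_Ioi]
  exact ENNReal.ofReal_lt_ofReal_iff_of_nonneg ENNReal.toReal_nonneg

lemma lintegral_expNeg_expMeasure (s : ℝ≥0) :
    ∫⁻ x, expNeg (s * ENNReal.ofReal x) ∂(expMeasure 1) = (1 + (s : ℝ≥0∞))⁻¹ := by
  have hs : (0 : ℝ) < 1 + s := by positivity
  have h := lintegral_exponentialPDF_eq_one hs
  have hm : Measurable (exponentialPDF 1) := (measurable_exponentialPDFReal 1).ennreal_ofReal
  have hm2 : Measurable (exponentialPDF (1 + s)) :=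
    (measurable_exponentialPDFReal (1 + s)).ennreal_ofReal
  have hE : Measurable fun x => expNeg (s * ENNReal.ofReal x) :=
    measurable_expNeg.comp (ENNReal.measurable_ofReal.const_mul _)
  have key : ∀ x, exponentialPDF 1 x * expNeg (s * ENNReal.ofReal x) =
      (1 + (s : ℝ≥0∞))⁻¹ * exponentialPDF (1 + s) x := by
    intro x
    rcases lt_or_ge x 0 with hx | hx
    · simp [exponentialPDF_of_neg hx]
    · rw [exponentialPDF_of_nonneg hx, exponentialPDF_of_nonneg hx, ← ENNReal.ofReal_coe_nnreal,
        ← ENNReal.ofReal_mul (NNReal.coe_nonneg s),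
        expNeg_ofReal (mul_nonneg (NNReal.coe_nonneg s) hx), ← ENNReal.ofReal_one,
        ← ENNReal.ofReal_add zero_le_one (NNReal.coe_nonneg s), ← ENNReal.ofReal_inv_of_pos hs,
        ← ENNReal.ofReal_mul (by positivity), ← ENNReal.ofReal_mul (by positivity)]
      congr 1
      rw [show 1 * Real.exp (-(1 * x)) * Real.exp (-(s * x)) = Real.exp (-((1 + s) * x)) by
        rw [one_mul, ← Real.exp_add]; ring_nf]
      field_simp
  have e : expMeasure 1 = volume.withDensity (exponentialPDF 1) := rfl
  rw [e, lintegral_withDensity_eq_lintegral_mul _ hm hE]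
  simp only [Pi.mul_apply]
  simp_rw [key]
  rw [lintegral_const_mul _ hm2, h, mul_one]

variable {Ω : Type*} [MeasurableSpace Ω] {μ : Measure Ω} {F : ℕ → Ω → ℝ}

/-- Independent exponential variables: the probability that one of them exceeds a positive linear
combination of the others plus a constant. -/
lemma measure_lt_fading (hF : ∀ i, Measurable (F i)) (hlaw : ∀ i, μ.map (F i) = expMeasure 1)
    (hind : iIndepFun F μ) (i : ℕ) (τ : ℝ≥0∞) (s : ℕ → ℝ≥0) :
    μ {ω | τ + ∑' j, (if j = i then 0 else s j * ENNReal.ofReal (F j ω)) <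
        ENNReal.ofReal (F i ω)} =
      expNeg τ * redProd i fun j => (1 + (s j : ℝ≥0∞))⁻¹ := by
  have := hind.isProbabilityMeasure
  set C : Ω → ℝ≥0∞ := fun ω => τ + ∑' j, (if j = i then 0 else s j * ENNReal.ofReal (F j ω))
    with hC
  have hind' : iIndep (fun j => MeasurableSpace.comap (F j) inferInstance) μ := hind.iIndep
  have hle : ∀ j, MeasurableSpace.comap (F j) inferInstance ≤ ‹MeasurableSpace Ω› := fun j =>
    (hF j).comap_le
  -- The right-hand side of the comparison involves only the fadings with index other than `i`,
  -- hence is independent of `F i`.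
  have hI := indep_iSup_of_disjoint hle hind' (S := {i}ᶜ) (T := {i}) (by simp)
  have hCm' : Measurable[⨆ j ∈ ({i}ᶜ : Set ℕ), MeasurableSpace.comap (F j) inferInstance] C := by
    refine Measurable.const_add (@measurable_ennrealTsum _ (_) _ fun j => ?_) τ
    by_cases hj : j = i
    · simp only [if_pos hj]
      exact measurable_const
    · simp only [if_neg hj]
      refine Measurable.const_mul (ENNReal.measurable_ofReal.comp ?_) _
      have h1 : MeasurableSpace.comap (F j) inferInstance ≤
          ⨆ j ∈ ({i}ᶜ : Set ℕ), MeasurableSpace.comap (F j) inferInstance :=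
        le_iSup₂_of_le (f := fun j (_ : j ∈ ({i}ᶜ : Set ℕ)) =>
          MeasurableSpace.comap (F j) inferInstance) j (by simpa using hj) le_rfl
      exact (comap_measurable (F j)).mono h1 le_rfl
  have hCm : Measurable C := hCm'.mono (iSup₂_le fun j _ => hle j) le_rfl
  have hCF : IndepFun C (F i) μ := by
    rw [IndepFun_iff_Indep]
    refine indep_of_indep_of_le_left (indep_of_indep_of_le_right hI ?_) hCm'.comap_le
    simp
  have hprod := hCF.map_prod_eq_prod_map_map hCm.aemeasurable (hF i).aemeasurable
  have hset : MeasurableSet {p : ℝ≥0∞ × ℝ | p.1 < ENNReal.ofReal p.2} :=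
    measurableSet_lt measurable_fst (ENNReal.measurable_ofReal.comp measurable_snd)
  have h1 : μ {ω | C ω < ENNReal.ofReal (F i ω)} = ∫⁻ ω, expNeg (C ω) ∂μ := by
    have : {ω | C ω < ENNReal.ofReal (F i ω)} =
        (fun ω => (C ω, F i ω)) ⁻¹' {p : ℝ≥0∞ × ℝ | p.1 < ENNReal.ofReal p.2} := rfl
    rw [this, ← Measure.map_apply (hCm.prodMk (hF i)) hset, hprod, Measure.prod_apply hset,
      lintegral_map (measurable_measure_prodMk_left hset) hCm, hlaw]
    exact lintegral_congr fun ω => expMeasure_lt_ofReal (C ω)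
  have hEm : ∀ j, Measurable fun x : ℝ => expNeg (s j * ENNReal.ofReal x) := fun j =>
    measurable_expNeg.comp (ENNReal.measurable_ofReal.const_mul _)
  rw [h1]
  simp_rw [hC, expNeg_add]
  simp_rw [← redProd_expNeg i]
  rw [lintegral_mul_redProd measurable_const (fun _ => expNeg_le_one τ) i
    (f := fun j ω => expNeg (s j * ENNReal.ofReal (F j ω)))
    (fun j => (hEm j).comp (hF j)) (fun j ω => expNeg_le_one _)]
  unfold redProd
  rw [ENNReal.mul_iInf fun h => absurd h (expNeg_ne_top τ)]
  refine iInf_congr fun n => ?_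
  have hEF : ∀ j, Measurable fun ω => expNeg (s j * ENNReal.ofReal (F j ω)) := fun j =>
    (hEm j).comp (hF j)
  rw [lintegral_const_mul _ (Finset.measurable_fun_prod _ fun j _ => hEF j),
    lintegral_prod_eq_prod_lintegral_of_indepFun _
      (fun j ω => expNeg (s j * ENNReal.ofReal (F j ω)))
      (hind.comp (fun j (x : ℝ) => expNeg (s j * ENNReal.ofReal x)) hEm)
      hEF]
  congr 1
  refine Finset.prod_congr rfl fun j _ => ?_
  simp only
  rw [← lintegral_expNeg_expMeasure, ← hlaw j, lintegral_map (hEm j) (hF j)]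

/-- The version of `measure_lt_fading` with coefficients depending on an independent variable. -/
theorem measure_lt_fading_of_indepFun {Y : Type*} [MeasurableSpace Y] {N : Ω → Y}
    (hF : ∀ i, Measurable (F i)) (hlaw : ∀ i, μ.map (F i) = expMeasure 1)
    (hind : iIndepFun F μ) (hN : Measurable N) (hFN : IndepFun (fun ω i => F i ω) N μ) (i : ℕ)
    {τ : Y → ℝ≥0∞} (hτ : Measurable τ) {s : ℕ → Y → ℝ≥0} (hs : ∀ j, Measurable (s j))
    {D : Set Y} (hD : MeasurableSet D) :
    μ {ω | N ω ∈ D ∧ τ (N ω) + ∑' j, (if j = i then 0 else s j (N ω) * ENNReal.ofReal (F j ω)) <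
        ENNReal.ofReal (F i ω)} =
      ∫⁻ ω, D.indicator 1 (N ω) * (expNeg (τ (N ω)) *
        redProd i fun j => (1 + (s j (N ω) : ℝ≥0∞))⁻¹) ∂μ := by
  have := hind.isProbabilityMeasure
  have hFm : Measurable fun ω i => F i ω := measurable_pi_lambda _ hF
  set T : Set (Y × (ℕ → ℝ)) := {p | p.1 ∈ D ∧
    τ p.1 + ∑' j, (if j = i then 0 else s j p.1 * ENNReal.ofReal (p.2 j)) <
      ENNReal.ofReal (p.2 i)} with hT
  have hTm : MeasurableSet T := by
    refine MeasurableSet.inter (s₁ := Prod.fst ⁻¹' D) (s₂ := {p : Y × (ℕ → ℝ) |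
      τ p.1 + ∑' j, (if j = i then 0 else s j p.1 * ENNReal.ofReal (p.2 j)) <
        ENNReal.ofReal (p.2 i)}) (measurable_fst hD) (measurableSet_lt ?_ ?_)
    · refine (hτ.comp measurable_fst).add (Measurable.tsum fun j => ?_)
      by_cases hj : j = i
      · simp only [if_pos hj]
        exact measurable_const
      · simp only [if_neg hj]
        exact ((hs j).comp measurable_fst).coe_nnreal_ennreal.mul
          (ENNReal.measurable_ofReal.comp ((measurable_pi_apply j).comp measurable_snd))
    · exact ENNReal.measurable_ofReal.comp ((measurable_pi_apply i).comp measurable_snd)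
  have hprod := hFN.symm.map_prod_eq_prod_map_map hN.aemeasurable hFm.aemeasurable
  have hpre : {ω | N ω ∈ D ∧ τ (N ω) + ∑' j, (if j = i then 0 else s j (N ω) *
      ENNReal.ofReal (F j ω)) < ENNReal.ofReal (F i ω)} =
      (fun ω => (N ω, fun i => F i ω)) ⁻¹' T := rfl
  rw [hpre, ← Measure.map_apply (hN.prodMk hFm) hTm, hprod, Measure.prod_apply hTm,
    lintegral_map (measurable_measure_prodMk_left hTm) hN]
  refine lintegral_congr fun ω => ?_
  rw [Measure.map_apply hFm (measurable_prodMk_left hTm)]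
  by_cases h : N ω ∈ D
  · rw [Set.indicator_of_mem h, Pi.one_apply, one_mul,
      ← measure_lt_fading hF hlaw hind i (τ (N ω)) fun j => s j (N ω)]
    congr 1
    ext ω'
    simp [hT, h]
  · rw [Set.indicator_of_notMem h, zero_mul]
    convert measure_empty (μ := μ) using 2
    ext ω'
    simp [hT, h]

end Fading

/-! ### Polar coordinates on a sector. -/

section Sector

/-- The polar chart has angles in `(-π, π)`, the sector angles in `[0, θ)`, so injectivity is shown
directly: equal points have equal radii, and their angles differ by a multiple of `2π` of absolute
value less than `2π`. -/
lemma injOn_polarCoord_symm_Ico {θ : ℝ} (hθ : θ ≤ 2 * Real.pi) :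
    Set.InjOn polarCoord.symm (Set.Ioi (0 : ℝ) ×ˢ Set.Ico 0 θ) := by
  rintro ⟨r, φ⟩ ⟨hr, hφ⟩ ⟨s, ψ⟩ ⟨hs, hψ⟩ h
  simp only [Set.mem_Ioi, Set.mem_Ico] at hr hs hφ hψ
  simp only [polarCoord_symm_apply, Prod.mk.injEq] at h
  obtain ⟨h1, h2⟩ := h
  have hsq : r ^ 2 = s ^ 2 := by
    have e1 : r ^ 2 = (r * Real.cos φ) ^ 2 + (r * Real.sin φ) ^ 2 := by
      nlinarith [Real.sin_sq_add_cos_sq φ]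
    have e2 : s ^ 2 = (s * Real.cos ψ) ^ 2 + (s * Real.sin ψ) ^ 2 := by
      nlinarith [Real.sin_sq_add_cos_sq ψ]
    rw [e1, e2, h1, h2]
  have hrs : r = s := by
    rwa [sq_eq_sq₀ hr.le hs.le] at hsq
  subst hrs
  have hc : Real.cos φ = Real.cos ψ := mul_left_cancel₀ hr.ne' h1
  have hsin : Real.sin φ = Real.sin ψ := mul_left_cancel₀ hr.ne' h2
  obtain ⟨k, hk⟩ := Real.Angle.angle_eq_iff_two_pi_dvd_sub.1 (Real.Angle.cos_sin_inj hc hsin)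
  have hpi := Real.pi_pos
  have hk1 : (k : ℝ) < 1 := by
    by_contra hcon
    push Not at hcon
    nlinarith [hφ.1, hφ.2, hψ.1, hψ.2]
  have hk2 : (-1 : ℝ) < k := by
    by_contra hcon
    push Not at hcon
    nlinarith [hφ.1, hφ.2, hψ.1, hψ.2]
  have hk0 : k = 0 := by
    have h3 : k < 1 := by exact_mod_cast hk1
    have h4 : -1 < k := by exact_mod_cast hk2
    omega
  rw [hk0] at hk
  have : φ = ψ := by
    simp only [Int.cast_zero, mul_zero] at hk
    linarith
  rw [this]

/-- The identification of the Euclidean plane with `ℝ × ℝ`. -/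
def planeEquiv : Plane ≃ᵐ ℝ × ℝ :=
  (MeasurableEquiv.toLp 2 (Fin 2 → ℝ)).symm.trans MeasurableEquiv.finTwoArrow

lemma planeEquiv_symm_apply (p : ℝ × ℝ) : planeEquiv.symm p = !₂[p.1, p.2] := rfl

lemma measurePreserving_planeEquiv : MeasurePreserving planeEquiv :=
  (volume_preserving_finTwoArrow ℝ).comp
    (EuclideanSpace.volume_preserving_symm_measurableEquiv_toLp (Fin 2))

lemma sector_zero_eq_preimage (θ : ℝ) :
    sector 0 0 θ = planeEquiv ⁻¹' (polarCoord.symm '' (Set.Ioi (0 : ℝ) ×ˢ Set.Ico 0 θ)) := by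
  ext x
  simp only [sector, Set.mem_ofPred_eq, Set.mem_preimage, Set.mem_image, Prod.exists,
    Set.mem_prod, Set.mem_Ioi, zero_add, polarCoord_symm_apply]
  constructor
  · rintro ⟨r, hr, φ, hφ, rfl⟩
    exact ⟨r, φ, ⟨hr, hφ⟩, rfl⟩
  · rintro ⟨r, φ, ⟨hr, hφ⟩, h⟩
    refine ⟨r, hr, φ, hφ, ?_⟩
    rw [← planeEquiv.symm_apply_apply x, ← h]
    rfl

/-- An injective continuous image of a Borel set is Borel (Lusin–Souslin). -/
lemma measurableSet_polarSector {θ : ℝ} (hθ : θ ≤ 2 * Real.pi) :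
    MeasurableSet (polarCoord.symm '' (Set.Ioi (0 : ℝ) ×ˢ Set.Ico 0 θ)) := by
  refine (measurableSet_Ioi.prod measurableSet_Ico).image_of_continuousOn_injOn ?_
    (injOn_polarCoord_symm_Ico hθ)
  exact Continuous.continuousOn (by
    show Continuous fun p : ℝ × ℝ => (p.1 * Real.cos p.2, p.1 * Real.sin p.2)
    fun_prop)

lemma measurableSet_sector {θ : ℝ} (hθ : θ ≤ 2 * Real.pi) : MeasurableSet (sector 0 0 θ) := by
  rw [sector_zero_eq_preimage]
  exact planeEquiv.measurable (measurableSet_polarSector hθ)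

lemma norm_polar {r : ℝ} (hr : 0 < r) (φ : ℝ) :
    ‖(!₂[r * Real.cos φ, r * Real.sin φ] : Plane)‖ = r := by
  rw [EuclideanSpace.norm_eq]
  simp only [Fin.sum_univ_two, Real.norm_eq_abs, sq_abs]
  rw [Real.sqrt_eq_iff_eq_sq (by positivity) hr.le]
  simp
  nlinarith [Real.sin_sq_add_cos_sq φ]

lemma norm_pos_of_mem_sector {θ : ℝ} {x : Plane} (hx : x ∈ sector 0 0 θ) : 0 < ‖x‖ := by
  obtain ⟨r, hr, φ, -, rfl⟩ := hx
  rwa [zero_add, norm_polar hr]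

/-- Integration of a radial function over a sector. -/
lemma setLIntegral_sector_norm {θ : ℝ} (hθ : θ ≤ 2 * Real.pi) {G : ℝ → ℝ≥0∞}
    (hG : Measurable G) :
    ∫⁻ x in sector 0 0 θ, G ‖x‖ =
      ENNReal.ofReal θ * ∫⁻ r in Set.Ioi (0 : ℝ), ENNReal.ofReal r * G r := by
  have hS : MeasurableSet (Set.Ioi (0 : ℝ) ×ˢ Set.Ico 0 θ) := measurableSet_Ioi.prod measurableSet_Ico
  have h1 : ∫⁻ x in sector 0 0 θ, G ‖x‖ =
      ∫⁻ p in polarCoord.symm '' (Set.Ioi (0 : ℝ) ×ˢ Set.Ico 0 θ), G ‖planeEquiv.symm p‖ := by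
    rw [sector_zero_eq_preimage, ← measurePreserving_planeEquiv.setLIntegral_comp_preimage
      (measurableSet_polarSector hθ) (f := fun p => G ‖planeEquiv.symm p‖)
      (hG.comp (planeEquiv.symm.measurable.norm))]
    simp
  rw [h1, lintegral_image_eq_lintegral_abs_det_fderiv_mul volume hS
    (fun p _ => (hasFDerivAt_polarCoord_symm p).hasFDerivWithinAt) (injOn_polarCoord_symm_Ico hθ)]
  rw [setLIntegral_congr_fun (g := fun p : ℝ × ℝ => ENNReal.ofReal p.1 * G p.1 * 1) hS]
  · rw [Measure.volume_eq_prod, ← Measure.prod_restrict, lintegral_prod_mul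
      (f := fun r => ENNReal.ofReal r * G r) (g := fun _ => 1)
      (ENNReal.measurable_ofReal.mul hG).aemeasurable aemeasurable_const]
    simp [mul_comm]
  · rintro ⟨r, φ⟩ ⟨hr, -⟩
    have hr' : 0 < r := hr
    simp only [det_fderivPolarCoordSymm, mul_one]
    rw [abs_of_pos hr', planeEquiv_symm_apply]
    simp only [polarCoord_symm_apply]
    rw [norm_polar hr']

end Sector

/-! ### From distances to path losses. -/

section PowerLaw

variable {α β : ℝ}

/-- The change of variables `z = β r ^ α` in a radial integral. -/
lemma lintegral_radial_eq (hα : 0 < α) (hβ : 0 < β) (G : ℝ → ℝ≥0∞) :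
    ∫⁻ r in Set.Ioi (0 : ℝ), ENNReal.ofReal r * G r =
      ∫⁻ z in Set.Ioi (0 : ℝ), ENNReal.ofReal (1 / α * (1 / β) ^ (2 / α) * z ^ (2 / α - 1)) *
        G ((z / β) ^ (1 / α)) := by
  have hinj : Set.InjOn (fun z : ℝ => (z / β) ^ (1 / α)) (Set.Ioi 0) := by
    intro z hz w hw h
    have hz' : 0 < z / β := div_pos hz hβ
    have hw' : 0 < w / β := div_pos hw hβ
    have := Real.rpow_left_injOn (one_div_pos.2 hα).ne' hz'.le hw'.le h
    field_simp at this
    exact this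
  have himg : (fun z : ℝ => (z / β) ^ (1 / α)) '' Set.Ioi 0 = Set.Ioi 0 := by
    ext r
    constructor
    · rintro ⟨z, hz, rfl⟩
      exact Real.rpow_pos_of_pos (div_pos hz hβ) _
    · intro hr
      have hr' : 0 < r := hr
      refine ⟨β * r ^ α, mul_pos hβ (Real.rpow_pos_of_pos hr' _), ?_⟩
      simp only
      rw [mul_div_cancel_left₀ _ hβ.ne', ← Real.rpow_mul hr'.le, mul_one_div_cancel hα.ne',
        Real.rpow_one]
  have hderiv : ∀ z ∈ Set.Ioi (0 : ℝ), HasDerivWithinAt (fun z : ℝ => (z / β) ^ (1 / α))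
      (1 / β * (1 / α) * (z / β) ^ (1 / α - 1)) (Set.Ioi 0) z := by
    intro z hz
    have := ((hasDerivAt_id z).div_const β).rpow_const (p := 1 / α)
      (Or.inl (div_pos hz hβ).ne')
    exact this.hasDerivWithinAt
  rw [← himg, lintegral_image_eq_lintegral_abs_deriv_mul measurableSet_Ioi hderiv hinj, himg]
  refine setLIntegral_congr_fun measurableSet_Ioi fun z hz => ?_
  have hz' : 0 < z := hz
  have hzb : 0 < z / β := div_pos hz' hβ
  rw [← mul_assoc, abs_of_pos (by positivity), ← ENNReal.ofReal_mul (by positivity)]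
  congr 2
  have e1 : (1 / β) ^ (2 / α) * z ^ (2 / α - 1) = (z / β) ^ (2 / α - 1) * (1 / β) := by
    rw [div_eq_mul_one_div z β, Real.mul_rpow hz'.le (by positivity), mul_assoc,
      ← Real.rpow_add_one (by positivity), sub_add_cancel, mul_comm]
  have e2 : (z / β) ^ (1 / α - 1) * (z / β) ^ (1 / α) = (z / β) ^ (2 / α - 1) := by
    rw [← Real.rpow_add hzb]
    congr 1
    ring
  rw [mul_assoc (1 / α), e1, ← e2]
  ring

end PowerLaw

/-! ### The total mass of the density of a first point. -/

section LayerCake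

lemma lintegral_ofReal_expMeasure : ∫⁻ t, ENNReal.ofReal t ∂(expMeasure 1) = 1 := by
  rw [lintegral_eq_lintegral_meas_lt _ ae_nonneg_expMeasure aemeasurable_id,
    ← lintegral_exponentialPDF_eq_one one_pos,
    ← lintegral_add_compl (exponentialPDF 1) (measurableSet_Ioi (a := (0 : ℝ)))]
  have h0 : ∫⁻ x in (Set.Ioi (0 : ℝ))ᶜ, exponentialPDF 1 x = 0 := by
    rw [Set.compl_Ioi, ← setLIntegral_congr Iio_ae_eq_Iic]
    exact lintegral_exponentialPDF_of_nonpos le_rfl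
  rw [h0, add_zero]
  refine setLIntegral_congr_fun measurableSet_Ioi fun t ht => ?_
  have ht' : 0 < t := ht
  rw [exponentialPDF_of_nonneg ht'.le, one_mul, one_mul, ← expMeasure_Ioi ht'.le]
  rfl

/-- With `M z = m (Iic z)` and `E` a unit exponential, `exp(-M z)` is the probability of `M z < E`.
Tonelli turns the integral into the mean of `m {M < E}`, which is the mean of `E`, namely `1`. Since
`M` attains every positive value, `m {M < t} = t` for `t > 0`. -/
lemma lintegral_expNeg_measure_Iic (m : Measure ℝ) [SFinite m]
    (hm : ∀ t : ℝ, 0 < t → ∃ s, m (Set.Iic s) = ENNReal.ofReal t) :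
    ∫⁻ z, expNeg (m (Set.Iic z)) ∂m = 1 := by
  have hmono : Monotone fun z => m (Set.Iic z) := fun a b h => measure_mono (Set.Iic_subset_Iic.2 h)
  have hM : Measurable fun z => m (Set.Iic z) := hmono.measurable
  set T : Set (ℝ × ℝ) := {p | m (Set.Iic p.1) < ENNReal.ofReal p.2} with hT
  have hTm : MeasurableSet T :=
    measurableSet_lt (hM.comp measurable_fst) (ENNReal.measurable_ofReal.comp measurable_snd)
  have h1 : ∫⁻ z, expNeg (m (Set.Iic z)) ∂m = (m.prod (expMeasure 1)) T := by
    rw [Measure.prod_apply hTm]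
    exact lintegral_congr fun z => (expMeasure_lt_ofReal _).symm
  rw [h1, Measure.prod_apply_symm hTm, ← lintegral_ofReal_expMeasure]
  refine lintegral_congr_ae ?_
  filter_upwards [ae_nonneg_expMeasure] with t ht
  have hset : (fun z => (z, t)) ⁻¹' T = {z | m (Set.Iic z) < ENNReal.ofReal t} := rfl
  rw [hset]
  rcases ht.eq_or_lt with rfl | ht
  · simp
  refine le_antisymm ?_ (le_of_forall_lt fun c hc => ?_)
  · obtain ⟨s, hs⟩ := hm t ht
    rw [← hs]
    refine measure_mono fun z hz => ?_
    by_contra hzs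
    exact absurd (hmono (not_le.1 hzs).le) (not_le.2 hz)
  · obtain ⟨d, hcd, hdt⟩ := exists_between hc
    have hd : d ≠ ∞ := (hdt.trans_le le_top).ne
    obtain ⟨s, hs⟩ := hm d.toReal (ENNReal.toReal_pos (ne_bot_of_gt hcd) hd)
    rw [ENNReal.ofReal_toReal hd] at hs
    refine hcd.trans_le (hs ▸ measure_mono fun z hz => ?_)
    exact (hmono hz).trans_lt (hs.trans_lt hdt)

end LayerCake

/-! ### Radial integrals of the model and the density `f_{Z₁}`. -/

namespace Params

variable (p : Params)

/-- The parameters satisfy the standing assumptions of the model. -/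
structure Valid : Prop where
  lam_pos : 0 < p.lam
  measurable_h : Measurable p.h
  h_mem : ∀ r : ℝ, 0 ≤ r → p.h r ∈ Set.Icc (0 : ℝ) 1
  beta_pos : 0 < p.beta
  alphaL_pos : 0 < p.alphaL
  alphaN_pos : 0 < p.alphaN
  Pb_pos : 0 < p.Pb
  C0_pos : 0 < p.C0
  one_le_Mcs : 1 ≤ p.Mcs
  one_le_Ncs : 1 ≤ p.Ncs

/-- The path loss exponent of LOS (`true`) and NLOS (`false`) links. -/
def alpha (b : Bool) : ℝ := if b = true then p.alphaL else p.alphaN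

/-- The path loss of LOS (`true`) and NLOS (`false`) links. -/
def loss (b : Bool) (r : ℝ) : ℝ := p.beta * r ^ p.alpha b

/-- Inverse function of `loss`. -/
def invLoss (b : Bool) (z : ℝ) : ℝ := (z / p.beta) ^ (1 / p.alpha b)

/-- The probability, as a real number, that a link of length `r` has the given type. -/
def linkProb (b : Bool) (r : ℝ) : ℝ := if b = true then p.h r else 1 - p.h r

/-- The intensity of the radial measure `r dr` of the base stations in the typical sector. -/
def rate : ℝ≥0∞ := ENNReal.ofReal (2 * Real.pi * (p.lam / p.Kcs))

/-- Normalised mean number of base stations with path loss at most `z`. -/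
def meanBelow (z : ℝ) : ℝ≥0∞ :=
  ∑ b, ∫⁻ r in Set.Ioc 0 (p.invLoss b z), ENNReal.ofReal (p.linkProb b r * r)

/-- Normalised exponent of the Laplace transform of the interference. -/
def interferenceExponent (T z : ℝ) : ℝ≥0∞ :=
  ∑ b, ∫⁻ r in Set.Ioi (p.invLoss b z),
    ENNReal.ofReal (T * z * p.linkProb b r * r / (T * z + p.loss b r))

/-- The intensity of the path losses in the typical sector. -/
def lossIntensity (z : ℝ) : ℝ≥0∞ :=
  p.rate * ∑ b, ENNReal.ofReal (1 / p.alpha b * (1 / p.beta) ^ (2 / p.alpha b) *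
    z ^ (2 / p.alpha b - 1)) * ENNReal.ofReal (p.linkProb b (p.invLoss b z))

variable {p}

namespace Valid

lemma alpha_pos (hp : p.Valid) (b : Bool) : 0 < p.alpha b := by
  cases b
  · exact hp.alphaN_pos
  · exact hp.alphaL_pos

lemma one_le_Kcs (hp : p.Valid) : 1 ≤ p.Kcs := hp.one_le_Mcs.trans (le_max_left _ _)

lemma Kcs_pos (hp : p.Valid) : (0 : ℝ) < p.Kcs := by
  exact_mod_cast Nat.lt_of_lt_of_le Nat.zero_lt_one hp.one_le_Kcs

lemma rate_pos (hp : p.Valid) : 0 < 2 * Real.pi * (p.lam / p.Kcs) := by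
  have := hp.lam_pos
  have := hp.Kcs_pos
  positivity

lemma linkProb_nonneg (hp : p.Valid) (b : Bool) {r : ℝ} (hr : 0 ≤ r) : 0 ≤ p.linkProb b r := by
  have h := hp.h_mem r hr
  cases b
  · simpa [linkProb] using h.2
  · simpa [linkProb] using h.1

lemma linkProb_le_one (hp : p.Valid) (b : Bool) {r : ℝ} (hr : 0 ≤ r) : p.linkProb b r ≤ 1 := by
  have h := hp.h_mem r hr
  cases b
  · simpa [linkProb] using h.1
  · simpa [linkProb] using h.2

lemma sum_linkProb (hp : p.Valid) {r : ℝ} (hr : 0 ≤ r) :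
    ∑ b, ENNReal.ofReal (p.linkProb b r) = 1 := by
  rw [Fintype.sum_bool, ← ENNReal.ofReal_add (hp.linkProb_nonneg _ hr) (hp.linkProb_nonneg _ hr)]
  simp [linkProb]

@[fun_prop]
lemma measurable_linkProb (hp : p.Valid) (b : Bool) : Measurable (p.linkProb b) := by
  cases b
  · exact hp.measurable_h.const_sub 1
  · exact hp.measurable_h

lemma measurable_loss (b : Bool) : Measurable (p.loss b) := by
  unfold loss
  fun_prop

lemma measurable_invLoss (b : Bool) : Measurable (p.invLoss b) := by
  unfold invLoss
  fun_prop

lemma loss_pos (hp : p.Valid) (b : Bool) {r : ℝ} (hr : 0 < r) : 0 < p.loss b r :=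
  mul_pos hp.beta_pos (Real.rpow_pos_of_pos hr _)

lemma invLoss_pos (hp : p.Valid) (b : Bool) {z : ℝ} (hz : 0 < z) : 0 < p.invLoss b z :=
  Real.rpow_pos_of_pos (div_pos hz hp.beta_pos) _

lemma loss_invLoss (hp : p.Valid) (b : Bool) {z : ℝ} (hz : 0 < z) : p.loss b (p.invLoss b z) = z := by
  have h := hp.beta_pos
  rw [loss, invLoss, ← Real.rpow_mul (div_pos hz h).le, one_div_mul_cancel (hp.alpha_pos b).ne',
    Real.rpow_one]
  field_simp

lemma loss_lt_loss_iff (hp : p.Valid) (b : Bool) {r s : ℝ} (hr : 0 ≤ r) (hs : 0 ≤ s) :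
    p.loss b r < p.loss b s ↔ r < s := by
  rw [loss, loss, mul_lt_mul_iff_right₀ hp.beta_pos, Real.rpow_lt_rpow_iff hr hs (hp.alpha_pos b)]

lemma lt_invLoss_iff (hp : p.Valid) (b : Bool) {r z : ℝ} (hr : 0 ≤ r) (hz : 0 < z) :
    r < p.invLoss b z ↔ p.loss b r < z := by
  rw [← hp.loss_lt_loss_iff b hr (hp.invLoss_pos b hz).le, hp.loss_invLoss b hz]

lemma invLoss_lt_iff (hp : p.Valid) (b : Bool) {r z : ℝ} (hr : 0 ≤ r) (hz : 0 < z) :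
    p.invLoss b z < r ↔ z < p.loss b r := by
  rw [← hp.loss_lt_loss_iff b (hp.invLoss_pos b hz).le hr, hp.loss_invLoss b hz]

lemma invLoss_le_iff (hp : p.Valid) (b : Bool) {w z : ℝ} (hw : 0 < w) (hz : 0 < z) :
    p.invLoss b w ≤ p.invLoss b z ↔ w ≤ z := by
  rw [← not_lt, hp.lt_invLoss_iff b (hp.invLoss_pos b hz).le hw, hp.loss_invLoss b hz, not_lt]

lemma angle_le (hp : p.Valid) : 2 * Real.pi / p.Kcs ≤ 2 * Real.pi := by
  have h : (1 : ℝ) ≤ p.Kcs := by exact_mod_cast hp.one_le_Kcs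
  exact div_le_self (by positivity) h

lemma measurableSet_typicalSector (hp : p.Valid) : MeasurableSet p.typicalSector :=
  measurableSet_sector hp.angle_le

/-- Integration of a radial function over the typical sector. -/
lemma setLIntegral_typicalSector (hp : p.Valid) {G : ℝ → ℝ≥0∞} (hG : Measurable G) :
    ∫⁻ x in p.typicalSector, G ‖x‖ ∂(ENNReal.ofReal p.lam • (volume : Measure Plane)) =
      p.rate * ∫⁻ r in Set.Ioi (0 : ℝ), ENNReal.ofReal r * G r := by
  rw [Measure.restrict_smul, lintegral_smul_measure, typicalSector,
    setLIntegral_sector_norm hp.angle_le hG, smul_eq_mul, ← mul_assoc,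
    ← ENNReal.ofReal_mul hp.lam_pos.le, rate]
  congr 2
  ring

lemma setLIntegral_linkProb (hp : p.Valid) (b : Bool) {R : ℝ} (hR : 0 ≤ R) :
    ∫⁻ r in Set.Ioc 0 R, ENNReal.ofReal (p.linkProb b r * r) =
        ENNReal.ofReal (∫ r in (0 : ℝ)..R, p.linkProb b r * r) ∧
      0 ≤ ∫ r in (0 : ℝ)..R, p.linkProb b r * r := by
  rw [intervalIntegral.integral_of_le hR]
  have hnn : 0 ≤ᵐ[volume.restrict (Set.Ioc 0 R)] fun r => p.linkProb b r * r := by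
    refine (ae_restrict_iff' measurableSet_Ioc).2 (ae_of_all _ fun r hr => ?_)
    exact mul_nonneg (hp.linkProb_nonneg b hr.1.le) hr.1.le
  refine ⟨(ofReal_integral_eq_lintegral_ofReal ?_ hnn).symm, integral_nonneg_of_ae hnn⟩
  refine Measure.integrableOn_of_bounded (M := R) (by simp)
    ((hp.measurable_linkProb b).mul measurable_id).aestronglyMeasurable ?_
  refine (ae_restrict_iff' measurableSet_Ioc).2 (ae_of_all _ fun r hr => ?_)
  rw [Real.norm_of_nonneg (mul_nonneg (hp.linkProb_nonneg b hr.1.le) hr.1.le)]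
  exact (mul_le_of_le_one_left hr.1.le (hp.linkProb_le_one b hr.1.le)).trans hr.2

/-- The structure of a first-point density: intensity of path losses at `z` times the probability of
no smaller loss. -/
lemma ofReal_fZ (hp : p.Valid) {z : ℝ} (hz : 0 < z) :
    ENNReal.ofReal (p.fZ z) = p.lossIntensity z * expNeg (p.rate * p.meanBelow z) := by
  have hβ := hp.beta_pos
  have hrate := hp.rate_pos
  set c : ℝ := 2 * Real.pi * (p.lam / p.Kcs) with hc
  set I : Bool → ℝ := fun b => ∫ r in (0 : ℝ)..(p.invLoss b z), p.linkProb b r * r with hI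
  have hInn : ∀ b, 0 ≤ I b := fun b => (hp.setLIntegral_linkProb b (hp.invLoss_pos b hz).le).2
  have hmean : p.rate * p.meanBelow z = ENNReal.ofReal (c * (I true + I false)) := by
    rw [meanBelow, Fintype.sum_bool, (hp.setLIntegral_linkProb _ (hp.invLoss_pos _ hz).le).1,
      (hp.setLIntegral_linkProb _ (hp.invLoss_pos _ hz).le).1,
      ← ENNReal.ofReal_add (hInn _) (hInn _), rate, ← ENNReal.ofReal_mul hrate.le]
  set J : Bool → ℝ := fun b => 1 / p.alpha b * (1 / p.beta) ^ (2 / p.alpha b) *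
    z ^ (2 / p.alpha b - 1) with hJ
  have hJnn : ∀ b, 0 ≤ J b := fun b => by
    have := hp.alpha_pos b
    positivity
  have hq : ∀ b, 0 ≤ p.linkProb b (p.invLoss b z) := fun b =>
    hp.linkProb_nonneg b (hp.invLoss_pos b hz).le
  have hint : p.lossIntensity z = ENNReal.ofReal (c * (J true * p.linkProb true (p.invLoss true z) +
      J false * p.linkProb false (p.invLoss false z))) := by
    rw [lossIntensity, Fintype.sum_bool, ← ENNReal.ofReal_mul (hJnn _), ← ENNReal.ofReal_mul (hJnn _),
      ← ENNReal.ofReal_add (mul_nonneg (hJnn _) (hq _)) (mul_nonneg (hJnn _) (hq _)), rate,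
      ← ENNReal.ofReal_mul hrate.le]
  rw [hmean, hint, expNeg_ofReal (mul_nonneg hrate.le (add_nonneg (hInn _) (hInn _))),
    ← ENNReal.ofReal_mul (mul_nonneg hrate.le
      (add_nonneg (mul_nonneg (hJnn _) (hq _)) (mul_nonneg (hJnn _) (hq _))))]
  congr 1
  have e1 : Real.exp (-(c * (I true + I false))) =
      Real.exp (-c * I true) * Real.exp (-c * I false) := by
    rw [← Real.exp_add]
    ring_nf
  have e2 : 2 * Real.pi * p.lam / p.Kcs = c := by
    rw [hc]
    ring
  have e3 : ∀ z, p.invLossL z = p.invLoss true z := fun z => rfl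
  have e4 : ∀ z, p.invLossN z = p.invLoss false z := fun z => rfl
  have e5 : p.alphaL = p.alpha true := rfl
  have e6 : p.alphaN = p.alpha false := rfl
  have e7 : ∀ r, p.h r = p.linkProb true r := fun r => rfl
  have e8 : ∀ r, 1 - p.linkProb true r = p.linkProb false r := fun r => rfl
  rw [e1, fZ]
  simp only [e2, e3, e4, e5, e6, e7, e8]
  simp only [hI, hJ]
  ring

lemma measurable_lossIntensity (hp : p.Valid) : Measurable p.lossIntensity := by
  unfold lossIntensity
  refine Measurable.const_mul (Finset.measurable_fun_sum _ fun b _ => Measurable.fun_mul ?_ ?_) _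
  · fun_prop
  · exact ((hp.measurable_linkProb b).comp (measurable_invLoss b)).ennreal_ofReal

/-- The intensity measure of the path losses in the typical sector. -/
lemma withDensity_lossIntensity_Iic (hp : p.Valid) {z : ℝ} (hz : 0 < z) :
    ((volume.restrict (Set.Ioi (0 : ℝ))).withDensity p.lossIntensity) (Set.Iic z) =
      p.rate * p.meanBelow z := by
  have hm : ∀ b, Measurable fun w => ENNReal.ofReal (1 / p.alpha b * (1 / p.beta) ^ (2 / p.alpha b) *
      w ^ (2 / p.alpha b - 1)) * ENNReal.ofReal (p.linkProb b (p.invLoss b w)) := fun b =>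
    Measurable.mul (by fun_prop)
      ((hp.measurable_linkProb b).comp (measurable_invLoss b)).ennreal_ofReal
  rw [withDensity_apply _ measurableSet_Iic, Measure.restrict_restrict measurableSet_Iic]
  simp_rw [lossIntensity]
  rw [lintegral_const_mul _ (Finset.measurable_fun_sum _ fun b _ => hm b),
    lintegral_finsetSum _ fun b _ => hm b, meanBelow]
  congr 1
  refine Finset.sum_congr rfl fun b _ => ?_
  have h := lintegral_radial_eq (hp.alpha_pos b) hp.beta_pos
    ((Set.Iic (p.invLoss b z)).indicator fun r => ENNReal.ofReal (p.linkProb b r))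
  have h1 : ∀ w ∈ Set.Ioi (0 : ℝ), ENNReal.ofReal (1 / p.alpha b * (1 / p.beta) ^ (2 / p.alpha b) *
      w ^ (2 / p.alpha b - 1)) * (Set.Iic (p.invLoss b z)).indicator
        (fun r => ENNReal.ofReal (p.linkProb b r)) ((w / p.beta) ^ (1 / p.alpha b)) =
      (Set.Iic z).indicator (fun w => ENNReal.ofReal (1 / p.alpha b *
        (1 / p.beta) ^ (2 / p.alpha b) * w ^ (2 / p.alpha b - 1)) *
          ENNReal.ofReal (p.linkProb b (p.invLoss b w))) w := by
    intro w hw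
    have e : (w / p.beta) ^ (1 / p.alpha b) = p.invLoss b w := rfl
    have hiff := hp.invLoss_le_iff b (Set.mem_Ioi.1 hw) hz
    rw [e]
    by_cases hwz : w ≤ z
    · rw [Set.indicator_of_mem (Set.mem_Iic.2 hwz),
        Set.indicator_of_mem (Set.mem_Iic.2 (hiff.2 hwz))]
    · rw [Set.indicator_of_notMem (a := w) (Set.notMem_Iic.2 (not_le.1 hwz)),
        Set.indicator_of_notMem (Set.notMem_Iic.2 (not_le.1 fun hle => hwz (hiff.1 hle))), mul_zero]
  rw [setLIntegral_congr_fun measurableSet_Ioi h1, lintegral_indicator measurableSet_Iic,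
    Measure.restrict_restrict measurableSet_Iic] at h
  rw [← h, ← Set.Iic_inter_Ioi, ← Measure.restrict_restrict measurableSet_Iic,
    ← lintegral_indicator measurableSet_Iic]
  refine setLIntegral_congr_fun measurableSet_Ioi fun r hr => ?_
  have hr' : 0 < r := hr
  by_cases hri : r ≤ p.invLoss b z
  · rw [Set.indicator_of_mem (Set.mem_Iic.2 hri), Set.indicator_of_mem (Set.mem_Iic.2 hri),
      mul_comm, ENNReal.ofReal_mul (hp.linkProb_nonneg b hr'.le)]
  · rw [Set.indicator_of_notMem (by simpa using hri), Set.indicator_of_notMem (by simpa using hri),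
      mul_zero]

lemma exists_rate_mul_meanBelow_eq (hp : p.Valid) {t : ℝ} (ht : 0 < t) :
    ∃ z, 0 < z ∧ p.rate * p.meanBelow z = ENNReal.ofReal t := by
  set c : ℝ := 2 * Real.pi * (p.lam / p.Kcs) with hc
  have hc0 : 0 < c := hp.rate_pos
  -- The bounds on `h` concern `r ≥ 0` only; with `|r|` the integrand is bounded by `|r|` everywhere
  -- and its primitive is continuous on the whole line.
  let k : Bool → ℝ → ℝ := fun b r => p.linkProb b |r| * r
  have hk1 : ∀ b r, ‖k b r‖ ≤ |r| := fun b r => by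
    simp only [k, norm_mul, Real.norm_eq_abs]
    rw [abs_of_nonneg (hp.linkProb_nonneg b (abs_nonneg r))]
    exact mul_le_of_le_one_left (abs_nonneg r) (hp.linkProb_le_one b (abs_nonneg r))
  have hki : ∀ b u v, IntervalIntegrable (k b) volume u v := fun b u v => by
    refine (continuous_abs.intervalIntegrable (μ := volume) u v).mono_fun ?_ ?_
    · exact (((hp.measurable_linkProb b).comp measurable_id.abs).mul
        measurable_id).aestronglyMeasurable
    · exact ae_of_all _ fun r => by simpa using hk1 b r
  let D : ℝ → ℝ := fun z => ∑ b, ∫ r in (0 : ℝ)..(p.invLoss b z), k b r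
  have hinv : ∀ b, Continuous (p.invLoss b) := fun b => by
    unfold invLoss
    exact (continuous_id.div_const _).rpow_const
      fun _ => Or.inr (one_div_pos.2 (hp.alpha_pos b)).le
  have hDc : Continuous D := continuous_finsetSum _ fun b _ =>
    (intervalIntegral.continuous_primitive (hki b) 0).comp (hinv b)
  have hkeq : ∀ b R, 0 ≤ R →
      ∫ r in (0 : ℝ)..R, k b r = ∫ r in (0 : ℝ)..R, p.linkProb b r * r := by
    intro b R hR
    refine intervalIntegral.integral_congr fun r hr => ?_
    rw [Set.uIcc_of_le hR] at hr
    simp only [k, abs_of_nonneg hr.1]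
  have hknn : ∀ b R, 0 ≤ R → 0 ≤ ∫ r in (0 : ℝ)..R, k b r := fun b R hR => by
    rw [hkeq b R hR]
    exact (hp.setLIntegral_linkProb b hR).2
  have hDmean : ∀ z, 0 < z → p.rate * p.meanBelow z = ENNReal.ofReal (c * D z) := by
    intro z hz
    have hR : ∀ b, 0 ≤ p.invLoss b z := fun b => (hp.invLoss_pos b hz).le
    rw [rate, ENNReal.ofReal_mul hc0.le, meanBelow,
      ENNReal.ofReal_sum_of_nonneg fun b _ => hknn b _ (hR b)]
    congr 1
    refine Finset.sum_congr rfl fun b _ => ?_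
    rw [(hp.setLIntegral_linkProb b (hR b)).1, hkeq b _ (hR b)]
  have hD0 : D 0 = 0 := by
    refine Finset.sum_eq_zero fun b _ => ?_
    rw [invLoss, zero_div, Real.zero_rpow (one_div_pos.2 (hp.alpha_pos b)).ne',
      intervalIntegral.integral_same]
  -- The two link types together contribute `R ^ 2 / 2` up to radius `R`. As `R ≥ 1`, `c R ^ 2 / 2 ≥
  -- c R / 2 ≥ t`, so the intermediate value theorem applies on `[0, z₁]`.
  set R : ℝ := 2 * t / c + 1 with hR
  have hR1 : 1 ≤ R := by
    have : 0 < 2 * t / c := by positivity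
    linarith
  have hR0 : 0 < R := by linarith
  set z₁ := max (p.loss true R) (p.loss false R) with hz₁
  have hz₁0 : 0 < z₁ := (hp.loss_pos true hR0).trans_le (le_max_left _ _)
  have hRinv : ∀ b, R ≤ p.invLoss b z₁ := fun b => by
    rw [← not_lt, hp.invLoss_lt_iff b hR0.le hz₁0, not_lt]
    cases b
    · exact le_max_right _ _
    · exact le_max_left _ _
  have hDz₁ : t ≤ c * D z₁ := by
    have h1 : ∀ b, ∫ r in (0 : ℝ)..R, k b r ≤ ∫ r in (0 : ℝ)..(p.invLoss b z₁), k b r := by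
      intro b
      refine intervalIntegral.integral_mono_interval le_rfl hR0.le (hRinv b) ?_ (hki b _ _)
      refine (ae_restrict_iff' measurableSet_Ioc).2 (ae_of_all _ fun r hr => ?_)
      exact mul_nonneg (hp.linkProb_nonneg b (abs_nonneg r)) hr.1.le
    have h2 : ∑ b, ∫ r in (0 : ℝ)..R, k b r = R ^ 2 / 2 := by
      rw [Fintype.sum_bool, ← intervalIntegral.integral_add (hki _ _ _) (hki _ _ _)]
      have : ∀ r, k true r + k false r = r := fun r => by
        simp only [k, linkProb, if_true, Bool.false_eq_true, if_false]
        ring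
      simp_rw [this]
      simp
    have h3 : R ^ 2 / 2 ≤ D z₁ := by
      rw [← h2]
      exact Finset.sum_le_sum fun b _ => h1 b
    have h4 : t ≤ c * (R ^ 2 / 2) := by
      have h5 : c * R = 2 * t + c := by
        rw [hR]
        field_simp
      nlinarith [mul_le_mul_of_nonneg_left hR1 (mul_pos hc0 hR0).le]
    exact h4.trans (mul_le_mul_of_nonneg_left h3 hc0.le)
  obtain ⟨z, hz, hzt⟩ := intermediate_value_Icc hz₁0.le
    (f := fun z => c * D z) (continuous_const.mul hDc).continuousOn
    (show t ∈ Set.Icc (c * D 0) (c * D z₁) by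
      rw [hD0, mul_zero]
      exact ⟨ht.le, hDz₁⟩)
  have hz0 : 0 < z := by
    refine lt_of_le_of_ne hz.1 fun h => ?_
    simp only [← h, hD0, mul_zero] at hzt
    exact ht.ne hzt
  refine ⟨z, hz0, ?_⟩
  rw [hDmean z hz0]
  exact congrArg ENNReal.ofReal hzt

/-- The density has the form `exp(-M) dM`, with `M` the mean number of base stations below a given
loss, so `lintegral_expNeg_measure_Iic` applies. The value `1` later rules out ties. -/
lemma lintegral_ofReal_fZ (hp : p.Valid) :
    ∫⁻ z in Set.Ioi (0 : ℝ), ENNReal.ofReal (p.fZ z) = 1 := by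
  set m := (volume.restrict (Set.Ioi (0 : ℝ))).withDensity p.lossIntensity with hm
  have hmono : Monotone fun z => m (Set.Iic z) := fun a b h => measure_mono (Set.Iic_subset_Iic.2 h)
  rw [← lintegral_expNeg_measure_Iic m fun t ht => by
    obtain ⟨z, hz, h⟩ := hp.exists_rate_mul_meanBelow_eq ht
    exact ⟨z, by rw [hm, hp.withDensity_lossIntensity_Iic hz, h]⟩]
  rw [hm, lintegral_withDensity_eq_lintegral_mul _ hp.measurable_lossIntensity
    (g := fun z => expNeg (m (Set.Iic z))) (measurable_expNeg.comp hmono.measurable)]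
  refine setLIntegral_congr_fun measurableSet_Ioi fun z hz => ?_
  rw [hp.ofReal_fZ hz, Pi.mul_apply, hp.withDensity_lossIntensity_Iic hz]

lemma ofReal_V (T z : ℝ) :
    ENNReal.ofReal (p.V z T (p.lam / p.Kcs)) = expNeg (p.rate * p.interferenceExponent T z) := by
  rw [V, interferenceExponent, Fintype.sum_bool]
  exact ENNReal.ofReal_toReal (expNeg_ne_top _)

end Valid

end Params

lemma measurable_setLIntegral_of_measurableSet {g : ℝ → ℝ → ℝ≥0∞}
    (hg : Measurable (Function.uncurry g)) {S : ℝ → Set ℝ}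
    (hS : MeasurableSet {q : ℝ × ℝ | q.2 ∈ S q.1}) :
    Measurable fun z => ∫⁻ r in S z, g z r := by
  have h : ∀ z, ∫⁻ r in S z, g z r = ∫⁻ r, {q : ℝ × ℝ | q.2 ∈ S q.1}.indicator
      (Function.uncurry g) (z, r) := fun z => by
    exact (lintegral_indicator (s := S z) (measurable_prodMk_left (x := z) hS) _).symm
  simp_rw [h]
  exact (hg.indicator hS).lintegral_prod_right'

/-! ### Per-link weights and the evaluation of the Campbell integral. -/

namespace Params

variable (p : Params)

open Classical in
/-- The factor by which a link of type `b` to `x` enters the conditional probability that the base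
station at path loss `s` is the closest one and is detected, at threshold `T`. -/
def weight (T s : ℝ) (x : Plane) (b : Bool) : ℝ≥0∞ :=
  if x ∈ p.typicalSector then
    (if s ≤ p.loss b ‖x‖ then (1 + ENNReal.ofReal (T * s / p.loss b ‖x‖))⁻¹ else 0)
  else 1

/-- The noise power relative to the link gain. -/
def noise : ℝ := p.sigma ^ 2 / p.linkGain

open Classical in
/-- The factor of the base station at path loss in `B`. -/
def serverWeight (T : ℝ) (B : Set ℝ) (x : Plane) (b : Bool) : ℝ≥0∞ :=
  if x ∈ p.typicalSector ∧ p.loss b ‖x‖ ∈ B then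
    expNeg (ENNReal.ofReal (T * p.loss b ‖x‖ * p.noise)) else 0

variable {p}

namespace Valid

lemma measurable_meanBelow (hp : p.Valid) : Measurable p.meanBelow := by
  unfold meanBelow
  refine Finset.measurable_fun_sum _ fun b _ => measurable_setLIntegral_of_measurableSet
    (g := fun _ r => ENNReal.ofReal (p.linkProb b r * r)) ?_ ?_
  · exact (((hp.measurable_linkProb b).comp measurable_snd).mul measurable_snd).ennreal_ofReal
  · exact (measurableSet_lt measurable_const measurable_snd).inter
      (measurableSet_le measurable_snd ((measurable_invLoss b).comp measurable_fst))

lemma measurable_interferenceExponent (hp : p.Valid) (T : ℝ) :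
    Measurable (p.interferenceExponent T) := by
  unfold interferenceExponent
  refine Finset.measurable_fun_sum _ fun b _ => measurable_setLIntegral_of_measurableSet
    (g := fun z r => ENNReal.ofReal (T * z * p.linkProb b r * r / (T * z + p.loss b r))) ?_ ?_
  · have h1 : Measurable fun q : ℝ × ℝ => p.linkProb b q.2 :=
      (hp.measurable_linkProb b).comp measurable_snd
    have h2 : Measurable fun q : ℝ × ℝ => p.loss b q.2 := (measurable_loss b).comp measurable_snd
    refine Measurable.ennreal_ofReal ?_
    show Measurable fun q : ℝ × ℝ => T * q.1 * p.linkProb b q.2 * q.2 / (T * q.1 + p.loss b q.2)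
    fun_prop
  · exact measurableSet_lt ((measurable_invLoss b).comp measurable_fst) measurable_snd

lemma linkGain_pos (hp : p.Valid) : 0 < p.linkGain := by
  have h1 := hp.Pb_pos
  have h2 : (0 : ℝ) < p.Mcs := by exact_mod_cast hp.one_le_Mcs
  have h3 : (1 : ℝ) ≤ p.Ncs := by exact_mod_cast hp.one_le_Ncs
  have hpi := Real.pi_pos
  have hC := hp.C0_pos
  refine mul_pos (mul_pos h1 h2) ?_
  unfold mainLobeGain
  split_ifs with h
  · exact one_pos
  · have h4 : 2 * Real.pi / p.Ncs < 2 * Real.pi :=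
      lt_of_le_of_ne (div_le_self (by positivity) h3) h
    have h5 : 0 < 2 * Real.pi - 2 * Real.pi / p.Ncs := by linarith
    positivity

lemma noise_nonneg (hp : p.Valid) : 0 ≤ p.noise :=
  div_nonneg (sq_nonneg _) hp.linkGain_pos.le

lemma ofReal_condProb (hp : p.Valid) {T z : ℝ} (hT : 0 ≤ T) (hz : 0 < z) :
    ENNReal.ofReal (p.condProb z T) = expNeg (ENNReal.ofReal (T * z * p.noise)) *
      expNeg (p.rate * p.interferenceExponent T z) := by
  rw [condProb, ENNReal.ofReal_mul (Real.exp_pos _).le, ofReal_V,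
    expNeg_ofReal (mul_nonneg (mul_nonneg hT hz.le) hp.noise_nonneg), noise, mul_div_assoc]

lemma weight_le_one (T s : ℝ) (x : Plane) (b : Bool) : p.weight T s x b ≤ 1 := by
  unfold weight
  split_ifs
  · exact ENNReal.inv_le_one.2 (le_add_right le_rfl)
  · exact zero_le
  · exact le_rfl

lemma serverWeight_le_one (T : ℝ) (B : Set ℝ) (x : Plane) (b : Bool) :
    p.serverWeight T B x b ≤ 1 := by
  unfold serverWeight
  split_ifs
  · exact expNeg_le_one _
  · exact zero_le

lemma measurable_weight (hp : p.Valid) (T : ℝ) (b : Bool) :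
    Measurable fun q : ℝ × Plane => p.weight T q.1 q.2 b := by
  have h1 : Measurable fun q : ℝ × Plane => p.loss b ‖q.2‖ :=
    (measurable_loss b).comp measurable_snd.norm
  unfold weight
  refine Measurable.ite (measurable_snd hp.measurableSet_typicalSector) ?_ measurable_const
  refine Measurable.ite (measurableSet_le measurable_fst h1) ?_ measurable_const
  fun_prop

lemma measurable_serverWeight (hp : p.Valid) (T : ℝ) {B : Set ℝ} (hB : MeasurableSet B) (b : Bool) :
    Measurable fun x : Plane => p.serverWeight T B x b := by
  have h1 : Measurable fun x : Plane => p.loss b ‖x‖ := (measurable_loss b).comp measurable_norm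
  unfold serverWeight
  refine Measurable.ite (hp.measurableSet_typicalSector.inter (h1 hB)) ?_ measurable_const
  exact measurable_expNeg.comp (by fun_prop)

lemma antitone_weight (hp : p.Valid) {T : ℝ} (hT : 0 ≤ T) : Antitone (p.weight T) := by
  intro s t hst x b
  unfold weight
  by_cases hx : x ∈ p.typicalSector
  · rw [if_pos hx, if_pos hx]
    have hl := hp.loss_pos b (norm_pos_of_mem_sector hx)
    by_cases ht : t ≤ p.loss b ‖x‖
    · rw [if_pos ht, if_pos (hst.trans ht)]
      refine ENNReal.inv_le_inv.2 (add_le_add_right (ENNReal.ofReal_le_ofReal ?_) 1)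
      gcongr
    · rw [if_neg ht]
      exact zero_le
  · rw [if_neg hx, if_neg hx]

/-- In the sector the weight jumps to `0` just after `s` passes the loss of the link; the non-strict
`≤` in its definition makes it continuous from the left there. -/
lemma continuousWithinAt_weight (T : ℝ) (x : Plane) (b : Bool) (s : ℝ) :
    ContinuousWithinAt (fun s => p.weight T s x b) (Set.Iic s) s := by
  unfold weight
  by_cases hx : x ∈ p.typicalSector
  · simp only [if_pos hx]
    by_cases hs : s ≤ p.loss b ‖x‖
    · have hc : Continuous fun s => (1 + ENNReal.ofReal (T * s / p.loss b ‖x‖))⁻¹ := by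
        refine continuous_inv.comp (continuous_const.add (ENNReal.continuous_ofReal.comp ?_))
        fun_prop
      refine hc.continuousWithinAt.congr (fun t ht => ?_) ?_
      · rw [if_pos (le_trans ht hs)]
      · rw [if_pos hs]
    · refine (continuousAt_const (y := (0 : ℝ≥0∞))).congr ?_ |>.continuousWithinAt
      filter_upwards [lt_mem_nhds (not_le.1 hs)] with t ht
      rw [if_neg (not_le.2 ht)]
  · simp only [if_neg hx]
    exact continuousWithinAt_const

lemma one_sub_inv_eq {T z l : ℝ} (hT : 0 ≤ T) (hz : 0 < z) (hl : 0 < l) :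
    1 - (1 + ENNReal.ofReal (T * z / l))⁻¹ = ENNReal.ofReal (T * z / (T * z + l)) := by
  have h0 : 0 ≤ T * z := mul_nonneg hT hz.le
  have h1 : (0 : ℝ) < 1 + T * z / l := by positivity
  rw [← ENNReal.ofReal_one, ← ENNReal.ofReal_add zero_le_one (by positivity),
    ← ENNReal.ofReal_inv_of_pos h1, ← ENNReal.ofReal_sub _ (by positivity)]
  congr 1
  field_simp
  ring

/-- The mean number of thinned points. -/
lemma lintegral_one_sub_weight (hp : p.Valid) {T z : ℝ} (hT : 0 ≤ T) (hz : 0 < z) :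
    ∫⁻ y, (1 - ∑ c, ENNReal.ofReal (p.linkProb c ‖y‖) * p.weight T z y c)
        ∂(ENNReal.ofReal p.lam • (volume : Measure Plane)) =
      p.rate * (p.meanBelow z + p.interferenceExponent T z) := by
  let v : Bool → ℝ → ℝ≥0∞ := fun c r =>
    if z ≤ p.loss c r then (1 + ENNReal.ofReal (T * z / p.loss c r))⁻¹ else 0
  have hvle : ∀ c r, v c r ≤ 1 := fun c r => by
    simp only [v]
    split_ifs
    · exact ENNReal.inv_le_one.2 (le_add_right le_rfl)
    · exact zero_le
  have hvm : ∀ c, Measurable (v c) := fun c => by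
    have := measurable_loss (p := p) c
    refine Measurable.ite (measurableSet_le measurable_const this) ?_ measurable_const
    fun_prop
  have hqm : ∀ c, Measurable fun r => ENNReal.ofReal (p.linkProb c r) := fun c =>
    (hp.measurable_linkProb c).ennreal_ofReal
  have hterm : ∀ c, Measurable fun r => ENNReal.ofReal (p.linkProb c r) * (1 - v c r) := fun c =>
    (hqm c).fun_mul ((hvm c).const_sub 1)
  have h1 : ∀ y, 1 - ∑ c, ENNReal.ofReal (p.linkProb c ‖y‖) * p.weight T z y c =
      p.typicalSector.indicator (fun y => ∑ c, ENNReal.ofReal (p.linkProb c ‖y‖) *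
        (1 - v c ‖y‖)) y := by
    intro y
    by_cases hy : y ∈ p.typicalSector
    · rw [Set.indicator_of_mem hy]
      have e1 : ∀ c, p.weight T z y c = v c ‖y‖ := fun c => by simp [weight, v, hy]
      simp_rw [e1]
      refine ENNReal.sub_eq_of_eq_add ?_ ?_
      · exact (ENNReal.sum_lt_top.2 fun c _ => ENNReal.mul_lt_top ENNReal.ofReal_lt_top
          ((hvle _ _).trans_lt ENNReal.one_lt_top)).ne
      · rw [← Finset.sum_add_distrib]
        refine (hp.sum_linkProb (norm_nonneg y)).symm.trans ?_
        refine Finset.sum_congr rfl fun c _ => ?_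
        rw [← mul_add, tsub_add_cancel_of_le (hvle _ _), mul_one]
    · rw [Set.indicator_of_notMem hy]
      have e1 : ∀ c, p.weight T z y c = 1 := fun c => by simp [weight, hy]
      simp_rw [e1, mul_one]
      rw [hp.sum_linkProb (norm_nonneg y), tsub_self]
  simp_rw [h1]
  rw [lintegral_indicator hp.measurableSet_typicalSector,
    hp.setLIntegral_typicalSector (G := fun r => ∑ c, ENNReal.ofReal (p.linkProb c r) * (1 - v c r))
      (Finset.measurable_fun_sum _ fun c _ => hterm c)]
  congr 1
  simp_rw [Finset.mul_sum]
  rw [lintegral_finsetSum _ fun c _ => ENNReal.measurable_ofReal.fun_mul (hterm c), meanBelow,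
    interferenceExponent, ← Finset.sum_add_distrib]
  refine Finset.sum_congr rfl fun c _ => ?_
  have hi := hp.invLoss_pos c hz
  -- Below `invLoss c z` the weight is `0`, which gives the void term; beyond it `one_sub_inv_eq`
  -- gives the interference term.
  rw [← Set.Ioo_union_Ici_eq_Ioi hi, lintegral_union measurableSet_Ici
    (Set.disjoint_left.2 fun r h2 h3 => absurd h2.2 (not_lt.2 h3))]
  congr 1
  · rw [← setLIntegral_congr Ioo_ae_eq_Ioc]
    refine setLIntegral_congr_fun measurableSet_Ioo fun r hr => ?_
    have hlt : p.loss c r < z := (hp.lt_invLoss_iff c hr.1.le hz).1 hr.2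
    simp only [v, if_neg (not_le.2 hlt), tsub_zero, mul_one]
    rw [ENNReal.ofReal_mul (hp.linkProb_nonneg c hr.1.le), mul_comm]
  · rw [setLIntegral_congr Ioi_ae_eq_Ici]
    refine setLIntegral_congr_fun measurableSet_Ici fun r hr => ?_
    have hr0 : 0 < r := hi.trans_le hr
    have hle : z ≤ p.loss c r := by
      rw [← not_lt, ← hp.lt_invLoss_iff c hr0.le hz, not_lt]
      exact hr
    have hl := hp.loss_pos c hr0
    simp only [v, if_pos hle]
    rw [one_sub_inv_eq hT hz hl, ← ENNReal.ofReal_mul (hp.linkProb_nonneg c hr0.le),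
      ← ENNReal.ofReal_mul hr0.le]
    congr 1
    ring

/-- The integrand is a function `H` of the loss of `x` alone, apart from the link probability.
Substituting the loss as variable for each link type turns the link probabilities into
`lossIntensity`; the exponential of the void term completes `f_{Z₁}`, and the remaining factors form
`P̃`. -/
lemma lintegral_serverWeight (hp : p.Valid) {T : ℝ} (hT : 0 ≤ T) {B : Set ℝ}
    (hB : MeasurableSet B) :
    ∑ b, ∫⁻ x, ENNReal.ofReal (p.linkProb b ‖x‖) * p.serverWeight T B x b *
        expNeg (∫⁻ y, (1 - ∑ c, ENNReal.ofReal (p.linkProb c ‖y‖) *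
            p.weight T (p.loss b ‖x‖) y c) ∂(ENNReal.ofReal p.lam • (volume : Measure Plane)))
          ∂(ENNReal.ofReal p.lam • (volume : Measure Plane)) =
      ∫⁻ z in Set.Ioi (0 : ℝ) ∩ B, ENNReal.ofReal (p.fZ z) * ENNReal.ofReal (p.condProb z T) := by
  set H : ℝ → ℝ≥0∞ := fun z => B.indicator (fun z => expNeg (ENNReal.ofReal (T * z * p.noise)) *
    expNeg (p.rate * (p.meanBelow z + p.interferenceExponent T z))) z with hH
  have hHm : Measurable H := by
    refine Measurable.indicator (Measurable.mul ?_ ?_) hB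
    · exact measurable_expNeg.comp (by fun_prop)
    · exact measurable_expNeg.comp
        ((hp.measurable_meanBelow.add (hp.measurable_interferenceExponent T)).const_mul _)
  have hGm : ∀ b, Measurable fun r => ENNReal.ofReal (p.linkProb b r) * H (p.loss b r) := fun b =>
    (hp.measurable_linkProb b).ennreal_ofReal.fun_mul (hHm.comp (measurable_loss b))
  have h1 : ∀ b x, ENNReal.ofReal (p.linkProb b ‖x‖) * p.serverWeight T B x b *
      expNeg (∫⁻ y, (1 - ∑ c, ENNReal.ofReal (p.linkProb c ‖y‖) *
        p.weight T (p.loss b ‖x‖) y c) ∂(ENNReal.ofReal p.lam • (volume : Measure Plane))) =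
      p.typicalSector.indicator (fun x => ENNReal.ofReal (p.linkProb b ‖x‖) *
        H (p.loss b ‖x‖)) x := by
    intro b x
    by_cases hx : x ∈ p.typicalSector
    · rw [Set.indicator_of_mem hx,
        hp.lintegral_one_sub_weight hT (hp.loss_pos b (norm_pos_of_mem_sector hx)), mul_assoc]
      congr 1
      by_cases hxB : p.loss b ‖x‖ ∈ B
      · simp [H, serverWeight, hx, hxB]
      · simp [H, serverWeight, hxB]
    · rw [Set.indicator_of_notMem hx]
      simp [serverWeight, hx]
  simp_rw [h1]
  have h2 : ∀ b, ∫⁻ x, p.typicalSector.indicator (fun x => ENNReal.ofReal (p.linkProb b ‖x‖) *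
      H (p.loss b ‖x‖)) x ∂(ENNReal.ofReal p.lam • (volume : Measure Plane)) =
      p.rate * ∫⁻ z in Set.Ioi (0 : ℝ), ENNReal.ofReal (1 / p.alpha b *
        (1 / p.beta) ^ (2 / p.alpha b) * z ^ (2 / p.alpha b - 1)) *
          ENNReal.ofReal (p.linkProb b (p.invLoss b z)) * H z := by
    intro b
    rw [lintegral_indicator hp.measurableSet_typicalSector, hp.setLIntegral_typicalSector (hGm b),
      lintegral_radial_eq (hp.alpha_pos b) hp.beta_pos]
    congr 1
    refine setLIntegral_congr_fun measurableSet_Ioi fun z hz => ?_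
    have e : (z / p.beta) ^ (1 / p.alpha b) = p.invLoss b z := rfl
    rw [e, hp.loss_invLoss b hz, ← mul_assoc]
  simp_rw [h2]
  have hm : ∀ b, Measurable fun z => ENNReal.ofReal (1 / p.alpha b *
        (1 / p.beta) ^ (2 / p.alpha b) * z ^ (2 / p.alpha b - 1)) *
          ENNReal.ofReal (p.linkProb b (p.invLoss b z)) * H z := fun b =>
    (Measurable.fun_mul (by fun_prop)
      ((hp.measurable_linkProb b).comp (measurable_invLoss b)).ennreal_ofReal).fun_mul hHm
  rw [← Finset.mul_sum, ← lintegral_finsetSum _ fun b _ => hm b,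
    ← lintegral_const_mul _ (Finset.measurable_fun_sum _ fun b _ => hm b), Set.inter_comm,
    ← Measure.restrict_restrict hB, ← lintegral_indicator hB]
  refine setLIntegral_congr_fun measurableSet_Ioi fun z hz => ?_
  rw [← Finset.sum_mul, ← mul_assoc]
  change p.lossIntensity z * H z = _
  by_cases hzB : z ∈ B
  · rw [Set.indicator_of_mem hzB, hp.ofReal_fZ hz, hp.ofReal_condProb hT hz]
    simp only [hH, Set.indicator_of_mem hzB]
    rw [mul_add, expNeg_add]
    ring
  · simp [H, hzB]

end Valid

end Params

/-! ### The Campbell formula for the network. -/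

namespace IsNetwork

variable {Ω : Type*} [MeasurableSpace Ω] {μ : Measure Ω} {p : Params}
  {X : ℕ → Ω → Plane} {los : ℕ → Ω → Bool} {F : ℕ → Ω → ℝ}

lemma isMarking (hnet : IsNetwork μ X los F p.lam p.h) :
    IsMarking μ X los (fun b x => ENNReal.ofReal (p.linkProb b ‖x‖)) :=
  hnet.blockage

/-- The law of the path loss of the closest base station, weighted by the conditional detection
probability. -/
theorem tsum_lintegral_serverWeight [IsProbabilityMeasure μ]
    (hnet : IsNetwork μ X los F p.lam p.h) (hp : p.Valid) {T : ℝ} (hT : 0 ≤ T) {B : Set ℝ} (hB : MeasurableSet B) :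
    ∑' i, ∫⁻ ω, p.serverWeight T B (X i ω) (los i ω) *
        redProd i (fun j => p.weight T (p.loss (los i ω) ‖X i ω‖) (X j ω) (los j ω)) ∂μ =
      ∫⁻ z in Set.Ioi (0 : ℝ) ∩ B, ENNReal.ofReal (p.fZ z) * ENNReal.ofReal (p.condProb z T) := by
  rw [← hp.lintegral_serverWeight hT hB]
  have : SigmaFinite (ENNReal.ofReal p.lam • (volume : Measure Plane)) :=
    SMul.sigmaFinite (μ := (volume : Measure Plane)) p.lam.toNNReal
  exact hnet.isMarking.palm hnet.poisson hnet.measurable_los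
    (fun b => ((hp.measurable_linkProb b).comp measurable_norm).ennreal_ofReal)
    (fun x => hp.sum_linkProb (norm_nonneg x)) (hp.measurable_serverWeight T hB)
    (Params.Valid.serverWeight_le_one T B) (z := fun x b => p.loss b ‖x‖)
    (fun b => (Params.Valid.measurable_loss b).comp measurable_norm)
    (hp.measurable_weight T) (Params.Valid.weight_le_one T) (hp.antitone_weight hT)
    (Params.Valid.continuousWithinAt_weight T)

end IsNetwork

/-! ### Configurations and their best base station. -/

namespace Params

variable (p : Params)

/-- The path loss of the `i`-th base station of the configuration `y` of locations and link
types. -/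
def configLoss (i : ℕ) (y : (ℕ → Plane) × (ℕ → Bool)) : ℝ := p.loss (y.2 i) ‖y.1 i‖

/-- In the configuration `y`, the `i`-th base station has the smallest path loss in the sector. -/
def IsServer (i : ℕ) (y : (ℕ → Plane) × (ℕ → Bool)) : Prop :=
  y.1 i ∈ p.typicalSector ∧
    ∀ j, j ≠ i → y.1 j ∈ p.typicalSector → p.configLoss i y ≤ p.configLoss j y

/-- The `i`-th base station has the smallest path loss in the sector, and it lies in `B`. -/
def serverSet (B : Set ℝ) (i : ℕ) : Set ((ℕ → Plane) × (ℕ → Bool)) :=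
  {y | p.IsServer i y ∧ p.configLoss i y ∈ B}

open Classical in
/-- The coefficient of the fading of the `j`-th base station in the detection condition for the
`i`-th one. -/
def fadingCoeff (T : ℝ) (i j : ℕ) (y : (ℕ → Plane) × (ℕ → Bool)) : ℝ≥0 :=
  if y.1 j ∈ p.typicalSector then (T * p.configLoss i y / p.configLoss j y).toNNReal else 0

variable {p}

namespace Valid

lemma measurable_configLoss (i : ℕ) : Measurable (p.configLoss i) := by
  have h1 : Measurable fun y : (ℕ → Plane) × (ℕ → Bool) => y.1 i :=
    (measurable_pi_apply i).comp measurable_fst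
  have h2 : Measurable fun y : (ℕ → Plane) × (ℕ → Bool) => y.2 i :=
    (measurable_pi_apply i).comp measurable_snd
  have h : p.configLoss i = fun y =>
      if y.2 i = true then p.loss true ‖y.1 i‖ else p.loss false ‖y.1 i‖ := by
    funext y
    unfold configLoss
    cases y.2 i <;> simp
  rw [h]
  exact Measurable.ite (h2 (measurableSet_singleton true))
    ((measurable_loss true).comp h1.norm) ((measurable_loss false).comp h1.norm)

lemma measurableSet_mem_sector (hp : p.Valid) (i : ℕ) :
    MeasurableSet {y : (ℕ → Plane) × (ℕ → Bool) | y.1 i ∈ p.typicalSector} :=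
  ((measurable_pi_apply i).comp measurable_fst) hp.measurableSet_typicalSector

lemma measurableSet_isServer (hp : p.Valid) (i : ℕ) : MeasurableSet {y | p.IsServer i y} := by
  have h : {y | p.IsServer i y} = {y | y.1 i ∈ p.typicalSector} ∩
      ⋂ j, ⋂ (_ : j ≠ i), ({y | y.1 j ∈ p.typicalSector}ᶜ ∪
        {y | p.configLoss i y ≤ p.configLoss j y}) := by
    ext y
    simp only [IsServer, Set.mem_ofPred_eq, Set.mem_inter_iff, Set.mem_iInter, Set.mem_union,
      Set.mem_compl_iff, imp_iff_not_or]
  rw [h]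
  exact (hp.measurableSet_mem_sector i).inter (MeasurableSet.iInter fun j => MeasurableSet.iInter
    fun _ => (hp.measurableSet_mem_sector j).compl.union
      (measurableSet_le (measurable_configLoss i) (measurable_configLoss j)))

lemma measurableSet_serverSet (hp : p.Valid) {B : Set ℝ} (hB : MeasurableSet B) (i : ℕ) :
    MeasurableSet (p.serverSet B i) :=
  (hp.measurableSet_isServer i).inter (measurable_configLoss i hB)

lemma measurable_fadingCoeff (hp : p.Valid) (T : ℝ) (i j : ℕ) :
    Measurable (p.fadingCoeff T i j) := by
  unfold fadingCoeff
  refine Measurable.ite (hp.measurableSet_mem_sector j) ?_ measurable_const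
  exact (((measurable_configLoss i).const_mul T).div (measurable_configLoss j)).real_toNNReal

lemma configLoss_pos (hp : p.Valid) {i : ℕ} {y : (ℕ → Plane) × (ℕ → Bool)}
    (hy : y.1 i ∈ p.typicalSector) : 0 < p.configLoss i y :=
  hp.loss_pos _ (norm_pos_of_mem_sector hy)

-- Minimality is absorbed by the product: a base station of the sector with smaller loss has weight
-- `0` and kills the right-hand side, and otherwise the weights reduce to the fading factors.
open Classical in
lemma indicator_serverSet (T : ℝ) (B : Set ℝ) (i : ℕ)
    (y : (ℕ → Plane) × (ℕ → Bool)) :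
    (p.serverSet B i).indicator 1 y * (expNeg (ENNReal.ofReal (T * p.configLoss i y * p.noise)) *
        redProd i fun j => (1 + (p.fadingCoeff T i j y : ℝ≥0∞))⁻¹) =
      p.serverWeight T B (y.1 i) (y.2 i) *
        redProd i (fun j => p.weight T (p.loss (y.2 i) ‖y.1 i‖) (y.1 j) (y.2 j)) := by
  change _ = _ * redProd i (fun j => p.weight T (p.configLoss i y) (y.1 j) (y.2 j))
  by_cases hs : y.1 i ∈ p.typicalSector ∧ p.configLoss i y ∈ B
  · have hsw : p.serverWeight T B (y.1 i) (y.2 i) =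
        expNeg (ENNReal.ofReal (T * p.configLoss i y * p.noise)) := if_pos hs
    rw [hsw]
    by_cases hmin : p.IsServer i y
    · rw [Set.indicator_of_mem (show y ∈ p.serverSet B i from ⟨hmin, hs.2⟩), Pi.one_apply, one_mul]
      congr 1
      unfold redProd
      refine iInf_congr fun n => Finset.prod_congr rfl fun j hj => ?_
      by_cases hj' : y.1 j ∈ p.typicalSector
      · have hle : p.configLoss i y ≤ p.loss (y.2 j) ‖y.1 j‖ :=
          hmin.2 j (Finset.ne_of_mem_erase hj) hj'
        have hc : p.fadingCoeff T i j y = (T * p.configLoss i y / p.configLoss j y).toNNReal :=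
          if_pos hj'
        show (1 + (p.fadingCoeff T i j y : ℝ≥0∞))⁻¹ = p.weight T (p.configLoss i y) (y.1 j) (y.2 j)
        rw [hc, weight, if_pos hj', if_pos hle]
        rfl
      · have hc : p.fadingCoeff T i j y = 0 := if_neg hj'
        show (1 + (p.fadingCoeff T i j y : ℝ≥0∞))⁻¹ = p.weight T (p.configLoss i y) (y.1 j) (y.2 j)
        rw [hc, weight, if_neg hj']
        simp
    · rw [Set.indicator_of_notMem (fun h => hmin h.1), zero_mul]
      obtain ⟨j, hji, hj, hlt⟩ : ∃ j, j ≠ i ∧ y.1 j ∈ p.typicalSector ∧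
          p.configLoss j y < p.configLoss i y := by
        by_contra hcon
        push Not at hcon
        exact hmin ⟨hs.1, hcon⟩
      have hw : p.weight T (p.configLoss i y) (y.1 j) (y.2 j) = 0 := by
        rw [weight, if_pos hj]
        exact if_neg (not_le.2 hlt)
      have h0 : redProd i (fun j => p.weight T (p.configLoss i y) (y.1 j) (y.2 j)) = 0 := by
        -- The partial product over `range (j + 1)` already contains the zero factor with index `j`.
        refine le_antisymm ((iInf_le _ (j + 1)).trans (le_of_eq ?_)) zero_le
        exact Finset.prod_eq_zero (i := j) (by simp [hji]) hw
      rw [h0, mul_zero]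
  · have hsw : p.serverWeight T B (y.1 i) (y.2 i) = 0 := if_neg hs
    rw [hsw, zero_mul, Set.indicator_of_notMem (fun h => hs ⟨h.1.1, h.2⟩), zero_mul]

end Valid

end Params

/-! ### Detection events and their total probability. -/

namespace IsNetwork

/-- The configuration of locations and link types. -/
def config {Ω : Type*} (X : ℕ → Ω → Plane) (los : ℕ → Ω → Bool) (ω : Ω) : (ℕ → Plane) × (ℕ → Bool) :=
  (fun i => X i ω, fun i => los i ω)

lemma pathLoss_eq {Ω : Type*} {p : Params} {X : ℕ → Ω → Plane} {los : ℕ → Ω → Bool} (i : ℕ)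
    (ω : Ω) : p.pathLoss X los i ω = p.configLoss i (config X los ω) := by
  simp only [Params.pathLoss, Params.configLoss, config]
  cases los i ω <;> rfl

variable {Ω : Type*} [MeasurableSpace Ω] {μ : Measure Ω} {p : Params}
  {X : ℕ → Ω → Plane} {los : ℕ → Ω → Bool} {F : ℕ → Ω → ℝ}

lemma measurable_config (hnet : IsNetwork μ X los F p.lam p.h) : Measurable (config X los) :=
  (measurable_pi_lambda _ hnet.poisson.measurable_point).prodMk
    (measurable_pi_lambda _ hnet.measurable_los)

/-- The `i`-th base station has the smallest path loss, which lies in `B`, and its fading exceeds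
the threshold times interference plus noise. -/
def detectionEvent (p : Params) (X : ℕ → Ω → Plane) (los : ℕ → Ω → Bool) (F : ℕ → Ω → ℝ) (T : ℝ)
    (B : Set ℝ) (i : ℕ) : Set Ω :=
  {ω | config X los ω ∈ p.serverSet B i ∧
    ENNReal.ofReal (T * p.configLoss i (config X los ω) * p.noise) +
      ∑' j, (if j = i then 0 else p.fadingCoeff T i j (config X los ω) * ENNReal.ofReal (F j ω)) <
        ENNReal.ofReal (F i ω)}

theorem tsum_measure_detectionEvent [IsProbabilityMeasure μ]
    (hnet : IsNetwork μ X los F p.lam p.h) (hp : p.Valid) {T : ℝ}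
    (hT : 0 ≤ T) {B : Set ℝ} (hB : MeasurableSet B) :
    ∑' i, μ (detectionEvent p X los F T B i) =
      ∫⁻ z in Set.Ioi (0 : ℝ) ∩ B, ENNReal.ofReal (p.fZ z) * ENNReal.ofReal (p.condProb z T) := by
  rw [← hnet.tsum_lintegral_serverWeight hp hT hB]
  refine tsum_congr fun i => ?_
  refine (measure_lt_fading_of_indepFun hnet.measurable_fading hnet.fading_law hnet.fading_indep
    hnet.measurable_config hnet.fading_indep_network i
    (τ := fun y => ENNReal.ofReal (T * p.configLoss i y * p.noise)) ?_
    (fun j => hp.measurable_fadingCoeff T i j) (hp.measurableSet_serverSet hB i)).trans ?_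
  · exact (((Params.Valid.measurable_configLoss i).const_mul T).mul_const _).ennreal_ofReal
  · exact lintegral_congr fun ω => Params.Valid.indicator_serverSet T B i _

/-- The case `T = 0`: the noise and interference factors become `1`, and only minimality remains. -/
theorem tsum_measure_serverSet [IsProbabilityMeasure μ]
    (hnet : IsNetwork μ X los F p.lam p.h) (hp : p.Valid) {B : Set ℝ} (hB : MeasurableSet B) :
    ∑' i, μ (config X los ⁻¹' p.serverSet B i) =
      ∫⁻ z in Set.Ioi (0 : ℝ) ∩ B, ENNReal.ofReal (p.fZ z) := by
  have h := hnet.tsum_lintegral_serverWeight hp le_rfl hB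
  have h1 : ∀ z ∈ Set.Ioi (0 : ℝ) ∩ B, ENNReal.ofReal (p.fZ z) * ENNReal.ofReal (p.condProb z 0) =
      ENNReal.ofReal (p.fZ z) := by
    intro z hz
    rw [hp.ofReal_condProb le_rfl hz.1]
    simp [Params.interferenceExponent]
  rw [setLIntegral_congr_fun (measurableSet_Ioi.inter hB) h1] at h
  rw [← h]
  refine tsum_congr fun i => ?_
  have hS : MeasurableSet (config X los ⁻¹' p.serverSet B i) :=
    hnet.measurable_config (hp.measurableSet_serverSet hB i)
  rw [← lintegral_indicator_one hS]
  refine lintegral_congr fun ω => ?_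
  have e := Params.Valid.indicator_serverSet (p := p) 0 B i (config X los ω)
  have e2 : ∀ j, (1 + (p.fadingCoeff 0 i j (config X los ω) : ℝ≥0∞))⁻¹ = 1 := fun j => by
    simp [Params.fadingCoeff]
  simp_rw [e2] at e
  have e3 : redProd i (fun _ => 1) = 1 := by simp [redProd]
  rw [e3] at e
  simp only [zero_mul, ENNReal.ofReal_zero, expNeg_zero, mul_one] at e
  exact e

end IsNetwork

/-! ### Existence and uniqueness of the best base station; the law of `Z₁`. -/

namespace IsNetwork

/-- Path losses not exceeding that of a given base station force bounded distance, so only finitely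
many candidates compete. -/
lemma exists_isServer {Ω : Type*} {p : Params} {X : ℕ → Ω → Plane} {los : ℕ → Ω → Bool}
    (hp : p.Valid) {ω : Ω}
    (hfin : ∀ n : ℕ, {i | X i ω ∈ p.typicalSector ∩ {x | ‖x‖ ≤ (n : ℝ)}}.Finite)
    (hne : ∃ i, X i ω ∈ p.typicalSector) : ∃ i, p.IsServer i (config X los ω) := by
  obtain ⟨i₀, hi₀⟩ := hne
  set y := config X los ω with hy
  have hz : 0 < p.configLoss i₀ y := hp.configLoss_pos hi₀
  obtain ⟨n, hn⟩ := exists_nat_ge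
    (max (p.invLoss true (p.configLoss i₀ y)) (p.invLoss false (p.configLoss i₀ y)))
  have hS : {i | X i ω ∈ p.typicalSector ∧ p.configLoss i y ≤ p.configLoss i₀ y}.Finite := by
    refine (hfin n).subset fun i hi => ⟨hi.1, ?_⟩
    have h1 : ‖X i ω‖ ≤ p.invLoss (los i ω) (p.configLoss i₀ y) := by
      rw [← not_lt, hp.invLoss_lt_iff _ (norm_nonneg _) hz, not_lt]
      exact hi.2
    refine h1.trans (le_trans ?_ hn)
    cases los i ω
    · exact le_max_right _ _
    · exact le_max_left _ _
  obtain ⟨i, hi, hmin⟩ := hS.exists_minimalFor (fun i => p.configLoss i y) _ ⟨i₀, hi₀, le_rfl⟩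
  refine ⟨i, hi.1, fun j _ hj => ?_⟩
  rcases le_total (p.configLoss j y) (p.configLoss i y) with h | h
  · exact hmin ⟨hj, h.trans hi.2⟩ h
  · exact h

lemma minLoss_eq {Ω : Type*} {p : Params} {X : ℕ → Ω → Plane} {los : ℕ → Ω → Bool} {ω : Ω} {i : ℕ}
    (hi : p.IsServer i (config X los ω)) :
    p.minLoss X los ω = p.configLoss i (config X los ω) := by
  refine IsLeast.csInf_eq ⟨⟨i, hi.1, (pathLoss_eq i ω).symm⟩, ?_⟩
  rintro l ⟨j, hj, rfl⟩
  rw [pathLoss_eq]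
  by_cases hji : j = i
  · rw [hji]
  · exact hi.2 j hji hj

variable {Ω : Type*} [MeasurableSpace Ω] {μ : Measure Ω} {p : Params}
  {X : ℕ → Ω → Plane} {los : ℕ → Ω → Bool} {F : ℕ → Ω → ℝ}

lemma sigmaFinite_intensity (lam : ℝ) :
    SigmaFinite (ENNReal.ofReal lam • (volume : Measure Plane)) :=
  SMul.sigmaFinite (μ := (volume : Measure Plane)) lam.toNNReal

lemma intensity_sector_inter_closedBall (hp : p.Valid) {R : ℝ} (hR : 0 ≤ R) :
    (ENNReal.ofReal p.lam • (volume : Measure Plane))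
        (p.typicalSector ∩ {x | ‖x‖ ≤ R}) =
      ENNReal.ofReal (2 * Real.pi * (p.lam / p.Kcs) * (R ^ 2 / 2)) := by
  have hm : MeasurableSet {x : Plane | ‖x‖ ≤ R} := measurableSet_le measurable_norm measurable_const
  have h := hp.setLIntegral_typicalSector
    (G := (Set.Iic R).indicator 1) (measurable_one.indicator measurableSet_Iic)
  have h1 : ∀ x : Plane, (Set.Iic R).indicator (1 : ℝ → ℝ≥0∞) ‖x‖ =
      {x : Plane | ‖x‖ ≤ R}.indicator 1 x := fun x => by
    simp [Set.indicator_apply]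
  simp_rw [h1] at h
  rw [lintegral_indicator_one hm, Measure.restrict_apply hm, Set.inter_comm] at h
  rw [h, ENNReal.ofReal_mul hp.rate_pos.le, Params.rate]
  congr 1
  have h2 : ∀ r, ENNReal.ofReal r * (Set.Iic R).indicator 1 r =
      (Set.Iic R).indicator (fun r => ENNReal.ofReal r) r := fun r => by
    by_cases hr : r ≤ R <;> simp [hr]
  simp_rw [h2]
  rw [lintegral_indicator measurableSet_Iic, Measure.restrict_restrict measurableSet_Iic,
    Set.Iic_inter_Ioi, ← ofReal_integral_eq_lintegral_ofReal]
  · rw [← intervalIntegral.integral_of_le hR]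
    simp
  · exact (continuous_id.integrableOn_Icc (a := 0) (b := R)).mono_set Set.Ioc_subset_Icc_self
  · exact (ae_restrict_iff' measurableSet_Ioc).2 (ae_of_all _ fun r hr => hr.1.le)

lemma ae_finite [IsProbabilityMeasure μ] (hnet : IsNetwork μ X los F p.lam p.h) (hp : p.Valid) :
    ∀ᵐ ω ∂μ, ∀ n : ℕ, {i | X i ω ∈ p.typicalSector ∩ {x | ‖x‖ ≤ (n : ℝ)}}.Finite := by
  have := sigmaFinite_intensity p.lam
  refine ae_all_iff.2 fun n => ?_
  set A : Set Plane := p.typicalSector ∩ {x | ‖x‖ ≤ (n : ℝ)} with hA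
  have hAm : MeasurableSet A :=
    hp.measurableSet_typicalSector.inter (measurableSet_le measurable_norm measurable_const)
  have hfin : (ENNReal.ofReal p.lam • (volume : Measure Plane)) A ≠ ∞ := by
    rw [hA, intensity_sector_inter_closedBall hp n.cast_nonneg]
    exact ENNReal.ofReal_ne_top
  have hm : ∀ i, Measurable fun ω => A.indicator (1 : Plane → ℝ≥0∞) (X i ω) := fun i =>
    (measurable_one.indicator hAm).comp (hnet.poisson.measurable_point i)
  have h := hnet.poisson.tsum_measure hAm hfin
  rw [← lintegral_tsum fun i => (hm i).aemeasurable] at h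
  filter_upwards [ae_lt_top (Measurable.tsum hm) (h ▸ hfin)] with ω hω
  rw [← encard_eq_tsum_indicator (fun i => X i ω) A] at hω
  rw [← Set.encard_lt_top_iff]
  exact lt_top_iff_ne_top.2 fun htop => by simp [htop] at hω

/-- The void probability of the sector truncated at radius `n` tends to `0`. -/
lemma ae_exists_mem_sector [IsProbabilityMeasure μ] (hnet : IsNetwork μ X los F p.lam p.h)
    (hp : p.Valid) : ∀ᵐ ω ∂μ, ∃ i, X i ω ∈ p.typicalSector := by
  set c : ℝ := 2 * Real.pi * (p.lam / p.Kcs) with hc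
  have hc0 : 0 < c := hp.rate_pos
  have hle : ∀ n : ℕ, μ {ω | ¬ ∃ i, X i ω ∈ p.typicalSector} ≤
      ENNReal.ofReal (Real.exp (-(c * ((n : ℝ) ^ 2 / 2)))) := by
    intro n
    set A : Set Plane := p.typicalSector ∩ {x | ‖x‖ ≤ (n : ℝ)} with hA
    have hAm : MeasurableSet A :=
      hp.measurableSet_typicalSector.inter (measurableSet_le measurable_norm measurable_const)
    have hΛ := intensity_sector_inter_closedBall hp n.cast_nonneg (R := (n : ℝ))
    rw [← hA, ← hc] at hΛ
    have h := hnet.poisson.counts_fintype (ι := Unit) (fun _ => A) (fun _ => 0) (fun _ => hAm)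
      (fun _ => by rw [hΛ]; exact ENNReal.ofReal_ne_top)
      (fun a b hab => absurd (Subsingleton.elim a b) hab)
    have hr : ((ENNReal.ofReal (c * ((n : ℝ) ^ 2 / 2))).toNNReal : ℝ) = c * ((n : ℝ) ^ 2 / 2) := by
      rw [ENNReal.coe_toNNReal_eq_toReal, ENNReal.toReal_ofReal (by positivity)]
    simp only [Finset.univ_unique, Finset.prod_singleton, poissonMeasure_singleton, hΛ, hr,
      pow_zero, mul_one, Nat.factorial_zero, Nat.cast_one, div_one] at h
    rw [← h]
    refine measure_mono fun ω hω => Set.mem_iInter.2 fun _ => ?_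
    simp only [Set.mem_ofPred_eq, Nat.cast_zero, Set.encard_eq_zero]
    exact Set.eq_empty_of_forall_notMem fun i hi => hω ⟨i, hi.1⟩
  have hlim : Tendsto (fun n : ℕ => ENNReal.ofReal (Real.exp (-(c * ((n : ℝ) ^ 2 / 2))))) atTop
      (𝓝 0) := by
    rw [← ENNReal.ofReal_zero]
    refine ENNReal.tendsto_ofReal (Real.tendsto_exp_neg_atTop_nhds_zero.comp ?_)
    refine Tendsto.const_mul_atTop hc0 (Tendsto.atTop_div_const two_pos ?_)
    exact (tendsto_pow_atTop two_ne_zero).comp tendsto_natCast_atTop_atTop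
  exact le_antisymm (ge_of_tendsto' hlim hle) zero_le

lemma measurableSet_preimage_serverSet (hnet : IsNetwork μ X los F p.lam p.h) (hp : p.Valid)
    {B : Set ℝ} (hB : MeasurableSet B) (i : ℕ) :
    MeasurableSet (config X los ⁻¹' p.serverSet B i) :=
  hnet.measurable_config (hp.measurableSet_serverSet hB i)

/-- Almost surely, exactly one base station of the sector has the smallest path loss. -/
theorem ae_existsUnique_isServer [IsProbabilityMeasure μ] (hnet : IsNetwork μ X los F p.lam p.h)
    (hp : p.Valid) : ∀ᵐ ω ∂μ, ∃! i, p.IsServer i (config X los ω) := by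
  have hsum := hnet.tsum_measure_serverSet hp MeasurableSet.univ
  rw [Set.inter_univ, hp.lintegral_ofReal_fZ] at hsum
  have hm : ∀ i, MeasurableSet (config X los ⁻¹' p.serverSet Set.univ i) :=
    hnet.measurableSet_preimage_serverSet hp MeasurableSet.univ
  have hmi : ∀ i, Measurable ((config X los ⁻¹' p.serverSet Set.univ i).indicator
      (1 : Ω → ℝ≥0∞)) := fun i => measurable_one.indicator (hm i)
  set S : Ω → ℝ≥0∞ := fun ω =>
    ∑' i, (config X los ⁻¹' p.serverSet Set.univ i).indicator 1 ω with hS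
  have hSint : ∫⁻ ω, S ω ∂μ = 1 := by
    rw [hS, lintegral_tsum fun i => (hmi i).aemeasurable, ← hsum]
    exact tsum_congr fun i => lintegral_indicator_one (hm i)
  have hSenc : ∀ ω, S ω = (({i | p.IsServer i (config X los ω)}.encard : ℕ∞) : ℝ≥0∞) := by
    intro ω
    rw [← ENNReal.tsum_set_one, tsum_subtype {i | p.IsServer i (config X los ω)}
      (fun _ => (1 : ℝ≥0∞))]
    refine tsum_congr fun i => ?_
    by_cases hi : p.IsServer i (config X los ω)
    · rw [Set.indicator_of_mem (show ω ∈ config X los ⁻¹' p.serverSet Set.univ i from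
        ⟨hi, trivial⟩), Set.indicator_of_mem (s := {i | p.IsServer i (config X los ω)}) hi]
      rfl
    · rw [Set.indicator_of_notMem (fun h => hi h.1),
        Set.indicator_of_notMem (s := {i | p.IsServer i (config X los ω)}) hi]
  have hS1 : ∀ᵐ ω ∂μ, 1 ≤ S ω := by
    filter_upwards [hnet.ae_finite hp, hnet.ae_exists_mem_sector hp] with ω h1 h2
    obtain ⟨i, hi⟩ := exists_isServer (los := los) hp h1 h2
    rw [hSenc, ← ENat.toENNReal_one, ENat.toENNReal_le, Set.one_le_encard_iff_nonempty]
    exact ⟨i, hi⟩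
  have hSm : Measurable S := Measurable.tsum hmi
  -- The number `S` of minimisers is almost surely at least `1` and has mean `1`, hence equals `1`
  -- almost surely.
  have hSeq : (fun _ => (1 : ℝ≥0∞)) =ᵐ[μ] S := by
    refine ae_eq_of_ae_le_of_lintegral_le hS1 (by simp) hSm.aemeasurable ?_
    rw [hSint]
    simp
  filter_upwards [hSeq] with ω hω
  rw [hSenc, ← ENat.toENNReal_one, ENat.toENNReal_inj, eq_comm, Set.encard_eq_one] at hω
  obtain ⟨i, hi⟩ := hω
  refine ⟨i, ?_, fun j hj => ?_⟩
  · have : i ∈ {i | p.IsServer i (config X los ω)} := hi ▸ rfl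
    exact this
  · have : j ∈ {i | p.IsServer i (config X los ω)} := hj
    rwa [hi] at this

lemma measurable_minLoss (hnet : IsNetwork μ X los F p.lam p.h) (hp : p.Valid) :
    Measurable (p.minLoss X los) := by
  have hX : ∀ i, MeasurableSet {ω | X i ω ∈ p.typicalSector} := fun i =>
    hnet.poisson.measurable_point i hp.measurableSet_typicalSector
  have hl : ∀ i, Measurable (p.pathLoss X los i) := fun i => by
    have : p.pathLoss X los i = p.configLoss i ∘ config X los := funext fun ω => pathLoss_eq i ω
    rw [this]
    exact (Params.Valid.measurable_configLoss i).comp hnet.measurable_config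
  have hpos : ∀ i ω, X i ω ∈ p.typicalSector → 0 < p.pathLoss X los i ω := fun i ω h => by
    rw [pathLoss_eq]
    exact hp.configLoss_pos h
  refine measurable_of_Iio fun c => ?_
  -- Since `sInf ∅ = 0` in `ℝ`, a configuration with empty sector belongs to the sublevel set
  -- exactly when `0 < c`.
  have hset : p.minLoss X los ⁻¹' Set.Iio c =
      ({ω | 0 < c} ∩ ⋂ i, {ω | X i ω ∈ p.typicalSector}ᶜ) ∪
        ⋃ i, ({ω | X i ω ∈ p.typicalSector} ∩ {ω | p.pathLoss X los i ω < c}) := by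
    ext ω
    simp only [Set.mem_preimage, Set.mem_Iio, Set.mem_union, Set.mem_inter_iff, Set.mem_iInter,
      Set.mem_compl_iff, Set.mem_iUnion, Set.mem_ofPred_eq]
    set L : Set ℝ := {l | ∃ i, X i ω ∈ p.typicalSector ∧ l = p.pathLoss X los i ω} with hL
    have hmin : p.minLoss X los ω = sInf L := rfl
    have hbdd : BddBelow L := ⟨0, by
      rintro l ⟨i, hi, rfl⟩
      exact (hpos i ω hi).le⟩
    by_cases hne : ∃ i, X i ω ∈ p.typicalSector
    · obtain ⟨i₀, hi₀⟩ := hne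
      rw [hmin, csInf_lt_iff hbdd ⟨_, i₀, hi₀, rfl⟩]
      constructor
      · rintro ⟨l, ⟨i, hi, rfl⟩, hlt⟩
        exact Or.inr ⟨i, hi, hlt⟩
      · rintro (⟨-, h⟩ | ⟨i, hi, hlt⟩)
        · exact absurd hi₀ (h i₀)
        · exact ⟨_, ⟨i, hi, rfl⟩, hlt⟩
    · have hempty : L = ∅ := Set.eq_empty_of_forall_notMem fun l ⟨i, hi, _⟩ => hne ⟨i, hi⟩
      rw [hmin, hempty, Real.sInf_empty]
      push Not at hne
      constructor
      · exact fun h => Or.inl ⟨h, hne⟩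
      · rintro (⟨h, -⟩ | ⟨i, hi, -⟩)
        · exact h
        · exact absurd hi (hne i)
  rw [hset]
  exact ((MeasurableSet.const _).inter (MeasurableSet.iInter fun i => (hX i).compl)).union
    (MeasurableSet.iUnion fun i => (hX i).inter (measurableSet_lt (hl i) measurable_const))

lemma aedisjoint_of_subset_isServer [IsProbabilityMeasure μ]
    (hnet : IsNetwork μ X los F p.lam p.h) (hp : p.Valid) {E : ℕ → Set Ω}
    (hE : ∀ i, ∀ ω ∈ E i, p.IsServer i (config X los ω)) :
    Pairwise (Function.onFun (AEDisjoint μ) E) := by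
  intro i j hij
  have h := hnet.ae_existsUnique_isServer hp
  have hsub : E i ∩ E j ⊆ {ω | ¬ ∃! i, p.IsServer i (config X los ω)} := fun ω hω hu =>
    hij (hu.unique (hE i ω hω.1) (hE j ω hω.2))
  exact measure_mono_null hsub (ae_iff.1 h)

/-- The law of the smallest path loss. -/
theorem map_minLoss [IsProbabilityMeasure μ] (hnet : IsNetwork μ X los F p.lam p.h) (hp : p.Valid) :
    μ.map (p.minLoss X los) =
      (volume.restrict (Set.Ioi (0 : ℝ))).withDensity (fun z => ENNReal.ofReal (p.fZ z)) := by
  ext B hB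
  rw [Measure.map_apply (hnet.measurable_minLoss hp) hB, withDensity_apply _ hB,
    Measure.restrict_restrict hB, Set.inter_comm, ← hnet.tsum_measure_serverSet hp hB,
    ← measure_iUnion₀ (hnet.aedisjoint_of_subset_isServer hp fun i ω hω => hω.1)
      fun i => (hnet.measurableSet_preimage_serverSet hp hB i).nullMeasurableSet]
  refine measure_congr ?_
  filter_upwards [hnet.ae_existsUnique_isServer hp] with ω hω
  obtain ⟨i, hi, huniq⟩ := hω
  refine propext ⟨fun h => ?_, fun h => ?_⟩
  · refine Set.mem_iUnion.2 ⟨i, hi, ?_⟩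
    rw [← minLoss_eq hi]
    exact h
  · obtain ⟨j, hj, hjB⟩ := Set.mem_iUnion.1 h
    show p.minLoss X los ω ∈ B
    rw [minLoss_eq hj]
    exact hjB

end IsNetwork

/-! ### The SINR condition as an inequality between fadings. -/

namespace IsNetwork

/-- The strict inequality in the interference sums excludes the best base station itself and, by
uniqueness of the minimiser, no other base station of the sector. Each remaining index occurs in
exactly one of the two sums, according to its link type. -/
lemma interference_eq {Ω : Type*} {p : Params} {X : ℕ → Ω → Plane} {los : ℕ → Ω → Bool}
    (F : ℕ → Ω → ℝ) (hp : p.Valid) {T : ℝ} (hT : 0 ≤ T) {ω : Ω} {i : ℕ}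
    (hi : p.IsServer i (config X los ω))
    (huniq : ∀ j, p.IsServer j (config X los ω) → j = i) :
    ENNReal.ofReal (T * p.configLoss i (config X los ω)) *
        (p.interferenceL X los F ω + p.interferenceN X los F ω) =
      ∑' j, (if j = i then 0 else
        (p.fadingCoeff T i j (config X los ω) : ℝ≥0∞) * ENNReal.ofReal (F j ω)) := by
  have hmin := minLoss_eq hi
  set y := config X los ω with hy
  have hZ : 0 < p.configLoss i y := hp.configLoss_pos hi.1
  set Z := p.configLoss i y with hZdef
  have hstrict : ∀ j, j ≠ i → X j ω ∈ p.typicalSector → Z < p.configLoss j y := by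
    intro j hji hj
    -- A tie would make `j` a second minimiser.
    refine lt_of_le_of_ne (hi.2 j hji hj) fun h => hji (huniq j ⟨hj, fun k _ hk => ?_⟩)
    rw [← h]
    by_cases hki : k = i
    · rw [hki]
    · exact hi.2 k hki hk
  have hL : p.interferenceL X los F ω = ∑' j, {j | los j ω = true ∧ X j ω ∈ p.typicalSector ∧
      p.invLoss true Z < ‖X j ω‖}.indicator (fun j => ENNReal.ofReal (F j ω / p.loss true ‖X j ω‖))
        j := by
    rw [Params.interferenceL, hmin]
    exact tsum_subtype
      {j | los j ω = true ∧ X j ω ∈ p.typicalSector ∧ p.invLoss true Z < ‖X j ω‖}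
      (fun j => ENNReal.ofReal (F j ω / p.loss true ‖X j ω‖))
  have hN : p.interferenceN X los F ω = ∑' j, {j | los j ω = false ∧ X j ω ∈ p.typicalSector ∧
      p.invLoss false Z < ‖X j ω‖}.indicator (fun j => ENNReal.ofReal (F j ω / p.loss false ‖X j ω‖))
        j := by
    rw [Params.interferenceN, hmin]
    exact tsum_subtype
      {j | los j ω = false ∧ X j ω ∈ p.typicalSector ∧ p.invLoss false Z < ‖X j ω‖}
      (fun j => ENNReal.ofReal (F j ω / p.loss false ‖X j ω‖))
  rw [hL, hN, ← ENNReal.tsum_add, ← ENNReal.tsum_mul_left]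
  refine tsum_congr fun j => ?_
  have hlos : ∀ b, los j ω = b → p.configLoss j y = p.loss b ‖X j ω‖ := fun b hb => by
    rw [← hb]
    rfl
  have hLlt : ∀ b, p.invLoss b Z < ‖X j ω‖ ↔ Z < p.loss b ‖X j ω‖ := fun b =>
    hp.invLoss_lt_iff b (norm_nonneg _) hZ
  have key : ∀ b, los j ω = b →
      ENNReal.ofReal (T * Z) *
        ({j | los j ω = b ∧ X j ω ∈ p.typicalSector ∧ p.invLoss b Z < ‖X j ω‖}.indicator
          (fun j => ENNReal.ofReal (F j ω / p.loss b ‖X j ω‖)) j) =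
      if j = i then 0 else (p.fadingCoeff T i j y : ℝ≥0∞) * ENNReal.ofReal (F j ω) := by
    intro b hb
    by_cases hmem : los j ω = b ∧ X j ω ∈ p.typicalSector ∧ p.invLoss b Z < ‖X j ω‖
    · have hlt := (hLlt b).1 hmem.2.2
      have hji : j ≠ i := by
        rintro rfl
        rw [← hlos b hb] at hlt
        exact lt_irrefl _ hlt
      have hc : p.fadingCoeff T i j y = (T * Z / p.configLoss j y).toNNReal := if_pos hmem.2.1
      rw [Set.indicator_of_mem
        (s := {j | los j ω = b ∧ X j ω ∈ p.typicalSector ∧ p.invLoss b Z < ‖X j ω‖}) hmem,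
        if_neg hji, hc, ← ENNReal.ofReal_mul (mul_nonneg hT hZ.le), hlos b hb]
      change _ = ENNReal.ofReal _ * _
      rw [← ENNReal.ofReal_mul (div_nonneg (mul_nonneg hT hZ.le) (hZ.trans hlt).le)]
      congr 1
      ring
    · rw [Set.indicator_of_notMem
        (s := {j | los j ω = b ∧ X j ω ∈ p.typicalSector ∧ p.invLoss b Z < ‖X j ω‖}) hmem, mul_zero]
      split_ifs with hji
      · rfl
      · have hj : X j ω ∉ p.typicalSector := fun hj =>
          hmem ⟨hb, hj, (hLlt b).2 (by rw [← hlos b hb]; exact hstrict j hji hj)⟩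
        have hc : p.fadingCoeff T i j y = 0 := if_neg hj
        rw [hc, ENNReal.coe_zero, zero_mul]
  cases hb : los j ω with
  | false =>
    have hn : j ∉ {j | los j ω = true ∧ X j ω ∈ p.typicalSector ∧ p.invLoss true Z < ‖X j ω‖} :=
      fun h => Bool.noConfusion (hb.symm.trans h.1)
    rw [Set.indicator_of_notMem hn, zero_add]
    exact key false hb
  | true =>
    have hn : j ∉ {j | los j ω = false ∧ X j ω ∈ p.typicalSector ∧ p.invLoss false Z < ‖X j ω‖} :=
      fun h => Bool.noConfusion (hb.symm.trans h.1)
    rw [Set.indicator_of_notMem hn, add_zero]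
    exact key true hb

lemma mem_detected_iff {Ω : Type*} {p : Params} {X : ℕ → Ω → Plane} {los : ℕ → Ω → Bool}
    {F : ℕ → Ω → ℝ} (hp : p.Valid) {T : ℝ} (hT : 0 < T) (B : Set ℝ) {ω : Ω}
    (h : ∃! i, p.IsServer i (config X los ω)) :
    ω ∈ p.detected X los F T ∩ p.minLoss X los ⁻¹' B ↔ ω ∈ ⋃ i, detectionEvent p X los F T B i := by
  obtain ⟨i, hi, huniq⟩ := h
  have hmin := minLoss_eq hi
  have hZ : 0 < p.configLoss i (config X los ω) := hp.configLoss_pos hi.1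
  have hI := interference_eq F hp hT.le hi huniq
  have hsinr : ENNReal.ofReal T < p.sinr X los F i ω ↔
      ENNReal.ofReal (T * p.configLoss i (config X los ω) * p.noise) +
        ∑' j, (if j = i then 0 else
          (p.fadingCoeff T i j (config X los ω) : ℝ≥0∞) * ENNReal.ofReal (F j ω)) <
        ENNReal.ofReal (F i ω) := by
    have hT0 : ENNReal.ofReal T ≠ 0 := by simpa using hT
    -- The threshold is neither `0` nor `∞`, so clearing the denominator is valid even when
    -- interference plus noise is zero or infinite.
    rw [← hI, Params.sinr, hmin, ENNReal.lt_div_iff_mul_lt (Or.inr ENNReal.ofReal_ne_top) (Or.inr hT0)]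
    set Z := p.configLoss i (config X los ω)
    have hZ0 : ENNReal.ofReal Z ≠ 0 := by simpa using hZ
    rw [← ENNReal.mul_lt_mul_iff_right hZ0 ENNReal.ofReal_ne_top,
      ← ENNReal.ofReal_mul hZ.le, mul_div_cancel₀ _ hZ.ne', ← mul_assoc,
      ← ENNReal.ofReal_mul hZ.le, mul_comm Z T, mul_add, add_comm,
      ENNReal.ofReal_mul (mul_nonneg hT.le hZ.le)]
    rfl
  constructor
  · rintro ⟨⟨j, hj, hjmin, hlt⟩, hB⟩
    have hjs : p.IsServer j (config X los ω) := ⟨hj, fun k hkj hk => by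
      rw [← pathLoss_eq, hjmin, hmin]
      by_cases hki : k = i
      · rw [hki]
      · exact hi.2 k hki hk⟩
    obtain rfl := huniq j hjs
    refine Set.mem_iUnion.2 ⟨j, ⟨hi, ?_⟩, hsinr.1 hlt⟩
    rw [← hmin]
    exact hB
  · intro hmem
    obtain ⟨j, ⟨hj, hB⟩, hlt⟩ := Set.mem_iUnion.1 hmem
    obtain rfl := huniq j hj
    refine ⟨⟨j, hi.1, ?_, hsinr.2 hlt⟩, ?_⟩
    · rw [pathLoss_eq, hmin]
    · rw [Set.mem_preimage, hmin]
      exact hB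

variable {Ω : Type*} [MeasurableSpace Ω] {μ : Measure Ω} {p : Params}
  {X : ℕ → Ω → Plane} {los : ℕ → Ω → Bool} {F : ℕ → Ω → ℝ}

lemma measurableSet_detectionEvent (hnet : IsNetwork μ X los F p.lam p.h) (hp : p.Valid) (T : ℝ)
    {B : Set ℝ} (hB : MeasurableSet B) (i : ℕ) :
    MeasurableSet (detectionEvent p X los F T B i) := by
  have hc := hnet.measurable_config
  refine (hnet.measurableSet_preimage_serverSet hp hB i).inter
    (measurableSet_lt (f := fun ω => ENNReal.ofReal (T * p.configLoss i (config X los ω) * p.noise) +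
      ∑' j, (if j = i then 0 else (p.fadingCoeff T i j (config X los ω) : ℝ≥0∞) *
        ENNReal.ofReal (F j ω))) (g := fun ω => ENNReal.ofReal (F i ω)) ?_ ?_)
  · refine Measurable.add ?_ (Measurable.tsum (f := fun j ω => if j = i then 0 else
      (p.fadingCoeff T i j (config X los ω) : ℝ≥0∞) * ENNReal.ofReal (F j ω)) fun j => ?_)
    · exact ((((Params.Valid.measurable_configLoss i).comp hc).const_mul T).mul_const
        _).ennreal_ofReal
    · split_ifs
      · exact measurable_const
      · exact ((hp.measurable_fadingCoeff T i j).comp hc).coe_nnreal_ennreal.mul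
          (hnet.measurable_fading j).ennreal_ofReal
  · exact (hnet.measurable_fading i).ennreal_ofReal

lemma detected_inter_ae_eq [IsProbabilityMeasure μ] (hnet : IsNetwork μ X los F p.lam p.h)
    (hp : p.Valid) {T : ℝ} (hT : 0 < T) (B : Set ℝ) :
    (p.detected X los F T ∩ p.minLoss X los ⁻¹' B : Set Ω) =ᵐ[μ]
      ⋃ i, detectionEvent p X los F T B i := by
  filter_upwards [hnet.ae_existsUnique_isServer hp] with ω hω
  exact propext (mem_detected_iff hp hT B hω)

lemma nullMeasurableSet_detected [IsProbabilityMeasure μ] (hnet : IsNetwork μ X los F p.lam p.h)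
    (hp : p.Valid) {T : ℝ} (hT : 0 < T) : NullMeasurableSet (p.detected X los F T) μ := by
  have h := hnet.detected_inter_ae_eq hp hT Set.univ
  rw [Set.preimage_univ, Set.inter_univ] at h
  exact (MeasurableSet.iUnion fun i => hnet.measurableSet_detectionEvent hp T MeasurableSet.univ
    i).nullMeasurableSet.congr h.symm

/-- The joint law of the smallest path loss and of the detection event. -/
theorem measure_detected_inter [IsProbabilityMeasure μ] (hnet : IsNetwork μ X los F p.lam p.h)
    (hp : p.Valid) {T : ℝ} (hT : 0 < T) {B : Set ℝ} (hB : MeasurableSet B) :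
    μ (p.detected X los F T ∩ p.minLoss X los ⁻¹' B) =
      ∫⁻ z in Set.Ioi (0 : ℝ) ∩ B, ENNReal.ofReal (p.fZ z) * ENNReal.ofReal (p.condProb z T) := by
  rw [measure_congr (hnet.detected_inter_ae_eq hp hT B),
    measure_iUnion₀ (hnet.aedisjoint_of_subset_isServer hp fun i ω hω => hω.1.1)
      fun i => (hnet.measurableSet_detectionEvent hp T hB i).nullMeasurableSet,
    hnet.tsum_measure_detectionEvent hp hT.le hB]

end IsNetwork

/-! ### Integrability, the conditional expectation and the detection probability. -/

namespace Params

variable {p : Params}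

lemma condProb_nonneg (z T : ℝ) : 0 ≤ p.condProb z T :=
  mul_nonneg (Real.exp_pos _).le ENNReal.toReal_nonneg

namespace Valid

lemma measurable_condProb (hp : p.Valid) (T : ℝ) : Measurable fun z => p.condProb z T := by
  have h : ∀ z, p.V z T (p.lam / p.Kcs) = (expNeg (p.rate * p.interferenceExponent T z)).toReal :=
    fun z => by
      rw [← ofReal_V]
      exact (ENNReal.toReal_ofReal ENNReal.toReal_nonneg).symm
  unfold condProb
  simp_rw [h]
  refine Measurable.mul (by fun_prop) (Measurable.ennreal_toReal ?_)
  exact measurable_expNeg.comp ((hp.measurable_interferenceExponent T).const_mul _)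

lemma condProb_le_one (hp : p.Valid) {T z : ℝ} (hT : 0 ≤ T) (hz : 0 < z) : p.condProb z T ≤ 1 := by
  rw [← ENNReal.ofReal_le_one, hp.ofReal_condProb hT hz]
  exact mul_le_one' (expNeg_le_one _) (expNeg_le_one _)

lemma fZ_nonneg (hp : p.Valid) {z : ℝ} (hz : 0 < z) : 0 ≤ p.fZ z := by
  have hl := hp.linkProb_nonneg true (hp.invLoss_pos true hz).le
  have hn := hp.linkProb_nonneg false (hp.invLoss_pos false hz).le
  have hl' : 0 ≤ p.h (p.invLossL z) := hl
  have hn' : 0 ≤ 1 - p.h (p.invLossN z) := hn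
  have := hp.lam_pos
  have := hp.beta_pos
  have := hp.alphaL_pos
  have := hp.alphaN_pos
  unfold fZ
  positivity

/-- On the half-line `fZ` agrees with the real part of the product in `ofReal_fZ`, whose
measurability follows from parametric Lebesgue integrals. -/
lemma aemeasurable_fZ (hp : p.Valid) : AEMeasurable p.fZ (volume.restrict (Set.Ioi 0)) := by
  have hm : Measurable fun z => (p.lossIntensity z * expNeg (p.rate * p.meanBelow z)).toReal :=
    (hp.measurable_lossIntensity.mul
      (measurable_expNeg.comp (hp.measurable_meanBelow.const_mul _))).ennreal_toReal
  refine hm.aemeasurable.congr ((ae_restrict_iff' measurableSet_Ioi).2 (ae_of_all _ fun z hz => ?_))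
  simp only
  rw [← hp.ofReal_fZ hz, ENNReal.toReal_ofReal (hp.fZ_nonneg hz)]

lemma integrableOn_fZ (hp : p.Valid) : IntegrableOn p.fZ (Set.Ioi 0) := by
  refine ⟨hp.aemeasurable_fZ.aestronglyMeasurable, ?_⟩
  rw [hasFiniteIntegral_iff_ofReal ((ae_restrict_iff' measurableSet_Ioi).2
    (ae_of_all _ fun z hz => hp.fZ_nonneg hz)), hp.lintegral_ofReal_fZ]
  exact ENNReal.one_lt_top

lemma integrableOn_condProb_mul_fZ (hp : p.Valid) {T : ℝ} (hT : 0 ≤ T) :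
    IntegrableOn (fun z => p.condProb z T * p.fZ z) (Set.Ioi 0) := by
  refine hp.integrableOn_fZ.bdd_mul (c := 1) (hp.measurable_condProb T).aestronglyMeasurable ?_
  refine (ae_restrict_iff' measurableSet_Ioi).2 (ae_of_all _ fun z hz => ?_)
  rw [Real.norm_of_nonneg (condProb_nonneg z T)]
  exact hp.condProb_le_one hT hz

end Valid

end Params

namespace IsNetwork

variable {Ω : Type*} [MeasurableSpace Ω] {μ : Measure Ω} {p : Params}
  {X : ℕ → Ω → Plane} {los : ℕ → Ω → Bool} {F : ℕ → Ω → ℝ}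

lemma ae_minLoss_pos [IsProbabilityMeasure μ] (hnet : IsNetwork μ X los F p.lam p.h)
    (hp : p.Valid) : ∀ᵐ ω ∂μ, 0 < p.minLoss X los ω := by
  filter_upwards [hnet.ae_existsUnique_isServer hp] with ω ⟨i, hi, _⟩
  rw [minLoss_eq hi]
  exact hp.configLoss_pos hi.1

lemma measure_detected_inter_eq_lintegral [IsProbabilityMeasure μ]
    (hnet : IsNetwork μ X los F p.lam p.h) (hp : p.Valid) {T : ℝ} (hT : 0 < T) {B : Set ℝ}
    (hB : MeasurableSet B) :
    μ (p.detected X los F T ∩ p.minLoss X los ⁻¹' B) =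
      ∫⁻ ω in p.minLoss X los ⁻¹' B, ENNReal.ofReal (p.condProb (p.minLoss X los ω) T) ∂μ := by
  have hZ := hnet.measurable_minLoss hp
  have hg : Measurable fun z => ENNReal.ofReal (p.condProb z T) :=
    (hp.measurable_condProb T).ennreal_ofReal
  rw [hnet.measure_detected_inter hp hT hB, ← setLIntegral_map hB hg hZ, hnet.map_minLoss hp,
    restrict_withDensity hB, Measure.restrict_restrict hB, Set.inter_comm B,
    lintegral_withDensity_eq_lintegral_mul₀ _ hg.aemeasurable]
  · rfl
  · exact (hp.aemeasurable_fZ.mono_measure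
      (Measure.restrict_mono_set _ Set.inter_subset_left)).ennreal_ofReal

/-- The conditional detection probability given the smallest path loss. -/
theorem condExp_detected [IsProbabilityMeasure μ] (hnet : IsNetwork μ X los F p.lam p.h)
    (hp : p.Valid) {T : ℝ} (hT : 0 < T) :
    μ[(p.detected X los F T).indicator (fun _ => (1 : ℝ)) |
        MeasurableSpace.comap (p.minLoss X los) inferInstance] =ᵐ[μ]
      (fun ω => p.condProb (p.minLoss X los ω) T) := by
  have hZ := hnet.measurable_minLoss hp
  have hD := hnet.nullMeasurableSet_detected hp hT
  have hcm : Measurable fun ω => p.condProb (p.minLoss X los ω) T :=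
    (hp.measurable_condProb T).comp hZ
  have hint : Integrable (fun ω => p.condProb (p.minLoss X los ω) T) μ := by
    refine Integrable.of_bound hcm.aestronglyMeasurable 1 ?_
    filter_upwards [hnet.ae_minLoss_pos hp] with ω hω
    rw [Real.norm_of_nonneg (Params.condProb_nonneg _ T)]
    exact hp.condProb_le_one hT.le hω
  -- Every set of the generated σ-algebra is `{Z₁ ∈ B}`, where the required identity is the joint
  -- law. The detection event is only null-measurable, hence the null-measurable forms of the
  -- indicator lemmas.
  refine (ae_eq_condExp_of_forall_setIntegral_eq hZ.comap_le
    ((integrable_const (1 : ℝ)).indicator₀ hD) (fun s _ _ => hint.integrableOn) ?_ ?_).symm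
  · rintro _ ⟨B, hB, rfl⟩ -
    rw [integral_indicator₀ (hD.mono Measure.restrict_le_self), setIntegral_const, smul_eq_mul,
      mul_one, measureReal_def, Measure.restrict_apply' (hZ hB),
      hnet.measure_detected_inter_eq_lintegral hp hT hB, integral_eq_lintegral_of_nonneg_ae
        (ae_of_all _ fun ω => Params.condProb_nonneg _ T) hcm.aestronglyMeasurable]
  · exact ((hp.measurable_condProb T).comp (comap_measurable _)).aestronglyMeasurable

theorem measureReal_detected [IsProbabilityMeasure μ] (hnet : IsNetwork μ X los F p.lam p.h)
    (hp : p.Valid) {T : ℝ} (hT : 0 < T) :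
    μ.real (p.detected X los F T) = ∫ z in Set.Ioi (0 : ℝ), p.condProb z T * p.fZ z := by
  have h := hnet.measure_detected_inter hp hT MeasurableSet.univ
  rw [Set.preimage_univ, Set.inter_univ, Set.inter_univ] at h
  rw [Measure.real, h, integral_eq_lintegral_of_nonneg_ae]
  · congr 1
    refine lintegral_congr fun z => ?_
    rw [ENNReal.ofReal_mul (Params.condProb_nonneg z T), mul_comm]
  · exact (ae_restrict_iff' measurableSet_Ioi).2 (ae_of_all _ fun z hz =>
      mul_nonneg (Params.condProb_nonneg z T) (hp.fZ_nonneg hz))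
  · exact (hp.integrableOn_condProb_mul_fZ hT.le).aestronglyMeasurable

end IsNetwork

end MmWave

end

theorem mainTheorem4 {Ω : Type*} [MeasurableSpace Ω] (μ : Measure Ω) [IsProbabilityMeasure μ]
    (p : MmWave.Params) (hlam : 0 < p.lam)
    (hh_meas : Measurable p.h) (hh : ∀ r : ℝ, 0 ≤ r → p.h r ∈ Set.Icc (0 : ℝ) 1)
    (hbeta : 0 < p.beta) (halphaL : 0 < p.alphaL) (halphaN : 0 < p.alphaN)
    (hPb : 0 < p.Pb) (hC0 : 0 < p.C0) (hMcs : 1 ≤ p.Mcs) (hNcs : 1 ≤ p.Ncs)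
    (X : ℕ → Ω → MmWave.Plane) (los : ℕ → Ω → Bool) (F : ℕ → Ω → ℝ)
    (hnet : MmWave.IsNetwork μ X los F p.lam p.h)
    (Γcs : ℝ) (hΓ : 0 < Γcs) :
    -- `f_{Z₁}` is the probability density function of the smallest path loss `Z₁`
    μ.map (p.minLoss X los) =
        (volume.restrict (Set.Ioi (0 : ℝ))).withDensity (fun z => ENNReal.ofReal (p.fZ z)) ∧
    -- the conditional detection probability given `Z₁ = z` is `P̃(z, Γcs)`
    μ[(p.detected X los F Γcs).indicator (fun _ => (1 : ℝ)) |
        MeasurableSpace.comap (p.minLoss X los) inferInstance] =ᵐ[μ]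
      (fun ω => p.condProb (p.minLoss X los ω) Γcs) ∧
    -- the detection probability is `∫ P̃(z, Γcs) f_{Z₁}(z) dz`
    MeasureTheory.IntegrableOn (fun z => p.condProb z Γcs * p.fZ z) (Set.Ioi (0 : ℝ)) volume ∧
    μ.real (p.detected X los F Γcs) = ∫ z in Set.Ioi (0 : ℝ), p.condProb z Γcs * p.fZ z := by
  have hp : p.Valid :=
    ⟨hlam, hh_meas, hh, hbeta, halphaL, halphaN, hPb, hC0, hMcs, hNcs⟩
  exact ⟨hnet.map_minLoss hp, hnet.condExp_detected hp hΓ,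
    hp.integrableOn_condProb_mul_fZ hΓ.le, hnet.measureReal_detected hp hΓ⟩
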